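/- Let $k$ be a field, $P$ a poset all of whose intervals $[x,y]=\{z: x\le z\le y\}$ are finite, and $\sim$ an equivalence relation on the set $\mathrm{Int}(P)$ of closed intervals $[x,y]$, $x\le y$. Write $\widetilde{[x,y]}$ for the class of $[x,y]$; write $x\sim y$ if $[x,x]\sim[y,y]$, $\tilde x$ for the class of $x$, and $P/\!\sim$ for the set of these classes. Assume: 1. (order-compatibility) if $[x,y]\sim[x',y']$ and $[y,z]\sim[y',z']$, then $[x,z]\sim[x',z']$; 2. (invariance) if $[x,y]\sim[x',y']$, there is exactly one map $\tau:[x,y]\to[x',y']$ such that $[x,z]\sim[x',\tau(z)]$ and $[z,y]\sim[\tau(z),y']$ for all $z\in[x,y]$; 3. (finiteness) $P/\!\sim$ is finite; 4. (concatenation) if $x\le y_1$, $y_2\le z$ and $y_1\sim y_2$, there are $x'\le y'\le z'$ with $[x',y']\sim[x,y_1]$ and $[y',z']\sim[y_2,z]$. Then each class $\alpha=\widetilde{[x,y]}$ has a well-defined source $s(\alpha)=\tilde x$ and target $t(\alpha)=\tilde y$. Let $A=k[P]_{\mathrm{red}}$ be the reduced incidence algebra: the $k$-algebra with basis $\{\xi_\alpha\}_{\alpha\in\mathrm{Int}(P)/\sim}$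 in which $\xi_\alpha\xi_\beta=\xi_\gamma$ if there are $x\le y\le z$ with $\widetilde{[x,y]}=\alpha$, $\widetilde{[y,z]}=\beta$, $\widetilde{[x,z]}=\gamma$, and $\xi_\alpha\xi_\beta=0$ otherwise. Let $I\subset A$ be the two-sided ideal spanned by the $\xi_{\widetilde{[x,y]}}$ with $x<y$, and let $R=\mathrm{gr}_I A=\bigoplus_{d\ge0}I^d/I^{d+1}$, an $\mathbb N$-graded ring. For $\tilde x\in P/\!\sim$ let $k_{\tilde x}$ be the one-dimensional left and right $R$-module, concentrated in degree $0$, on which $R$ acts through $R\to R_0=A/I\cong\prod_{\tilde z\in P/\sim}k\,\xi_{\tilde z}\to k\,\xi_{\tilde x}\cong k$, where $\xi_{\tilde z}=\xi_{\widetilde{[z,z]}}$. For each class $\alpha$ fix a representative $[x(\alpha),y(\alpha)]$, and let $\Delta_\alpha$ be the order complex of the open interval $(x(\alpha),y(\alpha))$, i.e. the simplicial complex of its finite chains, the empty face of dimension $-1$ included. For a simplicial complex $\Delta$ and $j\in\mathbb Z$ let $\Delta^{\langle j\rangle}$ be the subcomplex generated by all faces of dimension at least $j$. For graded $R$-modules,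 let $\mathrm{Tor}^R_i(-,-)_j$ be the component of internal degree $j$ of $\mathrm{Tor}^R_i$, computed from a graded projective resolution. Then for all $\tilde x,\tilde y\in P/\!\sim$: $\mathrm{Tor}^R_0(k_{\tilde x},k_{\tilde y})$ is isomorphic to $k$ and concentrated in degree $0$ if $\tilde x=\tilde y$, and it vanishes if $\tilde x\ne\tilde y$; and for all $i\ge1$ and $j\in\mathbb Z$ there is an isomorphism of $k$-vector spaces $$\mathrm{Tor}^R_i(k_{\tilde x},k_{\tilde y})_j\;\cong\;\bigoplus_{\alpha}\tilde H_{i-2}\bigl(\Delta_\alpha^{\langle j-2\rangle},\Delta_\alpha^{\langle j-1\rangle};k\bigr),$$ the sum running over all $\alpha\in\mathrm{Int}(P)/\!\sim$ with $s(\alpha)=\tilde x$, $t(\alpha)=\tilde y$ that are classes of intervals $[x,y]$ with $x<y$. Here $\tilde H$ denotes relative reduced simplicial homology. -/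

import Mathlib

universe u v w

open DirectSum TensorProduct

namespace RedInc

section AssociatedGraded

variable (k : Type v) [Field k] {A : Type u} [Ring A] [Algebra k A] (I : Ideal A)

/-- The homogeneous component `I ^ d / I ^ (d + 1)`. -/
abbrev GrPiece (d : ℕ) : Type u := ↥(I ^ d) ⧸ (I ^ (d + 1)).submoduleOf (I ^ d)

variable {I}

/-- The class in `I ^ d / I ^ (d + 1)` of an element of `I ^ d`. -/
def grMk {d : ℕ} (a : A) (ha : a ∈ I ^ d) : GrPiece I d :=
  Submodule.Quotient.mk ⟨a, ha⟩

theorem grMk_surj {d : ℕ} (x : GrPiece I d) : ∃ a, ∃ ha : a ∈ I ^ d, x = grMk a ha := by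
  obtain ⟨⟨a, ha⟩, rfl⟩ := Submodule.Quotient.mk_surjective _ x
  exact ⟨a, ha, rfl⟩

theorem grMk_eq {d : ℕ} {a b : A} (ha : a ∈ I ^ d) (hb : b ∈ I ^ d) :
    grMk a ha = grMk b hb ↔ a - b ∈ I ^ (d + 1) := by
  unfold grMk
  rw [Submodule.Quotient.eq]
  rfl

theorem gradedMonoid_mk_grMk {m n : ℕ} {a b : A} (ha : a ∈ I ^ m) (hb : b ∈ I ^ n)
    (hmn : m = n) (hab : a = b) :
    GradedMonoid.mk (A := GrPiece I) m (grMk a ha) = GradedMonoid.mk n (grMk b hb) := by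
  subst hmn
  subst hab
  rfl

theorem one_mem_pow_zero : (1 : A) ∈ I ^ 0 := by
  rw [Submodule.pow_zero, Ideal.one_eq_top]
  trivial

variable [I.IsTwoSided]

theorem mul_mem_pow_add {m n : ℕ} {a b : A} (ha : a ∈ I ^ m) (hb : b ∈ I ^ n) :
    a * b ∈ I ^ (m + n) := by
  rw [Ideal.IsTwoSided.pow_add]
  exact Ideal.mul_mem_mul ha hb

/-- The multiplication `(a + I ^ (m + 1)) (b + I ^ (n + 1)) = a b + I ^ (m + n + 1)`. -/
def grMul {m n : ℕ} (x : GrPiece I m) (y : GrPiece I n) : GrPiece I (m + n) :=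
  Quotient.map₂ (fun a b => (⟨a.1 * b.1, mul_mem_pow_add a.2 b.2⟩ : ↥(I ^ (m + n))))
    (by
      rintro ⟨a, ha⟩ ⟨a', ha'⟩ h ⟨b, hb⟩ ⟨b', hb'⟩ h'
      have h1 : a - a' ∈ I ^ (m + 1) := by
        have : (⟨a, ha⟩ - ⟨a', ha'⟩ : ↥(I ^ m)) ∈ (I ^ (m + 1)).submoduleOf (I ^ m) :=
          (Submodule.quotientRel_def _).1 h
        exact this
      have h2 : b - b' ∈ I ^ (n + 1) := by
        have : (⟨b, hb⟩ - ⟨b', hb'⟩ : ↥(I ^ n)) ∈ (I ^ (n + 1)).submoduleOf (I ^ n) :=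
          (Submodule.quotientRel_def _).1 h'
        exact this
      refine (Submodule.quotientRel_def _).2 ?_
      change a * b - a' * b' ∈ I ^ (m + n + 1)
      have e : a * b - a' * b' = (a - a') * b + a' * (b - b') := by noncomm_ring
      rw [e]
      refine Ideal.add_mem _ ?_ ?_
      · have := mul_mem_pow_add h1 hb
        rwa [show m + 1 + n = m + n + 1 by ring] at this
      · have := mul_mem_pow_add ha' h2
        rwa [← add_assoc] at this) x y

theorem grMul_mk {m n : ℕ} {a b : A} (ha : a ∈ I ^ m) (hb : b ∈ I ^ n) :
    grMul (grMk a ha) (grMk b hb) = grMk (a * b) (mul_mem_pow_add ha hb) := rfl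

instance grGMul : GradedMonoid.GMul (GrPiece I) where
  mul := grMul

instance grGOne : GradedMonoid.GOne (GrPiece I) where
  one := grMk 1 one_mem_pow_zero

instance grMonoid : GradedMonoid.GMonoid (GrPiece I) where
  one_mul := by
    rintro ⟨m, x⟩
    obtain ⟨a, ha, rfl⟩ := grMk_surj x
    exact gradedMonoid_mk_grMk _ _ (zero_add m) (one_mul a)
  mul_one := by
    rintro ⟨m, x⟩
    obtain ⟨a, ha, rfl⟩ := grMk_surj x
    exact gradedMonoid_mk_grMk _ _ (add_zero m) (mul_one a)
  mul_assoc := by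
    rintro ⟨m, x⟩ ⟨n, y⟩ ⟨l, z⟩
    obtain ⟨a, ha, rfl⟩ := grMk_surj x
    obtain ⟨b, hb, rfl⟩ := grMk_surj y
    obtain ⟨c, hc, rfl⟩ := grMk_surj z
    exact gradedMonoid_mk_grMk _ _ (add_assoc m n l) (mul_assoc a b c)

instance grRing : DirectSum.GRing (GrPiece I) where
  __ := grMonoid
  mul_zero {m n} x := by
    obtain ⟨a, ha, rfl⟩ := grMk_surj x
    change grMul (grMk a ha) (grMk 0 (zero_mem _)) = grMk 0 (zero_mem _)
    simp [grMul_mk]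
  zero_mul {m n} x := by
    obtain ⟨a, ha, rfl⟩ := grMk_surj x
    change grMul (grMk 0 (zero_mem _)) (grMk a ha) = grMk 0 (zero_mem _)
    simp [grMul_mk]
  mul_add {m n} x y z := by
    obtain ⟨a, ha, rfl⟩ := grMk_surj x
    obtain ⟨b, hb, rfl⟩ := grMk_surj y
    obtain ⟨c, hc, rfl⟩ := grMk_surj z
    change grMk (a * (b + c)) _ = grMk (a * b + a * c) (add_mem (mul_mem_pow_add ha hb) (mul_mem_pow_add ha hc))
    simp [mul_add]
  add_mul {m n} x y z := by
    obtain ⟨a, ha, rfl⟩ := grMk_surj x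
    obtain ⟨b, hb, rfl⟩ := grMk_surj y
    obtain ⟨c, hc, rfl⟩ := grMk_surj z
    change grMk ((a + b) * c) _ = grMk (a * c + b * c) (add_mem (mul_mem_pow_add ha hc) (mul_mem_pow_add hb hc))
    simp [add_mul]
  natCast n := n • grMk 1 one_mem_pow_zero
  natCast_zero := zero_nsmul _
  natCast_succ n := by rw [succ_nsmul]; rfl
  intCast n := n • grMk 1 one_mem_pow_zero
  intCast_ofNat n := natCast_zsmul _ n
  intCast_negSucc_ofNat n := by rw [negSucc_zsmul]

instance grAlgebra : DirectSum.GAlgebra k (GrPiece I) where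
  toFun := (LinearMap.toSpanSingleton k (GrPiece I 0) (grMk 1 one_mem_pow_zero)).toAddMonoidHom
  map_one := one_smul k (grMk (I := I) 1 one_mem_pow_zero)
  map_mul r s := by
    refine gradedMonoid_mk_grMk (a := (r * s) • 1) (b := (r • 1) * (s • 1)) _ _ rfl ?_
    rw [smul_mul_smul_comm, mul_one]
  commutes := by
    rintro r ⟨m, x⟩
    obtain ⟨a, ha, rfl⟩ := grMk_surj x
    refine gradedMonoid_mk_grMk (a := (r • 1) * a) (b := a * (r • 1)) _ _ (Nat.add_comm 0 m) ?_
    simp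
  smul_def := by
    rintro r ⟨m, x⟩
    obtain ⟨a, ha, rfl⟩ := grMk_surj x
    refine gradedMonoid_mk_grMk (a := r • a) (b := (r • 1) * a) _ _ (Nat.zero_add m).symm ?_
    simp

/-- The map `a + I ^ (d + 1) ↦ f a` on `I ^ d / I ^ (d + 1)`, for a linear form `f` on `A` which
vanishes on `I`. -/
def grLift (f : A →ₗ[k] k) (hf : ∀ a ∈ I, f a = 0) (d : ℕ) : GrPiece I d →ₗ[k] k where
  toFun := Quotient.lift (fun a : ↥(I ^ d) => f a.1) (by
    rintro ⟨a, ha⟩ ⟨b, hb⟩ h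
    have h1 : (⟨a, ha⟩ - ⟨b, hb⟩ : ↥(I ^ d)) ∈ (I ^ (d + 1)).submoduleOf (I ^ d) :=
      (Submodule.quotientRel_def _).1 h
    have h2 : a - b ∈ I ^ (d + 1) := h1
    rw [Submodule.pow_succ] at h2
    have h3 := hf _ (Ideal.mul_le_right h2)
    rwa [map_sub, sub_eq_zero] at h3)
  map_add' x y := by
    obtain ⟨a, ha, rfl⟩ := grMk_surj x
    obtain ⟨b, hb, rfl⟩ := grMk_surj y
    exact map_add f a b
  map_smul' c x := by
    obtain ⟨a, ha, rfl⟩ := grMk_surj x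
    exact map_smul f c a

/-- The associated graded ring `gr_I A = ⨁ d, I ^ d / I ^ (d + 1)`. -/
abbrev GrRing {A : Type u} [Ring A] (I : Ideal A) : Type u := ⨁ d, GrPiece I d

end AssociatedGraded

section Axioms

variable {P : Type u} [PartialOrder P]

/-- The closed interval `[x, y]`, as an element of `Int(P)`. -/
def iv (x y : P) (h : x ≤ y) : NonemptyInterval P := ⟨(x, y), h⟩

/-- The axioms on an equivalence relation `∼` on the set `Int(P)` of closed intervals of `P`. -/
class IncidenceAxioms (r : Setoid (NonemptyInterval P)) : Prop where
  /-- Order-compatibility. -/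
  order_compat : ∀ {x y z x' y' z' : P} (hxy : x ≤ y) (hyz : y ≤ z) (hxy' : x' ≤ y')
    (hyz' : y' ≤ z'), r (iv x y hxy) (iv x' y' hxy') → r (iv y z hyz) (iv y' z' hyz') →
      r (iv x z (hxy.trans hyz)) (iv x' z' (hxy'.trans hyz'))
  /-- Invariance: existence and uniqueness of a map `τ : [x, y] → [x', y']` commuting with the
  interval mappings `z ↦ ([x, z]~, [z, y]~)`. -/
  invariance : ∀ {x y x' y' : P} (hxy : x ≤ y) (hxy' : x' ≤ y'),
    r (iv x y hxy) (iv x' y' hxy') →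
      ∃! τ : Set.Icc x y → Set.Icc x' y', ∀ z : Set.Icc x y,
        r (iv x z z.2.1) (iv x' (τ z) (τ z).2.1) ∧ r (iv z y z.2.2) (iv (τ z) y' (τ z).2.2)
  /-- Finiteness: the relation `x ∼ y ↔ [x, x] ∼ [y, y]` on `P` has finitely many classes. -/
  finite_classes : Finite (Quotient (Setoid.comap (NonemptyInterval.pure (α := P)) r))
  /-- Concatenation. -/
  concatenation : ∀ {x y₁ y₂ z : P} (hx : x ≤ y₁) (hz : y₂ ≤ z),
    r (NonemptyInterval.pure y₁) (NonemptyInterval.pure y₂) →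
      ∃ (x' y' z' : P) (hx' : x' ≤ y') (hz' : y' ≤ z'),
        r (iv x' y' hx') (iv x y₁ hx) ∧ r (iv y' z' hz') (iv y₂ z hz)

variable (r : Setoid (NonemptyInterval P))

/-- `Int(P)/∼`. -/
abbrev IntClass : Type u := Quotient r

/-- `P/∼`, where `x ∼ y` means `[x, x] ∼ [y, y]`. -/
abbrev PointClass : Type u := Quotient (Setoid.comap (NonemptyInterval.pure (α := P)) r)

variable {r}

/-- The class of `[x, y]` in `Int(P)/∼`. -/
def cls (x y : P) (h : x ≤ y) : IntClass r := Quotient.mk r (iv x y h)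

theorem cls_eq {x y x' y' : P} {h : x ≤ y} {h' : x' ≤ y'} :
    cls (r := r) x y h = cls x' y' h' ↔ r (iv x y h) (iv x' y' h') := Quotient.eq

theorem exists_cls (α : IntClass r) : ∃ x y h, α = cls x y h := by
  induction α using Quotient.inductionOn with
  | h I => exact ⟨I.fst, I.snd, I.fst_le_snd, rfl⟩

/-- The class of `[x, x]`, for a class of points. -/
def pointInt : PointClass r → IntClass r :=
  Quotient.map NonemptyInterval.pure fun _ _ h => h

theorem pointInt_mk (x : P) : pointInt (r := r) (Quotient.mk _ x) = cls x x le_rfl := rfl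

theorem pointInt_injective : Function.Injective (pointInt (r := r)) := by
  intro X Y
  induction X using Quotient.inductionOn with
  | h x =>
    induction Y using Quotient.inductionOn with
    | h y => exact fun h => Quotient.sound (cls_eq.1 h)

/-- A class is proper if it is the class of an interval `[x, y]` with `x < y`. -/
def IsProper (α : IntClass r) : Prop := ∃ (x y : P) (h : x < y), cls x y h.le = α

/-- There are `x ≤ y ≤ z` with `[x, y] ∈ α`, `[y, z] ∈ β` and `[x, z] ∈ γ`. -/
def Composes (α β γ : IntClass r) : Prop :=
  ∃ (x y z : P) (hxy : x ≤ y) (hyz : y ≤ z),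
    cls x y hxy = α ∧ cls y z hyz = β ∧ cls x z (hxy.trans hyz) = γ

variable [IncidenceAxioms r]

theorem Composes.unique {α β γ γ' : IntClass r} (h : Composes α β γ) (h' : Composes α β γ') :
    γ = γ' := by
  obtain ⟨x, y, z, hxy, hyz, rfl, rfl, rfl⟩ := h
  obtain ⟨x', y', z', hxy', hyz', h1, h2, rfl⟩ := h'
  exact (cls_eq.2 (IncidenceAxioms.order_compat hxy' hyz' hxy hyz (cls_eq.1 h1)
    (cls_eq.1 h2))).symm

/-- An interval equivalent to a one-point interval is a one-point interval. -/
theorem eq_of_cls_eq_point {u v x : P} (huv : u ≤ v)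
    (h : cls (r := r) u v huv = cls x x le_rfl) : u = v := by
  obtain ⟨τ, hτ, -⟩ := IncidenceAxioms.invariance huv le_rfl (cls_eq.1 h)
  obtain ⟨σ, hσ, -⟩ := IncidenceAxioms.invariance le_rfl huv (cls_eq.1 h.symm)
  have hid := (IncidenceAxioms.invariance (r := r) huv huv (Setoid.refl' r _)).unique
    (y₁ := id) (y₂ := σ ∘ τ) (fun z => ⟨Setoid.refl' r _, Setoid.refl' r _⟩)
    (fun z => ⟨Setoid.trans' r (hτ z).1 (hσ (τ z)).1, Setoid.trans' r (hτ z).2 (hσ (τ z)).2⟩)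
  have hs : ∀ a b : Set.Icc x x, a = b := fun a b =>
    Subtype.ext ((le_antisymm a.2.2 a.2.1).trans (le_antisymm b.2.2 b.2.1).symm)
  have e1 := congrFun hid ⟨u, le_rfl, huv⟩
  have e2 := congrFun hid ⟨v, huv, le_rfl⟩
  simp only [id, Function.comp] at e1 e2
  rw [hs (τ ⟨u, le_rfl, huv⟩) (τ ⟨v, huv, le_rfl⟩), ← e2] at e1
  exact congrArg Subtype.val e1

theorem lt_of_cls_eq {u v x y : P} (huv : u ≤ v) (hxy : x < y)
    (h : cls (r := r) u v huv = cls x y hxy.le) : u < v := by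
  refine lt_of_le_of_ne huv ?_
  rintro rfl
  exact hxy.ne (eq_of_cls_eq_point hxy.le h.symm)

theorem source_eq {x y x' y' : P} {h : x ≤ y} {h' : x' ≤ y'}
    (e : cls (r := r) x y h = cls x' y' h') : cls (r := r) x x le_rfl = cls x' x' le_rfl := by
  obtain ⟨τ, hτ, -⟩ := IncidenceAxioms.invariance h h' (cls_eq.1 e)
  have h1 := cls_eq.2 (hτ ⟨x, le_rfl, h⟩).1
  have h2 := eq_of_cls_eq_point _ h1.symm
  rw [h1]
  congr 1
  exact h2.symm

theorem target_eq {x y x' y' : P} {h : x ≤ y} {h' : x' ≤ y'}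
    (e : cls (r := r) x y h = cls x' y' h') : cls (r := r) y y le_rfl = cls y' y' le_rfl := by
  obtain ⟨τ, hτ, -⟩ := IncidenceAxioms.invariance h h' (cls_eq.1 e)
  have h1 := cls_eq.2 (hτ ⟨y, h, le_rfl⟩).2
  have h2 := eq_of_cls_eq_point _ h1.symm
  rw [h1]
  congr 1

/-- The source map `s : Int(P)/∼ → P/∼`, `[x, y]~ ↦ x~`. -/
def source : IntClass r → PointClass r :=
  Quotient.lift (fun I => Quotient.mk _ I.fst) fun I J h =>
    Quotient.sound (cls_eq.1 (source_eq (r := r) (h := I.fst_le_snd) (h' := J.fst_le_snd)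
      (Quotient.sound h)))

/-- The target map `t : Int(P)/∼ → P/∼`, `[x, y]~ ↦ y~`. -/
def target : IntClass r → PointClass r :=
  Quotient.lift (fun I => Quotient.mk _ I.snd) fun I J h =>
    Quotient.sound (cls_eq.1 (target_eq (r := r) (h := I.fst_le_snd) (h' := J.fst_le_snd)
      (Quotient.sound h)))

theorem composes_assoc (α β γ δ : IntClass r) :
    (∃ ε, Composes α β ε ∧ Composes ε γ δ) ↔ ∃ ε, Composes β γ ε ∧ Composes α ε δ := by
  constructor
  · rintro ⟨ε, ⟨x, y, z, hxy, hyz, rfl, rfl, rfl⟩, x', z', w', hxz', hzw', h1, rfl, rfl⟩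
    obtain ⟨τ, hτ, -⟩ := IncidenceAxioms.invariance (hxy.trans hyz) hxz' (cls_eq.1 h1.symm)
    have h2 := hτ ⟨y, hxy, hyz⟩
    have hm := (τ ⟨y, hxy, hyz⟩).2
    exact ⟨cls (τ ⟨y, hxy, hyz⟩) w' (hm.2.trans hzw'),
      ⟨_, z', w', hm.2, hzw', (cls_eq.2 h2.2).symm, rfl, rfl⟩,
      ⟨x', _, w', hm.1, hm.2.trans hzw', (cls_eq.2 h2.1).symm, rfl, rfl⟩⟩
  · rintro ⟨ε, ⟨y, z, w, hyz, hzw, rfl, rfl, rfl⟩, x', y', w', hxy', hyw', rfl, h1, rfl⟩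
    obtain ⟨τ, hτ, -⟩ := IncidenceAxioms.invariance (hyz.trans hzw) hyw' (cls_eq.1 h1.symm)
    have h2 := hτ ⟨z, hyz, hzw⟩
    have hm := (τ ⟨z, hyz, hzw⟩).2
    exact ⟨cls x' (τ ⟨z, hyz, hzw⟩) (hxy'.trans hm.1),
      ⟨x', y', _, hxy', hm.1, rfl, (cls_eq.2 h2.1).symm, rfl⟩,
      ⟨x', _, w', hxy'.trans hm.1, hm.2, rfl, (cls_eq.2 h2.2).symm, rfl⟩⟩

theorem pointInt_composes {X : PointClass r} {α γ : IntClass r} :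
    Composes (pointInt X) α γ ↔ X = source α ∧ γ = α := by
  induction X using Quotient.inductionOn with
  | h x =>
    constructor
    · rintro ⟨u, v, w, huv, hvw, h1, rfl, rfl⟩
      obtain rfl : u = v := eq_of_cls_eq_point huv h1
      exact ⟨pointInt_injective h1.symm, rfl⟩
    · rintro ⟨h, rfl⟩
      obtain ⟨y, z, hyz, rfl⟩ := exists_cls γ
      exact ⟨y, y, z, le_rfl, hyz, congrArg pointInt h.symm, rfl, rfl⟩

theorem composes_pointInt {X : PointClass r} {α γ : IntClass r} :
    Composes α (pointInt X) γ ↔ X = target α ∧ γ = α := by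
  induction X using Quotient.inductionOn with
  | h x =>
    constructor
    · rintro ⟨u, v, w, huv, hvw, rfl, h1, rfl⟩
      obtain rfl : v = w := eq_of_cls_eq_point hvw h1
      exact ⟨pointInt_injective h1.symm, rfl⟩
    · rintro ⟨h, rfl⟩
      obtain ⟨y, z, hyz, rfl⟩ := exists_cls γ
      exact ⟨y, z, z, hyz, le_rfl, rfl, congrArg pointInt h.symm, rfl⟩

theorem composes_eq_pointInt {X : PointClass r} {α β : IntClass r}
    (h : Composes α β (pointInt X)) : α = pointInt X ∧ β = pointInt X := by
  induction X using Quotient.inductionOn with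
  | h x =>
    obtain ⟨u, v, w, huv, hvw, rfl, rfl, h1⟩ := h
    obtain rfl : u = w := eq_of_cls_eq_point (huv.trans hvw) h1
    obtain rfl : u = v := le_antisymm huv hvw
    exact ⟨h1, h1⟩

theorem not_isProper_pointInt (X : PointClass r) : ¬ IsProper (pointInt X) := by
  induction X using Quotient.inductionOn with
  | h x =>
    rintro ⟨u, v, huv, h⟩
    exact huv.ne (eq_of_cls_eq_point huv.le h)

theorem IsProper.of_left {α β γ : IntClass r} (hα : IsProper α) (h : Composes α β γ) :
    IsProper γ := by
  obtain ⟨u, v, huv, rfl⟩ := hα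
  obtain ⟨x, y, z, hxy, hyz, h1, rfl, rfl⟩ := h
  exact ⟨x, z, (lt_of_cls_eq hxy huv h1).trans_le hyz, rfl⟩

theorem IsProper.of_right {α β γ : IntClass r} (hβ : IsProper β) (h : Composes α β γ) :
    IsProper γ := by
  obtain ⟨u, v, huv, rfl⟩ := hβ
  obtain ⟨x, y, z, hxy, hyz, rfl, h1, rfl⟩ := h
  exact ⟨x, z, hxy.trans_lt (lt_of_cls_eq hyz huv h1), rfl⟩

end Axioms

section Algebra

variable {P : Type u} [PartialOrder P] (k : Type v) [Field k] (r : Setoid (NonemptyInterval P))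

/-- The reduced incidence algebra `k[P]_red`: the `k`-vector space with basis `Int(P)/∼`. -/
def RedAlg : Type (max u v) := IntClass r →₀ k

noncomputable instance : AddCommGroup (RedAlg k r) := inferInstanceAs (AddCommGroup (IntClass r →₀ k))

noncomputable instance : Module k (RedAlg k r) := inferInstanceAs (Module k (IntClass r →₀ k))

variable {r}

/-- The basis vector `ξ_α`. -/
noncomputable def xi (α : IntClass r) : RedAlg k r := Finsupp.single α 1

open Classical in
/-- The product of two basis vectors: `ξ_α ξ_β = ξ_γ` if there are `x ≤ y ≤ z` with
`[x, y] ∈ α`, `[y, z] ∈ β` and `[x, z] ∈ γ`, and `ξ_α ξ_β = 0` otherwise. -/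
noncomputable def xiMul (α β : IntClass r) : RedAlg k r :=
  if h : ∃ γ, Composes α β γ then xi k h.choose else 0

/-- The bilinear extension of `xiMul`. -/
noncomputable def mulLin : RedAlg k r →ₗ[k] RedAlg k r →ₗ[k] RedAlg k r :=
  Finsupp.linearCombination k fun α => Finsupp.linearCombination k fun β => xiMul k α β

variable {k}

theorem mulLin_xi (α β : IntClass r) : mulLin k (xi k α) (xi k β) = xiMul k α β := by
  unfold mulLin xi
  erw [Finsupp.linearCombination_single, one_smul, Finsupp.linearCombination_single, one_smul]

theorem lin_ext {M : Type*} [AddCommMonoid M] [Module k M] {f g : RedAlg k r →ₗ[k] M}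
    (h : ∀ α, f (xi k α) = g (xi k α)) : f = g :=
  Finsupp.lhom_ext' fun α => LinearMap.ext_ring (h α)

theorem xiMul_of_not {α β : IntClass r} (h : ¬ ∃ γ, Composes α β γ) : xiMul k α β = 0 :=
  dif_neg h

variable [IncidenceAxioms r]

theorem xiMul_of {α β γ : IntClass r} (h : Composes α β γ) : xiMul k α β = xi k γ := by
  have h' : ∃ γ, Composes α β γ := ⟨γ, h⟩
  rw [xiMul, dif_pos h', h'.choose_spec.unique h]

theorem mul_assoc_xi (α β γ : IntClass r) :
    mulLin k (xiMul k α β) (xi k γ) = mulLin k (xi k α) (xiMul k β γ) := by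
  by_cases h : ∃ δ, ∃ ε, Composes α β ε ∧ Composes ε γ δ
  · obtain ⟨δ, h⟩ := h
    obtain ⟨ε', h1', h2'⟩ := (composes_assoc α β γ δ).1 h
    obtain ⟨ε, h1, h2⟩ := h
    rw [xiMul_of h1, xiMul_of h1', mulLin_xi, mulLin_xi, xiMul_of h2, xiMul_of h2']
  · have e1 : mulLin k (xiMul k α β) (xi k γ) = 0 := by
      by_cases hε : ∃ ε, Composes α β ε
      · obtain ⟨ε, hε⟩ := hε
        rw [xiMul_of hε, mulLin_xi, xiMul_of_not]
        exact fun ⟨δ, hδ⟩ => h ⟨δ, ε, hε, hδ⟩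
      · rw [xiMul_of_not hε, map_zero, LinearMap.zero_apply]
    have e2 : mulLin k (xi k α) (xiMul k β γ) = 0 := by
      by_cases hε : ∃ ε, Composes β γ ε
      · obtain ⟨ε, hε⟩ := hε
        rw [xiMul_of hε, mulLin_xi, xiMul_of_not]
        exact fun ⟨δ, hδ⟩ => h ⟨δ, (composes_assoc α β γ δ).2 ⟨ε, hε, hδ⟩⟩
      · rw [xiMul_of_not hε, map_zero]
    rw [e1, e2]

theorem mulLin_assoc (a b c : RedAlg k r) :
    mulLin k (mulLin k a b) c = mulLin k a (mulLin k b c) := by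
  have h1 : ∀ α β : IntClass r, mulLin k (mulLin k (xi k α) (xi k β)) =
      mulLin k (xi k α) ∘ₗ mulLin k (xi k β) := fun α β => lin_ext fun γ => by
    rw [LinearMap.comp_apply, mulLin_xi, mulLin_xi, mul_assoc_xi]
  have h2 : ∀ α : IntClass r, (mulLin k).flip c ∘ₗ mulLin k (xi k α) =
      mulLin k (xi k α) ∘ₗ (mulLin k).flip c := fun α => lin_ext fun β =>
    LinearMap.congr_fun (h1 α β) c
  have h3 : (mulLin k).flip c ∘ₗ (mulLin k).flip b = (mulLin k).flip (mulLin k b c) :=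
    lin_ext fun α => LinearMap.congr_fun (h2 α) b
  exact LinearMap.congr_fun h3 a

variable (k r) in
/-- The unit `∑ ξ_x~`, summed over the finite set `P/∼`. -/
noncomputable def redOne : RedAlg k r :=
  letI := IncidenceAxioms.finite_classes (r := r)
  letI := Fintype.ofFinite (PointClass r)
  ∑ X : PointClass r, xi k (pointInt X)

open Classical in
theorem xiMul_pointInt_left (X : PointClass r) (α : IntClass r) :
    xiMul k (pointInt X) α = if X = source α then xi k α else 0 := by
  split_ifs with h
  · exact xiMul_of (pointInt_composes.2 ⟨h, rfl⟩)
  · exact xiMul_of_not fun ⟨γ, hγ⟩ => h (pointInt_composes.1 hγ).1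

open Classical in
theorem xiMul_pointInt_right (X : PointClass r) (α : IntClass r) :
    xiMul k α (pointInt X) = if X = target α then xi k α else 0 := by
  split_ifs with h
  · exact xiMul_of (composes_pointInt.2 ⟨h, rfl⟩)
  · exact xiMul_of_not fun ⟨γ, hγ⟩ => h (composes_pointInt.1 hγ).1

theorem redOne_mulLin (a : RedAlg k r) : mulLin k (redOne k r) a = a := by
  classical
  have h : mulLin k (redOne k r) = LinearMap.id := lin_ext fun α => by
    simp [redOne, mulLin_xi, xiMul_pointInt_left]
  rw [h, LinearMap.id_apply]

theorem mulLin_redOne (a : RedAlg k r) : mulLin k a (redOne k r) = a := by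
  classical
  have h : (mulLin k).flip (redOne k r) = LinearMap.id := lin_ext fun α => by
    simp [redOne, mulLin_xi, xiMul_pointInt_right]
  exact LinearMap.congr_fun h a

noncomputable instance : Ring (RedAlg k r) where
  __ := (inferInstance : AddCommGroup (RedAlg k r))
  mul a b := mulLin k a b
  one := redOne k r
  left_distrib a b c := map_add (mulLin k a) b c
  right_distrib a b c := LinearMap.map_add₂ (mulLin k) a b c
  zero_mul a := LinearMap.map_zero₂ (mulLin k) a
  mul_zero a := map_zero (mulLin k a)
  mul_assoc := mulLin_assoc
  one_mul := redOne_mulLin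
  mul_one := mulLin_redOne

theorem red_mul_def (a b : RedAlg k r) : a * b = mulLin k a b := rfl

noncomputable instance : Algebra k (RedAlg k r) :=
  Algebra.ofModule (fun c a b => LinearMap.map_smul₂ (mulLin k) c a b)
    (fun c a b => map_smul (mulLin k a) c b)

theorem red_induction {p : RedAlg k r → Prop} (a : RedAlg k r) (h0 : p 0)
    (hadd : ∀ a b, p a → p b → p (a + b)) (hsmul : ∀ (c : k) a, p a → p (c • a))
    (hxi : ∀ α, p (xi k α)) : p a := by
  refine Finsupp.induction_linear (motive := p) a h0 hadd fun α c => ?_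
  have : Finsupp.single α c = c • xi k α := by
    unfold xi
    erw [Finsupp.smul_single, smul_eq_mul, mul_one]
  erw [this]
  exact hsmul _ _ (hxi α)

theorem mul_xi_mem (a : RedAlg k r) {β : IntClass r} (hβ : IsProper β) :
    a * xi k β ∈ Submodule.span k (Set.range fun γ : {γ : IntClass r // IsProper γ} => xi k γ.1) := by
  induction a using red_induction with
  | h0 => rw [zero_mul]; exact zero_mem _
  | hadd a b ha hb => rw [add_mul]; exact add_mem ha hb
  | hsmul c a ha => rw [smul_mul_assoc]; exact Submodule.smul_mem _ _ ha
  | hxi α =>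
    rw [red_mul_def, mulLin_xi]
    by_cases h : ∃ γ, Composes α β γ
    · obtain ⟨γ, h⟩ := h
      rw [xiMul_of h]
      exact Submodule.subset_span ⟨⟨γ, hβ.of_right h⟩, rfl⟩
    · rw [xiMul_of_not h]
      exact zero_mem _

theorem xi_mul_mem (a : RedAlg k r) {β : IntClass r} (hβ : IsProper β) :
    xi k β * a ∈ Submodule.span k (Set.range fun γ : {γ : IntClass r // IsProper γ} => xi k γ.1) := by
  induction a using red_induction with
  | h0 => rw [mul_zero]; exact zero_mem _
  | hadd a b ha hb => rw [mul_add]; exact add_mem ha hb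
  | hsmul c a ha => rw [mul_smul_comm]; exact Submodule.smul_mem _ _ ha
  | hxi α =>
    rw [red_mul_def, mulLin_xi]
    by_cases h : ∃ γ, Composes β α γ
    · obtain ⟨γ, h⟩ := h
      rw [xiMul_of h]
      exact Submodule.subset_span ⟨⟨γ, hβ.of_left h⟩, rfl⟩
    · rw [xiMul_of_not h]
      exact zero_mem _

variable (k r) in
/-- The ideal `I` of `k[P]_red`: the `k`-span of the `ξ_α` with `α` the class of an interval
`[x, y]`, `x < y`. -/
noncomputable def redIdeal : Ideal (RedAlg k r) where
  __ := Submodule.span k (Set.range fun γ : {γ : IntClass r // IsProper γ} => xi k γ.1)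
  smul_mem' c x hx := by
    change c * x ∈ Submodule.span k _
    change x ∈ Submodule.span k _ at hx
    induction hx using Submodule.span_induction with
    | mem x hx =>
      obtain ⟨γ, rfl⟩ := hx
      exact mul_xi_mem c γ.2
    | zero => rw [mul_zero]; exact zero_mem _
    | add x y _ _ hx hy => rw [mul_add]; exact add_mem hx hy
    | smul a x _ hx => rw [mul_smul_comm]; exact Submodule.smul_mem _ _ hx

theorem mem_redIdeal {x : RedAlg k r} : x ∈ redIdeal k r ↔
    x ∈ Submodule.span k (Set.range fun γ : {γ : IntClass r // IsProper γ} => xi k γ.1) := Iff.rfl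

instance : (redIdeal k r).IsTwoSided where
  mul_mem_of_left {x} b hx := by
    rw [mem_redIdeal] at hx ⊢
    induction hx using Submodule.span_induction with
    | mem x hx =>
      obtain ⟨γ, rfl⟩ := hx
      exact xi_mul_mem b γ.2
    | zero => rw [zero_mul]; exact zero_mem _
    | add x y _ _ hx hy => rw [add_mul]; exact add_mem hx hy
    | smul a x _ hx => rw [smul_mul_assoc]; exact Submodule.smul_mem _ _ hx

/-- The coefficient of `ξ_x~`, as a linear form on `k[P]_red`. -/
noncomputable def pointCoeff (X : PointClass r) : RedAlg k r →ₗ[k] k :=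
  Finsupp.lapply (pointInt X)

open Classical in
theorem pointCoeff_xi (X : PointClass r) (α : IntClass r) :
    pointCoeff X (xi k α) = if α = pointInt X then 1 else 0 :=
  Finsupp.single_apply

theorem pointCoeff_mul (X : PointClass r) (a b : RedAlg k r) :
    pointCoeff X (a * b) = pointCoeff X a * pointCoeff X b := by
  classical
  induction a using red_induction with
  | h0 => simp
  | hadd a a' h h' => rw [add_mul, map_add, map_add, h, h', add_mul]
  | hsmul c a h => rw [smul_mul_assoc, map_smul, map_smul, h, smul_mul_assoc]
  | hxi α =>
    induction b using red_induction with
    | h0 => simp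
    | hadd a a' h h' => rw [mul_add, map_add, map_add, h, h', mul_add]
    | hsmul c a h => rw [mul_smul_comm, map_smul, map_smul, h, mul_smul_comm]
    | hxi β =>
      rw [red_mul_def, mulLin_xi, pointCoeff_xi, pointCoeff_xi]
      by_cases h : ∃ γ, Composes α β γ
      · obtain ⟨γ, h⟩ := h
        rw [xiMul_of h, pointCoeff_xi]
        by_cases hγ : γ = pointInt X
        · subst hγ
          obtain ⟨rfl, rfl⟩ := composes_eq_pointInt h
          simp
        · rw [if_neg hγ]
          by_cases hα : α = pointInt X
          · subst hα
            rw [if_neg (fun e => hγ ((pointInt_composes.1 h).2.trans e)), mul_zero]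
          · rw [if_neg hα, zero_mul]
      · rw [xiMul_of_not h, map_zero]
        by_cases hα : α = pointInt X
        · subst hα
          rw [if_pos rfl, one_mul, if_neg]
          rintro rfl
          exact h ⟨pointInt X, pointInt_composes.2 ⟨by
            induction X using Quotient.inductionOn with
            | h x => rfl, rfl⟩⟩
        · rw [if_neg hα, zero_mul]

theorem pointCoeff_one (X : PointClass r) : pointCoeff X (1 : RedAlg k r) = 1 := by
  classical
  change pointCoeff X (redOne k r) = 1
  simp [redOne, pointCoeff_xi, pointInt_injective.eq_iff]

theorem pointCoeff_of_mem (X : PointClass r) {a : RedAlg k r} (ha : a ∈ redIdeal k r) :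
    pointCoeff X a = 0 := by
  classical
  rw [mem_redIdeal] at ha
  induction ha using Submodule.span_induction with
  | mem x hx =>
    obtain ⟨γ, rfl⟩ := hx
    rw [pointCoeff_xi, if_neg]
    rintro h
    exact not_isProper_pointInt X (h ▸ γ.2)
  | zero => exact map_zero _
  | add x y _ _ hx hy => rw [map_add, hx, hy, add_zero]
  | smul a x _ hx => rw [map_smul, hx, smul_zero]

end Algebra

section Tor

variable (k : Type v) [Field k] (R : Type u) [Ring R] [Algebra k R]

/-- The relations `m r ⊗ n = m ⊗ r n` defining the tensor product over `R`. -/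
def balanced (M N : Type*) [AddCommGroup M] [Module k M] [Module Rᵐᵒᵖ M]
    [AddCommGroup N] [Module k N] [Module R N] : Submodule k (M ⊗[k] N) :=
  Submodule.span k {t | ∃ (m : M) (a : R) (n : N),
    t = (MulOpposite.op a • m) ⊗ₜ[k] n - m ⊗ₜ[k] (a • n)}

/-- The tensor product `M ⊗_R N` of a right module and a left module over a `k`-algebra `R`. -/
abbrev TensorOver (M N : Type*) [AddCommGroup M] [Module k M] [Module Rᵐᵒᵖ M]
    [AddCommGroup N] [Module k N] [Module R N] : Type _ :=
  (M ⊗[k] N) ⧸ balanced k R M N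

variable {R}

/-- The map `1 ⊗ f : M ⊗_R N → M ⊗_R N'` induced by an `R`-linear map `f`. -/
noncomputable def tensorMap (M : Type*) [AddCommGroup M] [Module k M] [Module Rᵐᵒᵖ M]
    {N N' : Type*} [AddCommGroup N] [Module k N] [Module R N] [IsScalarTower k R N]
    [AddCommGroup N'] [Module k N'] [Module R N'] [IsScalarTower k R N'] (f : N →ₗ[R] N') :
    TensorOver k R M N →ₗ[k] TensorOver k R M N' :=
  Submodule.mapQ _ _ (LinearMap.lTensor M (f.restrictScalars k)) <| by
    refine Submodule.span_le.2 ?_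
    rintro _ ⟨m, a, n, rfl⟩
    exact Submodule.subset_span ⟨m, a, f n, by simp⟩

/-- The degree `j` component of `M ⊗_R N`, for `ℤ`-graded modules `M` and `N`. -/
def tensorDegree {M N : Type*} [AddCommGroup M] [Module k M] [Module Rᵐᵒᵖ M]
    [AddCommGroup N] [Module k N] [Module R N]
    (degM : ℤ → Submodule k M) (degN : ℤ → Submodule k N) (j : ℤ) :
    Submodule k (TensorOver k R M N) :=
  Submodule.span k {t | ∃ a b : ℤ, a + b = j ∧ ∃ m ∈ degM a, ∃ n ∈ degN b,
    t = (balanced k R M N).mkQ (m ⊗ₜ[k] n)}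

/-- `deg` is a `ℤ`-grading of the left module `N` over the graded ring `R = ⨁ d, gr d`. -/
structure IsGradedModule (gr : ℕ → Submodule k R) {N : Type*} [AddCommGroup N] [Module k N]
    [Module R N] (deg : ℤ → Submodule k N) : Prop where
  isInternal : DirectSum.IsInternal deg
  smul_mem : ∀ {a : ℕ} {b : ℤ} {x : R} {n : N}, x ∈ gr a → n ∈ deg b → x • n ∈ deg (a + b)

/-- A graded projective resolution `⋯ → X 1 → X 0 → N → 0` of a `ℤ`-graded left module `N` over
the `ℕ`-graded ring `R`; all maps are `R`-linear and preserve degrees. -/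
structure GradedProjectiveResolution (gr : ℕ → Submodule k R) (N : Type*) [AddCommGroup N]
    [Module k N] [Module R N] (degN : ℤ → Submodule k N) where
  /-- The modules of the resolution. -/
  X : ℕ → Type w
  [addCommGroup : ∀ i, AddCommGroup (X i)]
  [moduleField : ∀ i, Module k (X i)]
  [module : ∀ i, Module R (X i)]
  [isScalarTower : ∀ i, IsScalarTower k R (X i)]
  /-- The gradings. -/
  deg : ∀ i, ℤ → Submodule k (X i)
  isGraded : ∀ i, IsGradedModule k gr (deg i)
  projective : ∀ i, Module.Projective R (X i)
  /-- The differentials. -/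
  d : ∀ i, X (i + 1) →ₗ[R] X i
  d_mem : ∀ i j x, x ∈ deg (i + 1) j → d i x ∈ deg i j
  /-- The augmentation. -/
  aug : X 0 →ₗ[R] N
  aug_mem : ∀ j x, x ∈ deg 0 j → aug x ∈ degN j
  aug_surjective : Function.Surjective aug
  exact_zero : Function.Exact (d 0) aug
  exact_succ : ∀ i, Function.Exact (d (i + 1)) (d i)

attribute [instance] GradedProjectiveResolution.addCommGroup
  GradedProjectiveResolution.moduleField GradedProjectiveResolution.module
  GradedProjectiveResolution.isScalarTower

namespace GradedProjectiveResolution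

variable {k} {gr : ℕ → Submodule k R} {N : Type*} [AddCommGroup N] [Module k N] [Module R N]
  {degN : ℤ → Submodule k N} (Q : GradedProjectiveResolution.{u, v, w} k gr N degN)
  (M : Type*) [AddCommGroup M] [Module k M] [Module Rᵐᵒᵖ M]

/-- The cycles of the complex `M ⊗_R X`. -/
noncomputable def cycles : (i : ℕ) → Submodule k (TensorOver k R M (Q.X i))
  | 0 => ⊤
  | i + 1 => LinearMap.ker (tensorMap k M (Q.d i))

/-- The boundaries of the complex `M ⊗_R X`. -/
noncomputable def boundaries (i : ℕ) : Submodule k (TensorOver k R M (Q.X i)) :=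
  LinearMap.range (tensorMap k M (Q.d i))

/-- `Tor_i^R(M, N)`, computed from the given resolution of `N`: the homology of `M ⊗_R X`. -/
abbrev Tor (i : ℕ) : Type _ := ↥(Q.cycles M i) ⧸ (Q.boundaries M i).submoduleOf (Q.cycles M i)

/-- The component `Tor_i^R(M, N)_j` of internal degree `j`: the classes of the cycles that are
homogeneous of degree `j`. -/
noncomputable def torDegree {M : Type*} [AddCommGroup M] [Module k M] [Module Rᵐᵒᵖ M]
    (degM : ℤ → Submodule k M) (i : ℕ) (j : ℤ) : Submodule k (Q.Tor M i) :=
  ((tensorDegree k degM (Q.deg i) j).submoduleOf (Q.cycles M i)).map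
    ((Q.boundaries M i).submoduleOf (Q.cycles M i)).mkQ

end GradedProjectiveResolution

end Tor

section PointModules

variable {P : Type u} [PartialOrder P] (k : Type v) [Field k] (r : Setoid (NonemptyInterval P))
  [IncidenceAxioms r]

/-- The ring `R = gr_I A` for `A = k[P]_red`. -/
abbrev RedGr : Type (max u v) := GrRing (redIdeal k r)

/-- The homogeneous component `R_d = I ^ d / I ^ (d + 1)`, as a subspace of `R`. -/
noncomputable def redGrading (d : ℕ) : Submodule k (RedGr k r) :=
  LinearMap.range (DirectSum.lof k ℕ (GrPiece (redIdeal k r)) d)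

variable {r}

/-- The linear form `I ^ d / I ^ (d + 1) → k`, `a + I ^ (d + 1) ↦` the coefficient of `ξ_x~` in
`a`. It vanishes for `d ≥ 1`. -/
noncomputable def pieceCoeff (X : PointClass r) (d : ℕ) : GrPiece (redIdeal k r) d →ₗ[k] k :=
  grLift k (pointCoeff X) (fun _ h => pointCoeff_of_mem X h) d

theorem pieceCoeff_grMk (X : PointClass r) {d : ℕ} {a : RedAlg k r} (ha : a ∈ redIdeal k r ^ d) :
    pieceCoeff k X d (grMk a ha) = pointCoeff X a := rfl

/-- The character `R → R_0 = ∏ k_x~ → k_x~ = k`. -/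
noncomputable def pointChar (X : PointClass r) : RedGr k r →ₐ[k] k :=
  DirectSum.toAlgebra k _ (pieceCoeff k X)
    ((pieceCoeff_grMk k X one_mem_pow_zero).trans (pointCoeff_one X))
    (fun {i j} x y => by
      obtain ⟨a, ha, rfl⟩ := grMk_surj x
      obtain ⟨b, hb, rfl⟩ := grMk_surj y
      exact pointCoeff_mul X a b)

/-- The one-dimensional left and right `R`-module `k_x~ = k ξ_x~`, concentrated in degree `0`. -/
def PointModule (_X : PointClass r) : Type v := k

variable (X : PointClass r)

noncomputable instance : AddCommGroup (PointModule k X) := inferInstanceAs (AddCommGroup k)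

noncomputable instance : Module k (PointModule k X) := inferInstanceAs (Module k k)

noncomputable instance : Module (RedGr k r) (PointModule k X) :=
  Module.compHom k (pointChar k X).toRingHom

noncomputable instance : Module (RedGr k r)ᵐᵒᵖ (PointModule k X) :=
  Module.compHom k ((pointChar k X).toRingHom.fromOpposite fun _ _ => Commute.all _ _)

instance : IsScalarTower k (RedGr k r) (PointModule k X) where
  smul_assoc c a m := by
    have h (m : k) : pointChar k X (c • a) * m = c * (pointChar k X a * m) := by
      rw [map_smul, smul_eq_mul, mul_assoc]
    exact h m

instance : IsScalarTower k (RedGr k r)ᵐᵒᵖ (PointModule k X) where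
  smul_assoc c a m := by
    have h (m : k) : pointChar k X (c • a.unop) * m = c * (pointChar k X a.unop * m) := by
      rw [map_smul, smul_eq_mul, mul_assoc]
    exact h m

/-- The grading of `k_x~`, concentrated in degree `0`. -/
noncomputable def pointDegree (j : ℤ) : Submodule k (PointModule k X) := if j = 0 then ⊤ else ⊥

end PointModules

section Simplicial

variable (k : Type v) [Field k] (V : Type u)

/-- Abstract simplicial complexes on a set `V`. The empty face, of dimension `-1`, is allowed, and
so is the void complex without faces. -/
structure FaceComplex where
  /-- The faces. -/
  faces : Set (Finset V)
  down_closed : ∀ {F G : Finset V}, F ∈ faces → G ⊆ F → G ∈ faces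

variable {V}

/-- The sequential layer `Δ^⟨j⟩`: the subcomplex generated by the faces of dimension at least
`j`. -/
def FaceComplex.layer (Δ : FaceComplex V) (j : ℤ) : FaceComplex V where
  faces := {F | ∃ G ∈ Δ.faces, F ⊆ G ∧ j ≤ (G.card : ℤ) - 1}
  down_closed := fun ⟨G, hG, hF, hj⟩ h => ⟨G, hG, h.trans hF, hj⟩

/-- The order complex of a subset `S` of a poset: its faces are the finite chains in `S`. -/
def orderComplex [PartialOrder V] (S : Set V) : FaceComplex V where
  faces := {F | (F : Set V) ⊆ S ∧ IsChain (· ≤ ·) (F : Set V)}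
  down_closed := fun ⟨hS, hc⟩ h =>
    ⟨(Finset.coe_subset.2 h).trans hS, hc.mono (Finset.coe_subset.2 h)⟩

/-- The vector space with the finite subsets of `V` as basis. -/
def ChainSpace (V : Type u) : Type (max u v) := Finset V →₀ k

noncomputable instance (V : Type u) : AddCommGroup (ChainSpace k V) :=
  inferInstanceAs (AddCommGroup (Finset V →₀ k))

noncomputable instance (V : Type u) : Module k (ChainSpace k V) :=
  inferInstanceAs (Module k (Finset V →₀ k))

/-- The basis vector of a finite subset `F`. -/
noncomputable def face (F : Finset V) : ChainSpace k V := Finsupp.single F 1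

/-- The space of simplicial `n`-chains of `Δ`, `n ≥ -1`, with the faces as basis. -/
noncomputable def FaceComplex.chains (Δ : FaceComplex V) (n : ℤ) : Submodule k (ChainSpace k V) :=
  Submodule.span k (face k '' {F | F ∈ Δ.faces ∧ (F.card : ℤ) - 1 = n})

open Classical in
/-- The augmented simplicial boundary map on faces which are chains in a poset, with vertices
ordered increasingly:
`∂ {v_0 < ⋯ < v_n} = ∑ i, (-1) ^ i {v_0 < ⋯ < v_n} \ {v_i}`. -/
noncomputable def boundary [PartialOrder V] : ChainSpace k V →ₗ[k] ChainSpace k V :=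
  Finsupp.linearCombination k fun F =>
    ∑ v ∈ F, (-1 : k) ^ (F.filter (· < v)).card • face k (F.erase v)

open Classical in
theorem boundary_face [PartialOrder V] (F : Finset V) : boundary k (face k F) =
    ∑ v ∈ F, (-1 : k) ^ (F.filter (· < v)).card • face k (F.erase v) := by
  unfold boundary face
  erw [Finsupp.linearCombination_single, one_smul]

/-- Relative cycles: the `n`-chains of `Δ` whose boundary lies in `Γ`. -/
noncomputable def relCycles [PartialOrder V] (Δ Γ : FaceComplex V) (n : ℤ) :
    Submodule k (ChainSpace k V) :=
  Δ.chains k n ⊓ (Γ.chains k (n - 1)).comap (boundary k)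

/-- Relative boundaries: sums of boundaries of `(n + 1)`-chains of `Δ` and `n`-chains of `Γ`. -/
noncomputable def relBoundaries [PartialOrder V] (Δ Γ : FaceComplex V) (n : ℤ) :
    Submodule k (ChainSpace k V) :=
  (Δ.chains k (n + 1)).map (boundary k) ⊔ Γ.chains k n

/-- The relative reduced simplicial homology `H̃_n(Δ, Γ; k)`, for a complex `Δ` whose faces are
chains in a poset, and a subcomplex `Γ`. -/
abbrev RelHomology [PartialOrder V] (Δ Γ : FaceComplex V) (n : ℤ) : Type (max u v) :=
  ↥(relCycles k Δ Γ n) ⧸ (relBoundaries k Δ Γ n).submoduleOf (relCycles k Δ Γ n)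

end Simplicial

end RedInc

open RedInc

set_option linter.unusedSectionVars false

/-! Interval classes are the morphisms of a category with object set P/∼. Order-compatibility makes
composition single-valued, concatenation makes it defined whenever target and source match, and
invariance makes it associative. Invariance gives more: by `exists_steps` and
`IsIncr.steps_injective`, the factorizations of the class of [x, y], x < y, into m + 1 proper
classes correspond bijectively to the chains x < p₁ < ⋯ < pₘ < y.

Let rk α be the maximal length of a factorization of α into proper classes. It is superadditive
(`rk_add_le`), so I^d is the span of the ξ_α with rk α ≥ d (`mem_pow_iff`). Hence R has a basis of
elements ζ_α, homogeneous of degree rk α, in which ζ_α ζ_β equals ζ_{αβ} if the ranks add up and 0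
otherwise (`zeta_mul_zeta`). For such a ring the normalized bar resolution of k_Y is explicit: it
has one projective summand for each composable sequence of proper classes ending at Y, and a
contraction (`bar_contraction`) gives exactness. Tensoring with k_X kills the term in which the
first entry multiplies the coefficient. What remains is the complex of paths from X to Y, whose
differential is minus the alternating sum of the merges of neighbours with additive rank. By the
comparison theorem for graded resolutions (`exists_torEquiv`), this complex computes Tor from any
resolution, the internal degree being the weight, i.e. the sum of the ranks of the entries
(`exists_torEquiv_path`).

Merging preserves weight and product, so the complex splits over pairs (j, α). If α is the class of
[x, y] with x < y, a path with product α is a chain in (x, y), and its weight is the largest number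
of steps of a refinement (`le_weight_steps_iff`). Thus a face lies in Δ^⟨t⟩ exactly if its weight is
at least t + 2 (`mem_layer_iff`), and the relative chains of (Δ^⟨j-2⟩, Δ^⟨j-1⟩) have the faces of
weight exactly j as basis. Deleting a vertex merges two neighbouring steps: either the weight stays
j and the merge counts, or the weight grows and the new face is zero in the relative complex. So the
relative boundary is the merging operator (`chainToPath_boundary_face`). A face of dimension n is a
path of length n + 2, whence the homological degree i - 2. In length 0 there is only the empty path,
present exactly if X = Y, and the differential into length 0 vanishes. -/

namespace RedInc

/-! ### The category of interval classes. -/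

section Composition

variable {P : Type u} [PartialOrder P] {r : Setoid (NonemptyInterval P)}

variable (r) in
open Classical in
/-- The class of `[x, y]`, with a default value unless `x ≤ y`. -/
noncomputable def cl (x y : P) : IntClass r := if h : x ≤ y then cls x y h else cls x x le_rfl

theorem cl_of_le {x y : P} (h : x ≤ y) : cl r x y = cls x y h := dif_pos h

theorem exists_cl (α : IntClass r) : ∃ x y, x ≤ y ∧ α = cl r x y := by
  obtain ⟨x, y, h, rfl⟩ := exists_cls α
  exact ⟨x, y, h, (cl_of_le h).symm⟩

theorem composes_cl {x y z : P} (hxy : x ≤ y) (hyz : y ≤ z) :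
    Composes (cl r x y) (cl r y z) (cl r x z) :=
  ⟨x, y, z, hxy, hyz, (cl_of_le _).symm, (cl_of_le _).symm, (cl_of_le _).symm⟩

variable [IncidenceAxioms r]

/-- The existence half of invariance: z' is the image of z under τ. -/
theorem exists_transfer {x y x' y' z : P} (h' : x' ≤ y') (hxz : x ≤ z)
    (hzy : z ≤ y) (e : cl r x y = cl r x' y') : ∃ z', x' ≤ z' ∧ z' ≤ y' ∧
      cl r x z = cl r x' z' ∧ cl r z y = cl r z' y' := by
  rw [cl_of_le (hxz.trans hzy), cl_of_le h'] at e
  obtain ⟨τ, hτ, -⟩ := IncidenceAxioms.invariance (hxz.trans hzy) h' (cls_eq.1 e)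
  have h := hτ ⟨z, hxz, hzy⟩
  refine ⟨τ ⟨z, hxz, hzy⟩, (τ ⟨z, hxz, hzy⟩).2.1, (τ ⟨z, hxz, hzy⟩).2.2, ?_, ?_⟩
  · rw [cl_of_le hxz, cl_of_le (τ ⟨z, hxz, hzy⟩).2.1]
    exact cls_eq.2 h.1
  · rw [cl_of_le hzy, cl_of_le (τ ⟨z, hxz, hzy⟩).2.2]
    exact cls_eq.2 h.2

/-- The uniqueness half of invariance, applied to [x, y] ∼ [x, y]: the identity, and the map that
differs from it only by sending z to z', both respect the classes, so they coincide. -/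
theorem eq_of_cl_eq {x y z z' : P} (hxz : x ≤ z) (hzy : z ≤ y) (hxz' : x ≤ z') (hzy' : z' ≤ y)
    (e1 : cl r x z = cl r x z') (e2 : cl r z y = cl r z' y) : z = z' := by
  classical
  rw [cl_of_le hxz, cl_of_le hxz', cls_eq] at e1
  rw [cl_of_le hzy, cl_of_le hzy', cls_eq] at e2
  have h := (IncidenceAxioms.invariance (r := r) (hxz.trans hzy) (hxz.trans hzy)
    (Setoid.refl' r _)).unique
    (y₁ := id) (y₂ := Function.update id ⟨z, hxz, hzy⟩ ⟨z', hxz', hzy'⟩)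
    (fun a => ⟨Setoid.refl' r _, Setoid.refl' r _⟩)
    (fun a => by
      by_cases ha : a = ⟨z, hxz, hzy⟩
      · subst ha
        simp only [Function.update_self]
        exact ⟨e1, e2⟩
      · simp only [Function.update_of_ne ha]
        exact ⟨Setoid.refl' r _, Setoid.refl' r _⟩)
  have h := congrFun h ⟨z, hxz, hzy⟩
  simpa using congrArg Subtype.val h

/-- By transfer, every factorization of a class is visible inside any chosen representative. This
turns algebra of classes into combinatorics of one interval. -/
theorem composes_cl_iff {x y : P} (h : x ≤ y) {α β : IntClass r} :
    Composes α β (cl r x y) ↔ ∃ z, x ≤ z ∧ z ≤ y ∧ cl r x z = α ∧ cl r z y = β := by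
  constructor
  · rintro ⟨a, b, c, hab, hbc, rfl, rfl, e⟩
    rw [← cl_of_le (hab.trans hbc)] at e
    obtain ⟨z, h1, h2, h3, h4⟩ := exists_transfer h hab hbc e
    exact ⟨z, h1, h2, by rw [← h3, cl_of_le], by rw [← h4, cl_of_le]⟩
  · rintro ⟨z, h1, h2, rfl, rfl⟩
    exact composes_cl h1 h2

theorem source_cl {x y : P} (h : x ≤ y) : source (cl r x y) = Quotient.mk _ x := by
  rw [cl_of_le h]; rfl

theorem target_cl {x y : P} (h : x ≤ y) : target (cl r x y) = Quotient.mk _ y := by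
  rw [cl_of_le h]; rfl

theorem pointInt_mk' (x : P) : pointInt (r := r) (Quotient.mk _ x) = cl r x x := by
  rw [cl_of_le le_rfl]; rfl

theorem Composes.source_eq {α β γ : IntClass r} (h : Composes α β γ) : source γ = source α := by
  obtain ⟨x, y, z, hxy, hyz, rfl, rfl, rfl⟩ := h
  rfl

theorem Composes.target_eq {α β γ : IntClass r} (h : Composes α β γ) : target γ = target β := by
  obtain ⟨x, y, z, hxy, hyz, rfl, rfl, rfl⟩ := h
  rfl

theorem Composes.middle_eq {α β γ : IntClass r} (h : Composes α β γ) : target α = source β := by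
  obtain ⟨x, y, z, hxy, hyz, rfl, rfl, rfl⟩ := h
  rfl

/-- This is where the concatenation axiom enters: matching endpoints alone make classes composable.
Without it some products of composable paths in the bar complex would be undefined. -/
theorem exists_composes {α β : IntClass r} (h : target α = source β) : ∃ γ, Composes α β γ := by
  obtain ⟨x, y₁, h1, rfl⟩ := exists_cls α
  obtain ⟨y₂, z, h2, rfl⟩ := exists_cls β
  obtain ⟨x', y', z', h1', h2', e1, e2⟩ := IncidenceAxioms.concatenation h1 h2
    (cls_eq.1 (congrArg pointInt h))
  exact ⟨cls x' z' (h1'.trans h2'), x', y', z', h1', h2', cls_eq.2 e1, cls_eq.2 e2, rfl⟩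

open Classical in
/-- The composition of two classes of intervals, with a default value if they do not compose. -/
noncomputable def comp (α β : IntClass r) : IntClass r :=
  if h : ∃ γ, Composes α β γ then h.choose else α

theorem Composes.comp_eq {α β γ : IntClass r} (h : Composes α β γ) : comp α β = γ := by
  have h' : ∃ γ, Composes α β γ := ⟨γ, h⟩
  rw [comp, dif_pos h']
  exact h'.choose_spec.unique h

theorem composes_comp {α β : IntClass r} (h : target α = source β) : Composes α β (comp α β) := by
  obtain ⟨γ, hγ⟩ := exists_composes h
  rwa [hγ.comp_eq]

theorem comp_cl {x y z : P} (hxy : x ≤ y) (hyz : y ≤ z) :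
    comp (cl r x y) (cl r y z) = cl r x z := (composes_cl hxy hyz).comp_eq

theorem source_comp {α β : IntClass r} (h : target α = source β) :
    source (comp α β) = source α := (composes_comp h).source_eq

theorem target_comp {α β : IntClass r} (h : target α = source β) :
    target (comp α β) = target β := (composes_comp h).target_eq

theorem comp_assoc {α β γ : IntClass r} (h : target α = source β) (h' : target β = source γ) :
    comp (comp α β) γ = comp α (comp β γ) := by
  have h1 := composes_comp h
  have h2 : Composes (comp α β) γ (comp (comp α β) γ) :=
    composes_comp ((target_comp h).trans h')
  obtain ⟨ε, h3, h4⟩ := (composes_assoc _ _ _ _).1 ⟨_, h1, h2⟩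
  rw [h3.comp_eq, h4.comp_eq]

@[simp] theorem source_pointInt (X : PointClass r) : source (pointInt X) = X := by
  induction X using Quotient.inductionOn with
  | h x => rfl

@[simp] theorem target_pointInt (X : PointClass r) : target (pointInt X) = X := by
  induction X using Quotient.inductionOn with
  | h x => rfl

theorem pointInt_comp {X : PointClass r} {α : IntClass r} (h : X = source α) :
    comp (pointInt X) α = α := (pointInt_composes.2 ⟨h, rfl⟩).comp_eq

theorem comp_pointInt {X : PointClass r} {α : IntClass r} (h : X = target α) :
    comp α (pointInt X) = α := (composes_pointInt.2 ⟨h, rfl⟩).comp_eq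

theorem isProper_cl {x y : P} (h : x < y) : IsProper (cl r x y) := ⟨x, y, h, (cl_of_le h.le).symm⟩

theorem lt_of_isProper_cl {x y : P} (h : x ≤ y) (h' : IsProper (cl r x y)) : x < y := by
  obtain ⟨u, v, huv, e⟩ := h'
  rw [cl_of_le h] at e
  exact lt_of_cls_eq h huv e.symm

theorem isProper_or (α : IntClass r) : IsProper α ∨ α = pointInt (source α) := by
  obtain ⟨x, y, h, rfl⟩ := exists_cl α
  rcases h.lt_or_eq with h | rfl
  · exact Or.inl (isProper_cl h)
  · right
    rw [source_cl le_rfl, pointInt_mk']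

theorem isProper_comp_left {α β : IntClass r} (h : target α = source β) (hα : IsProper α) :
    IsProper (comp α β) := hα.of_left (composes_comp h)

/-! ### Factorizations of a class and chains in an interval. -/

/-- `l` is a composable sequence of proper classes from `X` to `Y`. -/
def IsPath (Y : PointClass r) : PointClass r → List (IntClass r) → Prop
  | X, [] => X = Y
  | X, α :: l => IsProper α ∧ source α = X ∧ IsPath Y (target α) l

/-- The product of a composable sequence of classes which starts at `X`. -/
noncomputable def prodFrom : PointClass r → List (IntClass r) → IntClass r
  | X, [] => pointInt X
  | _, α :: l => comp α (prodFrom (target α) l)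

theorem IsPath.source_prodFrom {X Y : PointClass r} {l : List (IntClass r)} (h : IsPath Y X l) :
    source (prodFrom X l) = X := by
  induction l generalizing X with
  | nil => exact source_pointInt X
  | cons α l ih => exact (source_comp (ih h.2.2).symm).trans h.2.1

theorem IsPath.target_prodFrom {X Y : PointClass r} {l : List (IntClass r)} (h : IsPath Y X l) :
    target (prodFrom X l) = Y := by
  induction l generalizing X with
  | nil => exact (target_pointInt X).trans h
  | cons α l ih => exact (target_comp h.2.2.source_prodFrom.symm).trans (ih h.2.2)

theorem IsPath.isProper_prodFrom {X Y : PointClass r} {α : IntClass r} {l : List (IntClass r)}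
    (h : IsPath Y X (α :: l)) : IsProper (prodFrom X (α :: l)) :=
  isProper_comp_left h.2.2.source_prodFrom.symm h.1

theorem IsPath.append {X Y Z : PointClass r} {l l' : List (IntClass r)} (h : IsPath Y X l)
    (h' : IsPath Z Y l') : IsPath Z X (l ++ l') := by
  induction l generalizing X with
  | nil => obtain rfl : X = Y := h; exact h'
  | cons α l ih => exact ⟨h.1, h.2.1, ih h.2.2⟩

theorem IsPath.prodFrom_append {X Y Z : PointClass r} {l l' : List (IntClass r)}
    (h : IsPath Y X l) (h' : IsPath Z Y l') :
    prodFrom X (l ++ l') = comp (prodFrom X l) (prodFrom Y l') := by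
  induction l generalizing X with
  | nil =>
    obtain rfl : X = Y := h
    exact (pointInt_comp h'.source_prodFrom.symm).symm
  | cons α l ih =>
    have e := ih h.2.2
    simp only [List.cons_append, prodFrom]
    rw [e, comp_assoc h.2.2.source_prodFrom.symm
      (h.2.2.target_prodFrom.trans h'.source_prodFrom.symm)]

theorem isPath_singleton {α : IntClass r} (h : IsProper α) :
    IsPath (target α) (source α) [α] := ⟨h, rfl, rfl⟩

theorem prodFrom_singleton (X : PointClass r) (α : IntClass r) : prodFrom X [α] = α :=
  comp_pointInt rfl

/-- `x < p₁ < ⋯ < pₘ < y`. -/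
def IsIncr (y : P) : P → List P → Prop
  | x, [] => x < y
  | x, v :: p => x < v ∧ IsIncr y v p

variable (r) in
/-- The classes of the successive intervals of the chain `x, p₁, …, pₘ, y`. -/
noncomputable def steps (y : P) : P → List P → List (IntClass r)
  | x, [] => [cl r x y]
  | x, v :: p => cl r x v :: steps y v p

theorem IsIncr.lt {x y : P} {p : List P} (h : IsIncr y x p) : x < y := by
  induction p generalizing x with
  | nil => exact h
  | cons v p ih => exact h.1.trans (ih h.2)

theorem length_steps (x y : P) (p : List P) : (steps r y x p).length = p.length + 1 := by
  induction p generalizing x with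
  | nil => rfl
  | cons v p ih => simp [steps, ih]

theorem IsIncr.isPath {x y : P} {p : List P} (h : IsIncr y x p) :
    IsPath (r := r) (Quotient.mk _ y) (Quotient.mk _ x) (steps r y x p) := by
  induction p generalizing x with
  | nil => exact ⟨isProper_cl h, source_cl (le_of_lt h), target_cl (le_of_lt h)⟩
  | cons v p ih =>
    refine ⟨isProper_cl h.1, source_cl h.1.le, ?_⟩
    rw [target_cl h.1.le]
    exact ih h.2

theorem IsIncr.prodFrom_steps {x y : P} {p : List P} (h : IsIncr y x p) :
    prodFrom (r := r) (Quotient.mk _ x) (steps r y x p) = cl r x y := by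
  induction p generalizing x with
  | nil => exact prodFrom_singleton _ _
  | cons v p ih =>
    have e := ih h.2
    simp only [steps, prodFrom]
    rw [target_cl h.1.le, e, comp_cl h.1.le h.2.lt.le]

/-- Surjectivity of the passage from chains to factorizations: `composes_cl_iff` locates the
endpoint z of the first factor in [x, y], and the remaining factors are handled in [z, y]. -/
theorem exists_steps {X Y : PointClass r} {α : IntClass r} {l : List (IntClass r)} {x y : P}
    (hl : IsPath Y X (α :: l)) (hxy : x ≤ y) (h : prodFrom X (α :: l) = cl r x y) :
    ∃ p, IsIncr y x p ∧ steps r y x p = α :: l := by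
  induction l generalizing x α X with
  | nil =>
    rw [prodFrom_singleton] at h
    subst h
    exact ⟨[], lt_of_isProper_cl hxy hl.1, rfl⟩
  | cons β l ih =>
    have hc := composes_comp hl.2.2.source_prodFrom.symm
    change Composes _ _ (prodFrom X (α :: β :: l)) at hc
    rw [h, composes_cl_iff hxy] at hc
    obtain ⟨z, hxz, hzy, rfl, e2⟩ := hc
    obtain ⟨p, hp, e⟩ := ih hl.2.2 hzy e2.symm
    exact ⟨z :: p, ⟨lt_of_isProper_cl hxz hl.1, hp⟩, by rw [steps, e]⟩

/-- The first vertices v and v' are compared by `eq_of_cl_eq`: [x, v] and [x, v'] are the equal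
first steps, while [v, y] and [v', y] have the same class as products of the same remaining steps.
-/
theorem IsIncr.steps_injective {x y : P} {p q : List P} (hp : IsIncr y x p) (hq : IsIncr y x q)
    (h : steps r y x p = steps r y x q) : p = q := by
  have hlen : p.length = q.length := by
    have := congrArg List.length h
    simpa [length_steps] using this
  induction p generalizing x q with
  | nil => exact (List.length_eq_zero_iff.1 hlen.symm).symm
  | cons v p ih =>
    cases q with
    | nil => simp at hlen
    | cons v' q =>
      simp only [steps, List.cons.injEq] at h
      have h1 := hp.2.prodFrom_steps (r := r)
      have h2 := hq.2.prodFrom_steps (r := r)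
      have e : (Quotient.mk _ v : PointClass r) = Quotient.mk _ v' := by
        rw [← target_cl hp.1.le, h.1, target_cl hq.1.le]
      rw [h.2, e, h2] at h1
      obtain rfl := eq_of_cl_eq hp.1.le hp.2.lt.le hq.1.le hq.2.lt.le h.1 h1.symm
      rw [ih hp.2 hq.2 h.2 (by simpa using hlen)]

theorem IsIncr.mem_Ioo {x y : P} {p : List P} (h : IsIncr y x p) {z : P} (hz : z ∈ p) :
    z ∈ Set.Ioo x y := by
  induction p generalizing x with
  | nil => simp at hz
  | cons v p ih =>
    rcases List.mem_cons.1 hz with rfl | hz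
    · exact ⟨h.1, h.2.lt⟩
    · exact ⟨h.1.trans (ih h.2 hz).1, (ih h.2 hz).2⟩

theorem IsIncr.pairwise {x y : P} {p : List P} (h : IsIncr y x p) : p.Pairwise (· < ·) := by
  induction p generalizing x with
  | nil => exact List.Pairwise.nil
  | cons v p ih => exact List.Pairwise.cons (fun z hz => (h.2.mem_Ioo hz).1) (ih h.2)

theorem isIncr_of_pairwise {x y : P} {p : List P} (hxy : x < y) (h : p.Pairwise (· < ·))
    (hp : ∀ z ∈ p, z ∈ Set.Ioo x y) : IsIncr y x p := by
  induction p generalizing x with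
  | nil => exact hxy
  | cons v p ih =>
    rw [List.pairwise_cons] at h
    have hv := hp v (by simp)
    exact ⟨hv.1, ih hv.2 h.2 fun z hz => ⟨h.1 z hz, (hp z (by simp [hz])).2⟩⟩

theorem IsIncr.length_le {x y : P} {p : List P} (h : IsIncr y x p)
    (hfin : (Set.Icc x y).Finite) : p.length ≤ (Set.Icc x y).ncard := by
  classical
  have hnd : p.Nodup := h.pairwise.imp fun h => h.ne
  rw [← List.toFinset_card_of_nodup hnd, ← Set.ncard_coe_finset]
  refine Set.ncard_le_ncard (fun z hz => ?_) hfin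
  exact Set.Ioo_subset_Icc_self (h.mem_Ioo (by simpa using hz))

/-! ### The rank of a class and the weight of a chain. -/

/-- The maximal length of a factorization of a class into proper classes. -/
noncomputable def rk (α : IntClass r) : ℕ :=
  sSup {n | ∃ l, IsPath (target α) (source α) l ∧ prodFrom (source α) l = α ∧ l.length = n}

/-- Factorizations come from chains in a finite interval. Boundedness is what makes the supremum in
`rk` meaningful, since `sSup` of an unbounded set of naturals is 0. -/
theorem bddAbove_factor (hP : ∀ x y : P, (Set.Icc x y).Finite) (α : IntClass r) :
    BddAbove {n | ∃ l, IsPath (target α) (source α) l ∧ prodFrom (source α) l = α ∧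
      l.length = n} := by
  obtain ⟨x, y, h, rfl⟩ := exists_cl α
  refine ⟨(Set.Icc x y).ncard + 1, ?_⟩
  rintro n ⟨l, hl, hp, rfl⟩
  cases l with
  | nil => simp
  | cons β l =>
    obtain ⟨p, hp, e⟩ := exists_steps hl h hp
    rw [← e, length_steps]
    have := hp.length_le (hP x y)
    omega

theorem exists_factor (hP : ∀ x y : P, (Set.Icc x y).Finite) (α : IntClass r) :
    ∃ l, IsPath (target α) (source α) l ∧ prodFrom (source α) l = α ∧ l.length = rk α := by
  refine Nat.sSup_mem ?_ (bddAbove_factor hP α)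
  rcases isProper_or α with h | h
  · exact ⟨1, [α], isPath_singleton h, prodFrom_singleton _ _, rfl⟩
  -- A point class is the product of the empty path.
  · refine ⟨0, [], ?_, h.symm, rfl⟩
    rw [h]
    simp [IsPath]

theorem IsPath.length_le_rk (hP : ∀ x y : P, (Set.Icc x y).Finite) {X Y : PointClass r}
    {l : List (IntClass r)} (h : IsPath Y X l) : l.length ≤ rk (prodFrom X l) := by
  refine le_csSup (bddAbove_factor hP _) ⟨l, ?_⟩
  rw [h.source_prodFrom, h.target_prodFrom]
  exact ⟨h, rfl, rfl⟩

/-- Concatenate factorizations of maximal length. Strict inequality is possible, and this defect is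
exactly what the associated graded product records. -/
theorem rk_add_le (hP : ∀ x y : P, (Set.Icc x y).Finite) {α β : IntClass r}
    (h : target α = source β) : rk α + rk β ≤ rk (comp α β) := by
  obtain ⟨l, hl, el, hl'⟩ := exists_factor hP α
  obtain ⟨m, hm, em, hm'⟩ := exists_factor hP β
  rw [← h] at hm em
  have h1 := (hl.append hm).length_le_rk hP
  rwa [hl.prodFrom_append hm, el, em, List.length_append, hl', hm'] at h1

theorem rk_pos (hP : ∀ x y : P, (Set.Icc x y).Finite) {α : IntClass r} (h : IsProper α) :
    0 < rk α := by
  have h1 := (isPath_singleton h).length_le_rk hP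
  rwa [prodFrom_singleton] at h1

/-- A nonempty product of proper classes is proper, so only the empty factorization is available. -/
theorem rk_pointInt (hP : ∀ x y : P, (Set.Icc x y).Finite) (X : PointClass r) :
    rk (pointInt X) = 0 := by
  obtain ⟨l, hl, el, hl'⟩ := exists_factor hP (pointInt X)
  rw [← hl']
  cases l with
  | nil => rfl
  | cons α l =>
    have := hl.isProper_prodFrom
    rw [el] at this
    exact absurd this (not_isProper_pointInt X)

theorem IsIncr.append {x v y : P} {p q : List P} (hp : IsIncr v x p) (hq : IsIncr y v q) :
    IsIncr y x (p ++ v :: q) := by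
  induction p generalizing x with
  | nil => exact ⟨hp, hq⟩
  | cons w p ih => exact ⟨hp.1, ih hp.2⟩

theorem IsIncr.of_append {x v y : P} {p q : List P} (h : IsIncr y x (p ++ v :: q)) :
    IsIncr v x p ∧ IsIncr y v q := by
  induction p generalizing x with
  | nil => exact h
  | cons w p ih => exact ⟨⟨h.1, (ih h.2).1⟩, (ih h.2).2⟩

/-- The sum of the ranks of the entries. -/
noncomputable def weight (l : List (IntClass r)) : ℕ := (l.map rk).sum

@[simp] theorem weight_nil : weight ([] : List (IntClass r)) = 0 := rfl

@[simp] theorem weight_cons (α : IntClass r) (l : List (IntClass r)) :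
    weight (α :: l) = rk α + weight l := by simp [weight]

theorem IsIncr.length_lt_rk (hP : ∀ x y : P, (Set.Icc x y).Finite) {x y : P} {q : List P}
    (h : IsIncr y x q) : q.length + 1 ≤ rk (cl r x y) := by
  have := (h.isPath (r := r)).length_le_rk hP
  rwa [h.prodFrom_steps, length_steps] at this

theorem exists_isIncr_rk (hP : ∀ x y : P, (Set.Icc x y).Finite) {x y : P} (h : x < y) :
    ∃ q, IsIncr y x q ∧ q.length + 1 = rk (cl r x y) := by
  obtain ⟨l, hl, el, hl'⟩ := exists_factor hP (cl r x y)
  cases l with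
  | nil =>
    have := rk_pos hP (isProper_cl (r := r) h)
    simp at hl'
    omega
  | cons α l =>
    obtain ⟨q, hq, e⟩ := exists_steps hl h.le el
    exact ⟨q, hq, by rw [← hl', ← e, length_steps]⟩

/-- The weight of a chain is the maximal number of steps of a refinement. -/
theorem le_weight_steps_iff (hP : ∀ x y : P, (Set.Icc x y).Finite) {x y : P} {p : List P}
    (hp : IsIncr y x p) (m : ℕ) : m ≤ weight (steps r y x p) ↔
      ∃ q, IsIncr y x q ∧ p ⊆ q ∧ m ≤ q.length + 1 := by
  induction p generalizing x m with
  | nil =>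
    simp only [steps, weight_cons, weight_nil, add_zero]
    constructor
    · intro h
      obtain ⟨q, hq, e⟩ := exists_isIncr_rk (r := r) hP hp
      exact ⟨q, hq, by simp, by omega⟩
    · rintro ⟨q, hq, -, hm⟩
      exact hm.trans (hq.length_lt_rk hP)
  | cons v p ih =>
    simp only [steps, weight_cons]
    constructor
    · intro h
      obtain ⟨q, hq, e⟩ := exists_isIncr_rk (r := r) hP hp.1
      obtain ⟨q', hq', hs, hm⟩ := (ih hp.2 _).1 le_rfl
      -- A longest chain in (x, v) is spliced with an optimal refinement of the rest.
      refine ⟨q ++ v :: q', hq.append hq', ?_, ?_⟩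
      · intro z hz
        rcases List.mem_cons.1 hz with rfl | hz
        · simp
        · have := hs hz
          simp [this]
      · simp only [List.length_append, List.length_cons]
        omega
    · rintro ⟨q, hq, hs, hm⟩
      -- The refinement is cut at v: q1 is bounded by the rank of the first step, and q2 refines the
      -- remaining chain because the vertices of p lie above v and hence not in q1.
      obtain ⟨q1, q2, rfl⟩ := List.append_of_mem (hs (List.mem_cons_self (a := v) (l := p)))
      obtain ⟨h1, h2⟩ := hq.of_append
      have e1 := h1.length_lt_rk (r := r) hP
      have e2 := (ih hp.2 (q2.length + 1)).2 ⟨q2, h2, fun z hz => by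
        have h3 := hs (List.mem_cons_of_mem v hz)
        have h4 := (hp.2.mem_Ioo hz).1
        rcases List.mem_append.1 h3 with h5 | h5
        · exact absurd (h1.mem_Ioo h5).2 h4.not_gt
        · rcases List.mem_cons.1 h5 with rfl | h5
          · exact absurd h4 (lt_irrefl _)
          · exact h5, le_rfl⟩
      simp only [List.length_append, List.length_cons] at hm
      omega

end Composition

/-! ### A multiplicative basis of the associated graded ring. -/

section GradedBasis

/-- The map on `I ^ d / I ^ (d + 1)` induced by a linear form on `A` which vanishes on
`I ^ (d + 1)`. -/
def grPieceForm (k : Type v) [Field k] {A : Type u} [Ring A] [Algebra k A] {I : Ideal A} (d : ℕ)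
    (f : A →ₗ[k] k) (hf : ∀ a ∈ I ^ (d + 1), f a = 0) : GrPiece I d →ₗ[k] k where
  toFun := Quotient.lift (fun a : ↥(I ^ d) => f a.1) (by
    rintro ⟨a, ha⟩ ⟨b, hb⟩ h
    have h1 : (⟨a, ha⟩ - ⟨b, hb⟩ : ↥(I ^ d)) ∈ (I ^ (d + 1)).submoduleOf (I ^ d) :=
      (Submodule.quotientRel_def _).1 h
    have h3 := hf _ (show a - b ∈ I ^ (d + 1) from h1)
    rwa [map_sub, sub_eq_zero] at h3)
  map_add' x y := by
    obtain ⟨a, ha, rfl⟩ := grMk_surj x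
    obtain ⟨b, hb, rfl⟩ := grMk_surj y
    exact map_add f a b
  map_smul' c x := by
    obtain ⟨a, ha, rfl⟩ := grMk_surj x
    exact map_smul f c a

variable {P : Type u} [PartialOrder P] (hP : ∀ x y : P, (Set.Icc x y).Finite)
  {k : Type v} [Field k] {r : Setoid (NonemptyInterval P)} [IncidenceAxioms r]

theorem xi_mul_xi {α β γ : IntClass r} (h : Composes α β γ) : xi k α * xi k β = xi k γ := by
  rw [red_mul_def, mulLin_xi, xiMul_of h]

theorem xi_mul_xi_of_ne {α β : IntClass r} (h : target α ≠ source β) :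
    xi k α * xi k β = 0 := by
  rw [red_mul_def, mulLin_xi, xiMul_of_not]
  rintro ⟨γ, hγ⟩
  exact h hγ.middle_eq

theorem mem_pow_zero (a : RedAlg k r) : a ∈ redIdeal k r ^ 0 := by
  rw [Submodule.pow_zero, Ideal.one_eq_top]
  trivial

variable (k) in
theorem IsPath.xi_mem_pow {X Y : PointClass r} {l : List (IntClass r)} (h : IsPath Y X l) :
    xi k (prodFrom X l) ∈ redIdeal k r ^ l.length := by
  induction l generalizing X with
  | nil => exact mem_pow_zero _
  | cons α l ih =>
    have h1 : xi k α ∈ redIdeal k r ^ 1 := by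
      rw [Submodule.pow_one]
      exact Submodule.subset_span ⟨⟨α, h.1⟩, rfl⟩
    have h2 := mul_mem_pow_add h1 (ih h.2.2)
    rw [xi_mul_xi (composes_comp h.2.2.source_prodFrom.symm)] at h2
    rwa [List.length_cons, add_comm]

include hP in
variable (k) in
theorem xi_mem_pow {α : IntClass r} {d : ℕ} (h : d ≤ rk α) : xi k α ∈ redIdeal k r ^ d := by
  obtain ⟨l, hl, e, hl'⟩ := exists_factor hP α
  have h1 := hl.xi_mem_pow k
  rw [e, hl'] at h1
  exact Ideal.pow_le_pow_right h h1

variable (k r) in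
/-- The span of the `ξ_α` with `α` of rank at least `d`. -/
noncomputable def rankSpan (d : ℕ) : Submodule k (RedAlg k r) :=
  Submodule.span k (xi k '' {α | d ≤ rk α})

-- Superadditivity of the rank shows that multiplying by a proper ξ_β raises the rank by at least
-- one. Conversely, a factorization of length rk α exhibits ξ_α as a product of rk α elements of I.
include hP in
theorem mem_pow_iff {d : ℕ} {a : RedAlg k r} : a ∈ redIdeal k r ^ d ↔ a ∈ rankSpan k r d := by
  constructor
  · intro ha
    induction d generalizing a with
    | zero =>
      induction a using red_induction with
      | h0 => exact zero_mem _
      | hadd a b iha ihb => exact add_mem (iha (mem_pow_zero a)) (ihb (mem_pow_zero b))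
      | hsmul c a ih => exact Submodule.smul_mem _ _ (ih (mem_pow_zero a))
      | hxi α => exact Submodule.subset_span ⟨α, Nat.zero_le _, rfl⟩
    | succ d ih =>
      rw [Submodule.pow_succ] at ha
      refine Submodule.mul_induction_on ha (fun b hb c hc => ?_) fun _ _ => add_mem
      have hb := ih hb
      rw [mem_redIdeal] at hc
      refine Submodule.span_induction (p := fun b _ => b * c ∈ rankSpan k r (d + 1)) ?_ ?_ ?_ ?_ hb
      · rintro _ ⟨α, hα, rfl⟩
        refine Submodule.span_induction
          (p := fun c _ => xi k α * c ∈ rankSpan k r (d + 1)) ?_ ?_ ?_ ?_ hc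
        · rintro _ ⟨⟨β, hβ⟩, rfl⟩
          by_cases h : target α = source β
          · change xi k α * xi k β ∈ _
            rw [xi_mul_xi (composes_comp h)]
            refine Submodule.subset_span ⟨_, ?_, rfl⟩
            have h1 := rk_add_le hP h
            have h2 := rk_pos hP hβ
            have h3 : d ≤ rk α := hα
            change d + 1 ≤ rk (comp α β)
            omega
          · change xi k α * xi k β ∈ _
            rw [xi_mul_xi_of_ne h]
            exact zero_mem _
        · rw [mul_zero]; exact zero_mem _
        · intro x y _ _ hx hy
          rw [mul_add]; exact add_mem hx hy
        · intro t x _ hx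
          rw [mul_smul_comm]; exact Submodule.smul_mem _ _ hx
      · rw [zero_mul]; exact zero_mem _
      · intro x y _ _ hx hy
        rw [add_mul]; exact add_mem hx hy
      · intro t x _ hx
        rw [smul_mul_assoc]; exact Submodule.smul_mem _ _ hx
  · intro ha
    induction ha using Submodule.span_induction with
    | mem x hx =>
      obtain ⟨α, hα, rfl⟩ := hx
      exact xi_mem_pow hP k hα
    | zero => exact zero_mem _
    | add x y _ _ hx hy => exact add_mem hx hy
    | smul t x _ hx => exact Submodule.smul_of_tower_mem _ t hx

variable (k) in
/-- The coefficient of `ξ_α`. -/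
noncomputable def xiCoeff (α : IntClass r) : RedAlg k r →ₗ[k] k := Finsupp.lapply α

open Classical in
theorem xiCoeff_xi (α β : IntClass r) : xiCoeff k α (xi k β) = if β = α then 1 else 0 :=
  Finsupp.single_apply

include hP in
theorem xiCoeff_of_mem {α : IntClass r} {d : ℕ} (h : rk α < d) {a : RedAlg k r}
    (ha : a ∈ redIdeal k r ^ d) : xiCoeff k α a = 0 := by
  classical
  rw [mem_pow_iff hP] at ha
  induction ha using Submodule.span_induction with
  | mem x hx =>
    obtain ⟨β, hβ, rfl⟩ := hx
    rw [xiCoeff_xi, if_neg]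
    rintro rfl
    exact absurd h (not_lt.2 hβ)
  | zero => exact map_zero _
  | add x y _ _ hx hy => rw [map_add, hx, hy, add_zero]
  | smul t x _ hx => rw [map_smul, hx, smul_zero]

variable (k) in
/-- The class of `ξ_α` in degree `rk α` of the associated graded ring. -/
noncomputable def zeta (α : IntClass r) : RedGr k r :=
  DirectSum.lof k ℕ (GrPiece (redIdeal k r)) (rk α) (grMk (xi k α) (xi_mem_pow hP k le_rfl))

/-- Composable classes, the rank of whose composition is the sum of the ranks. -/
def Good (α β : IntClass r) : Prop := target α = source β ∧ rk (comp α β) = rk α + rk β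

theorem lof_grMk_mul {m n : ℕ} {a b : RedAlg k r} (ha : a ∈ redIdeal k r ^ m)
    (hb : b ∈ redIdeal k r ^ n) :
    (DirectSum.lof k ℕ (GrPiece (redIdeal k r)) m (grMk a ha) : RedGr k r) *
      DirectSum.lof k ℕ (GrPiece (redIdeal k r)) n (grMk b hb) =
      DirectSum.lof k ℕ (GrPiece (redIdeal k r)) (m + n) (grMk (a * b) (mul_mem_pow_add ha hb)) :=
  DirectSum.of_mul_of _ _

theorem lof_grMk_congr {m n : ℕ} {a b : RedAlg k r} (ha : a ∈ redIdeal k r ^ m)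
    (hb : b ∈ redIdeal k r ^ n) (hmn : m = n) (hab : a = b) :
    DirectSum.lof k ℕ (GrPiece (redIdeal k r)) m (grMk a ha) =
      DirectSum.lof k ℕ (GrPiece (redIdeal k r)) n (grMk b hb) := by
  subst hmn hab
  rfl

theorem grMk_eq_zero {d : ℕ} {a : RedAlg k r} (ha : a ∈ redIdeal k r ^ d)
    (h : a ∈ redIdeal k r ^ (d + 1)) : grMk a ha = 0 :=
  (grMk_eq ha (zero_mem _)).2 (by rwa [sub_zero])

theorem zeta_mul_zeta_good {α β : IntClass r} (h : Good α β) :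
    zeta hP k α * zeta hP k β = zeta hP k (comp α β) := by
  unfold zeta
  rw [lof_grMk_mul]
  exact lof_grMk_congr _ _ h.2.symm (xi_mul_xi (composes_comp h.1))

/-- Either the product already vanishes in A, or the composite has rank at least rk α + rk β + 1, so
that the product dies in the quotient by the next power of I. -/
theorem zeta_mul_zeta_not_good {α β : IntClass r} (h : ¬ Good α β) :
    zeta hP k α * zeta hP k β = 0 := by
  unfold zeta
  rw [lof_grMk_mul, grMk_eq_zero, map_zero]
  by_cases h1 : target α = source β
  · rw [xi_mul_xi (composes_comp h1)]
    apply xi_mem_pow hP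
    have := rk_add_le hP h1
    have h2 : rk (comp α β) ≠ rk α + rk β := fun h2 => h ⟨h1, h2⟩
    omega
  · rw [xi_mul_xi_of_ne h1]
    exact zero_mem _

open Classical in
theorem zeta_mul_zeta (α β : IntClass r) :
    zeta hP k α * zeta hP k β = if Good α β then zeta hP k (comp α β) else 0 := by
  split_ifs with h
  · exact zeta_mul_zeta_good hP h
  · exact zeta_mul_zeta_not_good hP h

/-- The linear form `ζ_β ↦ δ_{αβ}`. -/
noncomputable def zetaCoeff (α : IntClass r) : RedGr k r →ₗ[k] k :=
  grPieceForm k (rk α) (xiCoeff k α) (fun _ h => xiCoeff_of_mem hP (Nat.lt_succ_self _) h) ∘ₗ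
    DirectSum.component k ℕ _ (rk α)

open Classical in
theorem zetaCoeff_zeta (α β : IntClass r) :
    zetaCoeff hP α (zeta hP k β) = if β = α then 1 else 0 := by
  unfold zetaCoeff zeta
  rw [LinearMap.comp_apply]
  by_cases h : rk β = rk α
  · rw [← xiCoeff_xi]
    have e : DirectSum.component k ℕ (GrPiece (redIdeal k r)) (rk α)
        (DirectSum.lof k ℕ _ (rk β) (grMk (xi k β) (xi_mem_pow hP k le_rfl))) =
        grMk (xi k β) (xi_mem_pow hP k h.ge) := by
      rw [lof_grMk_congr _ (xi_mem_pow hP k h.ge) h rfl]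
      exact DirectSum.component.lof_self k (ι := ℕ) (M := GrPiece (redIdeal k r)) (rk α) _
    rw [e]
    rfl
  · rw [DirectSum.component.of, dif_neg h, map_zero, if_neg]
    rintro rfl
    exact h rfl

theorem linearIndependent_zeta : LinearIndependent k (zeta hP k (r := r)) := by
  classical
  have key (α : IntClass r) (c : IntClass r →₀ k) :
      zetaCoeff hP α (Finsupp.linearCombination k (zeta hP k) c) = c α := by
    rw [Finsupp.linearCombination_apply, map_finsuppSum]
    simp +contextual [zetaCoeff_zeta, Finsupp.sum, eq_comm]
  intro c c' h
  ext α
  rw [← key, ← key, h]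

/-- In an expansion of a into ξ_α of rank at least d, the terms of rank greater than d vanish modulo
I^(d+1). -/
theorem lof_grMk_mem_span {d : ℕ} {a : RedAlg k r} (ha : a ∈ redIdeal k r ^ d) :
    DirectSum.lof k ℕ (GrPiece (redIdeal k r)) d (grMk a ha) ∈
      Submodule.span k (zeta hP k '' {α | rk α = d}) := by
  have ha' := (mem_pow_iff hP).1 ha
  induction ha' using Submodule.span_induction with
  | mem x hx =>
    obtain ⟨α, hα, rfl⟩ := hx
    rcases (show d ≤ rk α from hα).eq_or_lt with h | h
    · subst h
      exact Submodule.subset_span ⟨α, rfl, rfl⟩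
    · rw [grMk_eq_zero, map_zero]
      · exact zero_mem _
      · exact xi_mem_pow hP k h
  | zero =>
    have : grMk (0 : RedAlg k r) ha = 0 := rfl
    rw [this, map_zero]
    exact zero_mem _
  | add x y hx hy ihx ihy =>
    have hx' := (mem_pow_iff hP).2 hx
    have hy' := (mem_pow_iff hP).2 hy
    have : grMk (x + y) ha = grMk x hx' + grMk y hy' := rfl
    rw [this, map_add]
    exact add_mem (ihx hx') (ihy hy')
  | smul t x hx ih =>
    have hx' := (mem_pow_iff hP).2 hx
    have : grMk (t • x) ha = t • grMk x hx' := rfl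
    rw [this, map_smul]
    exact Submodule.smul_mem _ _ (ih hx')

theorem redGrading_eq (d : ℕ) :
    redGrading k r d = Submodule.span k (zeta hP k '' {α | rk α = d}) := by
  apply le_antisymm
  · rintro _ ⟨x, rfl⟩
    obtain ⟨a, ha, rfl⟩ := grMk_surj x
    exact lof_grMk_mem_span hP ha
  · refine Submodule.span_le.2 ?_
    rintro _ ⟨α, rfl, rfl⟩
    exact ⟨_, rfl⟩

theorem iSup_redGrading : ⨆ d, redGrading k r d = ⊤ := by
  rw [eq_top_iff]
  intro x _
  induction x using DirectSum.induction_on with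
  | zero => exact zero_mem _
  | of d x => exact Submodule.mem_iSup_of_mem d ⟨x, rfl⟩
  | add x y hx hy => exact add_mem (hx trivial) (hy trivial)

theorem span_zeta : Submodule.span k (Set.range (zeta hP k (r := r))) = ⊤ := by
  rw [eq_top_iff, ← iSup_redGrading]
  refine iSup_le fun d => ?_
  rw [redGrading_eq hP]
  exact Submodule.span_mono (Set.image_subset_range _ _)

theorem pointInt_mul_zeta {X : PointClass r} {α : IntClass r} (h : X = source α) :
    zeta hP k (pointInt X) * zeta hP k α = zeta hP k α := by
  have h1 := pointInt_comp h
  rw [zeta_mul_zeta_good hP, h1]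
  exact ⟨by simpa using h, by rw [h1, rk_pointInt hP, zero_add]⟩

theorem zeta_mul_pointInt {X : PointClass r} {α : IntClass r} (h : target α = X) :
    zeta hP k α * zeta hP k (pointInt X) = zeta hP k α := by
  have h1 := comp_pointInt h.symm
  rw [zeta_mul_zeta_good hP, h1]
  exact ⟨by simpa using h, by rw [h1, rk_pointInt hP, add_zero]⟩

open Classical in
theorem pointChar_zeta (X : PointClass r) (α : IntClass r) :
    pointChar k X (zeta hP k α) = if α = pointInt X then 1 else 0 := by
  rw [← pointCoeff_xi (k := k), ← pieceCoeff_grMk k X (xi_mem_pow hP k (le_refl (rk α)))]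
  exact DirectSum.toModule_lof k (rk α) _

theorem pointChar_of_isProper (X : PointClass r) {α : IntClass r} (h : IsProper α) :
    pointChar k X (zeta hP k α) = 0 := by
  rw [pointChar_zeta, if_neg]
  rintro rfl
  exact not_isProper_pointInt X h

end GradedBasis

/-- A family of subspaces which span and are separated by linear maps is a direct sum
decomposition. -/
theorem isInternal_of_separated {k V W L : Type*} [DecidableEq L] [Field k] [AddCommGroup V]
    [Module k V] [AddCommGroup W] [Module k W] {D : L → Submodule k V} (pr : L → V →ₗ[k] W)
    (h1 : ∀ l, ∀ x ∈ D l, pr l x = 0 → x = 0) (h0 : ∀ l l', l' ≠ l → ∀ x ∈ D l', pr l x = 0)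
    (htop : ⨆ l, D l = ⊤) : DirectSum.IsInternal D := by
  rw [DirectSum.isInternal_submodule_iff_iSupIndep_and_iSup_eq_top]
  refine ⟨fun l => ?_, htop⟩
  rw [Submodule.disjoint_def]
  intro x hx hx'
  have h : ⨆ j, ⨆ (_ : j ≠ l), D j ≤ LinearMap.ker (pr l) :=
    iSup_le fun j => iSup_le fun hj x hx => h0 l j hj x hx
  exact h1 l x hx (h hx')

/-! ### The merging operator. -/

section Merge

variable {P : Type u} [PartialOrder P] (hP : ∀ x y : P, (Set.Icc x y).Finite)
  (k : Type v) [Field k] {r : Setoid (NonemptyInterval P)} [IncidenceAxioms r]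

open Classical in
/-- The alternating sum of the lists obtained by composing two successive entries which are
`Good`, the first one with sign `1`. -/
noncomputable def merge : List (IntClass r) → (List (IntClass r) →₀ k)
  | [] => 0
  | [_] => 0
  | α :: β :: l => (if Good α β then Finsupp.single (comp α β :: l) 1 else 0) -
      Finsupp.lmapDomain k k (List.cons α) (merge (β :: l))

/-- The weight survives because only pairs of additive rank are merged, the product because
composition is associative. These two invariants later split the complex of paths. -/
theorem IsPath.merge_mem {X Y : PointClass r} {l : List (IntClass r)} (h : IsPath Y X l) :
    merge k l ∈ Finsupp.supported k k {m | IsPath Y X m ∧ m.length + 1 = l.length ∧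
      weight m = weight l ∧ prodFrom X m = prodFrom X l} := by
  induction l generalizing X with
  | nil => exact zero_mem _
  | cons α l ih =>
    cases l with
    | nil => exact zero_mem _
    | cons β l =>
      refine sub_mem ?_ ?_
      · split_ifs with hg
        · refine Finsupp.single_mem_supported k _ ⟨⟨?_, ?_, ?_⟩, rfl, ?_, ?_⟩
          · exact isProper_comp_left hg.1 h.1
          · exact (source_comp hg.1).trans h.2.1
          · rw [target_comp hg.1]; exact h.2.2.2.2
          · simp only [weight_cons]
            rw [hg.2, add_assoc]
          · simp only [prodFrom]
            rw [target_comp hg.1, comp_assoc hg.1 h.2.2.2.2.source_prodFrom.symm]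
        · exact zero_mem _
      · have h1 := ih h.2.2
        have h2 := Submodule.mem_map_of_mem (f := Finsupp.lmapDomain k k (List.cons α)) h1
        rw [Finsupp.lmapDomain_supported] at h2
        refine Finsupp.supported_mono ?_ h2
        rintro _ ⟨m, hm, rfl⟩
        refine ⟨⟨h.1, h.2.1, hm.1⟩, ?_, ?_, ?_⟩
        · simpa using hm.2.1
        · simpa using hm.2.2.1
        · simp only [prodFrom] at hm ⊢
          rw [hm.2.2.2]

end Merge

/-! ### A copy of the graded ring with controlled module structures. -/

section Wrapper

variable {P : Type u} [PartialOrder P] (hP : ∀ x y : P, (Set.Icc x y).Finite)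
  (k : Type v) [Field k] (r : Setoid (NonemptyInterval P)) [IncidenceAxioms r]

/-- The ring `R = gr_I A`, as a type whose only module structures are those which come from its
ring and algebra structures. -/
def GrR : Type (max u v) := RedGr k r

noncomputable instance : Ring (GrR k r) := inferInstanceAs (Ring (RedGr k r))

noncomputable instance : Algebra k (GrR k r) := inferInstanceAs (Algebra k (RedGr k r))

variable {r} in
noncomputable instance (X : PointClass r) : Module (GrR k r) (PointModule k X) :=
  inferInstanceAs (Module (RedGr k r) (PointModule k X))

variable {r} in
noncomputable instance (X : PointClass r) : Module (GrR k r)ᵐᵒᵖ (PointModule k X) :=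
  inferInstanceAs (Module (RedGr k r)ᵐᵒᵖ (PointModule k X))

variable {r} in
instance (X : PointClass r) : IsScalarTower k (GrR k r) (PointModule k X) :=
  inferInstanceAs (IsScalarTower k (RedGr k r) (PointModule k X))

/-- The homogeneous components of `R`. -/
noncomputable def grGrading (d : ℕ) : Submodule k (GrR k r) := redGrading k r d

variable {r}

/-- The character of `R` on `k_X`. -/
noncomputable def grChar (X : PointClass r) : GrR k r →ₐ[k] k := pointChar k X

/-- The basis element `ζ_α` of `R`. -/
noncomputable def zetaGr (α : IntClass r) : GrR k r := zeta hP k α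

theorem linearIndependent_zetaGr : LinearIndependent k (zetaGr hP k (r := r)) :=
  linearIndependent_zeta hP

theorem span_zetaGr : Submodule.span k (Set.range (zetaGr hP k (r := r))) = ⊤ := span_zeta hP

/-- The basis `ζ_α` of `R`. -/
noncomputable def zetaBasis : Module.Basis (IntClass r) k (GrR k r) :=
  Module.Basis.mk (linearIndependent_zetaGr hP k) (span_zetaGr hP k).ge

theorem zetaBasis_apply (α : IntClass r) : zetaBasis hP k α = zetaGr hP k α := by
  simp [zetaBasis]

open Classical in
theorem zetaGr_mul_zetaGr (α β : IntClass r) :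
    zetaGr hP k α * zetaGr hP k β = if Good α β then zetaGr hP k (comp α β) else 0 :=
  zeta_mul_zeta hP α β

theorem pointInt_mul_zetaGr {X : PointClass r} {α : IntClass r} (h : X = source α) :
    zetaGr hP k (pointInt X) * zetaGr hP k α = zetaGr hP k α :=
  pointInt_mul_zeta hP h

theorem zetaGr_mul_pointInt {X : PointClass r} {α : IntClass r} (h : target α = X) :
    zetaGr hP k α * zetaGr hP k (pointInt X) = zetaGr hP k α :=
  zeta_mul_pointInt hP h

theorem grGrading_eq (d : ℕ) :
    grGrading k r d = Submodule.span k (zetaGr hP k '' {α | rk α = d}) := redGrading_eq hP d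

variable (r) in
theorem iSup_grGrading : ⨆ d, grGrading k r d = ⊤ := iSup_redGrading

open Classical in
theorem grChar_zetaGr (X : PointClass r) (α : IntClass r) :
    grChar k X (zetaGr hP k α) = if α = pointInt X then 1 else 0 := pointChar_zeta hP X α

theorem grChar_of_isProper (X : PointClass r) {α : IntClass r} (h : IsProper α) :
    grChar k X (zetaGr hP k α) = 0 := pointChar_of_isProper hP X h

variable (r) in
/-- The identification of `k_X` with `k`. -/
noncomputable def pointVal (X : PointClass r) : PointModule k X ≃ₗ[k] k := LinearEquiv.refl k k

theorem gr_smul_one (X : PointClass r) (a : GrR k r) :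
    a • (pointVal k r X).symm 1 = (pointVal k r X).symm (grChar k X a) :=
  mul_one (grChar k X a)

theorem gr_op_smul (X : PointClass r) (a : GrR k r) (c : PointModule k X) :
    MulOpposite.op a • c = grChar k X a • c := rfl

end Wrapper

/-! ### The normalized bar resolution of k_Y. -/

section Bar

variable {P : Type u} [PartialOrder P] (hP : ∀ x y : P, (Set.Icc x y).Finite)
  (k : Type v) [Field k] {r : Setoid (NonemptyInterval P)} [IncidenceAxioms r]

variable (r) in
/-- The free `R`-module on all lists of classes, which contains the bar resolutions. -/
abbrev BarAmbient : Type (max u v) := List (IntClass r) →₀ GrR k r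

variable {k} in
/-- The `k`-linear map `k[List] → R[List]`, `l ↦ a l`. -/
noncomputable def embed (a : GrR k r) : (List (IntClass r) →₀ k) →ₗ[k] BarAmbient k r :=
  Finsupp.mapRange.linearMap (LinearMap.toSpanSingleton k (GrR k r) a)

variable {k} in
theorem embed_single (a : GrR k r) (l : List (IntClass r)) (c : k) :
    embed a (Finsupp.single l c) = c • Finsupp.single l a := by
  simp [embed]

variable {k} in
theorem smul_embed (a b : GrR k r) (c : List (IntClass r) →₀ k) :
    a • embed b c = embed (a * b) c := by
  induction c using Finsupp.induction_linear with
  | zero => simp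
  | add x y hx hy => rw [map_add, map_add, smul_add, hx, hy]
  | single l t =>
    rw [embed_single, embed_single, smul_comm, Finsupp.smul_single, smul_eq_mul]

/-- The bar differential on generators. -/
noncomputable def barGen : List (IntClass r) → BarAmbient k r
  | [] => 0
  | α :: l => Finsupp.single l (zetaGr hP k α) - embed 1 (merge k (α :: l))

/-- The bar differential. -/
noncomputable def barD : BarAmbient k r →ₗ[GrR k r] BarAmbient k r :=
  Finsupp.linearCombination (GrR k r) (barGen hP k)

theorem barD_nil (a : GrR k r) : barD hP k (Finsupp.single [] a) = 0 := by
  simp [barD, barGen]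

theorem barD_cons (a : GrR k r) (α : IntClass r) (l : List (IntClass r)) :
    barD hP k (Finsupp.single (α :: l) a) =
      Finsupp.single l (a * zetaGr hP k α) - embed a (merge k (α :: l)) := by
  simp [barD, barGen, smul_sub, smul_embed]

open Classical in
/-- The contracting homotopy of the bar resolution. -/
noncomputable def barS : BarAmbient k r →ₗ[k] BarAmbient k r :=
  Finsupp.lsum k fun l => (zetaBasis hP k).constr k fun α =>
    if IsProper α then Finsupp.single (α :: l) (zetaGr hP k (pointInt (source α))) else 0

open Classical in
theorem barS_single (l : List (IntClass r)) (α : IntClass r) :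
    barS hP k (Finsupp.single l (zetaGr hP k α)) =
      if IsProper α then Finsupp.single (α :: l) (zetaGr hP k (pointInt (source α))) else 0 := by
  unfold barS
  rw [Finsupp.lsum_single, ← zetaBasis_apply, Module.Basis.constr_basis]

theorem barS_of_isProper (l : List (IntClass r)) {α : IntClass r} (h : IsProper α) :
    barS hP k (Finsupp.single l (zetaGr hP k α)) =
      Finsupp.single (α :: l) (zetaGr hP k (pointInt (source α))) := by
  rw [barS_single, if_pos h]

theorem barS_of_not_isProper (l : List (IntClass r)) {α : IntClass r} (h : ¬ IsProper α) :
    barS hP k (Finsupp.single l (zetaGr hP k α)) = 0 := by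
  rw [barS_single, if_neg h]

theorem barS_embed_of_isProper {α : IntClass r} (h : IsProper α) (c : List (IntClass r) →₀ k) :
    barS hP k (embed (zetaGr hP k α) c) =
      embed (zetaGr hP k (pointInt (source α))) (Finsupp.lmapDomain k k (List.cons α) c) := by
  induction c using Finsupp.induction_linear with
  | zero => simp
  | add x y hx hy => simp only [map_add, hx, hy]
  | single l t =>
    rw [embed_single, map_smul, barS_of_isProper hP k l h, Finsupp.lmapDomain_apply,
      Finsupp.mapDomain_single, embed_single]

theorem barS_embed_of_not_isProper {α : IntClass r} (h : ¬ IsProper α)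
    (c : List (IntClass r) →₀ k) : barS hP k (embed (zetaGr hP k α) c) = 0 := by
  induction c using Finsupp.induction_linear with
  | zero => simp
  | add x y hx hy => simp only [map_add, hx, hy, add_zero]
  | single l t => rw [embed_single, map_smul, barS_of_not_isProper hP k l h, smul_zero]

variable (Y : PointClass r)

/-- The augmentation of the bar resolution. -/
noncomputable def barAug : BarAmbient k r →ₗ[GrR k r] PointModule k Y :=
  LinearMap.toSpanSingleton (GrR k r) (PointModule k Y) ((pointVal k r Y).symm 1) ∘ₗ
    Finsupp.lapply (R := GrR k r) ([] : List (IntClass r))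

theorem barAug_single_nil (a : GrR k r) :
    barAug k Y (Finsupp.single [] a) = (pointVal k r Y).symm (grChar k Y a) := by
  unfold barAug
  rw [LinearMap.comp_apply, Finsupp.lapply_apply, Finsupp.single_eq_same,
    LinearMap.toSpanSingleton_apply, gr_smul_one]

theorem barAug_single_cons (α : IntClass r) (l : List (IntClass r)) (a : GrR k r) :
    barAug k Y (Finsupp.single (α :: l) a) = 0 := by
  simp [barAug]

/-- The section of the augmentation. -/
noncomputable def barUnit : PointModule k Y →ₗ[k] BarAmbient k r :=
  LinearMap.toSpanSingleton k (BarAmbient k r) (Finsupp.single [] (zetaGr hP k (pointInt Y))) ∘ₗ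
    (pointVal k r Y).toLinearMap

theorem barUnit_apply (c : PointModule k Y) :
    barUnit hP k Y c = pointVal k r Y c • Finsupp.single [] (zetaGr hP k (pointInt Y)) := rfl

theorem barD_barUnit (c : PointModule k Y) : barD hP k (barUnit hP k Y c) = 0 := by
  rw [barUnit_apply, LinearMap.map_smul_of_tower, barD_nil, smul_zero]

/-- The homotopy moves a proper coefficient α into the list as a new first entry and kills point
classes. For proper α, the merges in the differential of the longer list cancel against the homotopy
of the differential. For a point class, only the term where the first entry acts on the coefficient
contributes, and the homotopy moves that entry back. The empty list over the point class of Y is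
supplied by the augmentation. -/
theorem bar_contraction_single {l : List (IntClass r)} {α : IntClass r}
    (h : IsPath Y (target α) l) :
    barD hP k (barS hP k (Finsupp.single l (zetaGr hP k α))) +
      barS hP k (barD hP k (Finsupp.single l (zetaGr hP k α))) +
      barUnit hP k Y (barAug k Y (Finsupp.single l (zetaGr hP k α))) =
      Finsupp.single l (zetaGr hP k α) := by
  classical
  rcases isProper_or α with hα | hα
  · rw [barS_of_isProper hP k l hα, barD_cons, pointInt_mul_zetaGr hP k rfl]
    cases l with
    | nil =>
      rw [barD_nil, map_zero, barAug_single_nil, grChar_of_isProper hP k Y hα, map_zero, map_zero]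
      simp [merge]
    | cons β l =>
      rw [barAug_single_cons, barD_cons, map_sub (barS hP k), barS_embed_of_isProper hP k hα,
        map_zero, zetaGr_mul_zetaGr hP k]
      simp only [merge, map_sub]
      split_ifs with hg
      · rw [barS_of_isProper hP k _ (isProper_comp_left hg.1 hα), source_comp hg.1,
          embed_single, one_smul]
        abel
      · simp
  · have hα' : ¬ IsProper α := hα ▸ not_isProper_pointInt _
    have ht : target α = source α := by rw [hα]; simp
    rw [barS_of_not_isProper hP k l hα', map_zero]
    cases l with
    | nil =>
      obtain rfl : target α = Y := h
      rw [barD_nil, map_zero, barAug_single_nil, grChar_zetaGr hP k, if_pos (by rw [ht, ← hα]),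
        barUnit_apply, LinearEquiv.apply_symm_apply, one_smul, ht, ← hα]
      simp
    | cons β l =>
      -- The point class α acts as the identity on ζ_β.
      have hs : source α = source β := ht.symm.trans h.2.1.symm
      rw [barAug_single_cons, map_zero, barD_cons, map_sub, barS_embed_of_not_isProper hP k hα',
        hα, pointInt_mul_zetaGr hP k hs, barS_of_isProper hP k l h.1, hs]
      simp

/-- The index set of the basis of the bar resolution. -/
def barIndex (i : ℕ) : Set (List (IntClass r) × IntClass r) :=
  {s | IsPath Y (target s.2) s.1 ∧ s.1.length = i}

/-- The span of basis elements of the bar resolution. -/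
noncomputable def barSpan (s : Set (List (IntClass r) × IntClass r)) :
    Submodule k (BarAmbient k r) :=
  Submodule.span k ((fun t => Finsupp.single t.1 (zetaGr hP k t.2)) '' s)

theorem single_mem_barSpan {s : Set (List (IntClass r) × IntClass r)} {l : List (IntClass r)}
    {α : IntClass r} (h : (l, α) ∈ s) : Finsupp.single l (zetaGr hP k α) ∈ barSpan hP k s :=
  Submodule.subset_span ⟨_, h, rfl⟩

theorem barSpan_le {s : Set (List (IntClass r) × IntClass r)} {N : Submodule k (BarAmbient k r)}
    (h : ∀ t ∈ s, Finsupp.single t.1 (zetaGr hP k t.2) ∈ N) : barSpan hP k s ≤ N := by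
  refine Submodule.span_le.2 ?_
  rintro _ ⟨t, ht, rfl⟩
  exact h t ht

theorem embed_mem_barSpan {s : Set (List (IntClass r) × IntClass r)} {α : IntClass r}
    {c : List (IntClass r) →₀ k} (h : c ∈ Finsupp.supported k k {l | (l, α) ∈ s}) :
    embed (zetaGr hP k α) c ∈ barSpan hP k s := by
  rw [Finsupp.supported_eq_span_single] at h
  induction h using Submodule.span_induction with
  | mem x hx =>
    obtain ⟨l, hl, rfl⟩ := hx
    rw [embed_single, one_smul]
    exact single_mem_barSpan hP k hl
  | zero => rw [map_zero]; exact zero_mem _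
  | add x y _ _ hx hy => rw [map_add]; exact add_mem hx hy
  | smul c x _ hx => rw [map_smul]; exact Submodule.smul_mem _ _ hx

/-- The index set of the degree `j` part of the bar resolution. -/
def barIndexDeg (i : ℕ) (j : ℤ) : Set (List (IntClass r) × IntClass r) :=
  {s | s ∈ barIndex Y i ∧ ((rk s.2 + weight s.1 : ℕ) : ℤ) = j}

theorem smul_barSpan {a : ℕ} {s s' : Set (List (IntClass r) × IntClass r)}
    (hs : ∀ t ∈ s, ∀ β, rk β = a → Good β t.2 → (t.1, comp β t.2) ∈ s') {x : GrR k r}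
    {y : BarAmbient k r} (hx : x ∈ grGrading k r a) (hy : y ∈ barSpan hP k s) :
    x • y ∈ barSpan hP k s' := by
  classical
  rw [grGrading_eq hP k] at hx
  induction hx using Submodule.span_induction with
  | mem x hx =>
    obtain ⟨β, hβ, rfl⟩ := hx
    induction hy using Submodule.span_induction with
    | mem y hy =>
      obtain ⟨t, ht, rfl⟩ := hy
      dsimp only
      rw [Finsupp.smul_single, smul_eq_mul, zetaGr_mul_zetaGr hP k]
      split_ifs with hg
      · exact single_mem_barSpan hP k (hs t ht β hβ hg)
      · rw [Finsupp.single_zero]; exact zero_mem _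
    | zero => rw [smul_zero]; exact zero_mem _
    | add x y _ _ hx hy => rw [smul_add]; exact add_mem hx hy
    | smul c x _ hx => rw [smul_comm]; exact Submodule.smul_mem _ _ hx
  | zero => rw [zero_smul]; exact zero_mem _
  | add x y _ _ hx hy => rw [add_smul]; exact add_mem hx hy
  | smul c x _ hx => rw [smul_assoc]; exact Submodule.smul_mem _ _ hx

theorem smul_mem_barSpan_index {i : ℕ} (x : GrR k r) {y : BarAmbient k r}
    (hy : y ∈ barSpan hP k (barIndex Y i)) : x • y ∈ barSpan hP k (barIndex Y i) := by
  have hx : x ∈ ⨆ d, grGrading k r d := by rw [iSup_grGrading]; trivial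
  induction hx using Submodule.iSup_induction' with
  | mem d x hx =>
    refine smul_barSpan hP k (s := barIndex Y i) (s' := barIndex Y i) (fun t ht β _ hg => ⟨?_, ht.2⟩) hx hy
    rw [target_comp hg.1]
    exact ht.1
  | zero => rw [zero_smul]; exact zero_mem _
  | add x y _ _ hx hy => rw [add_smul]; exact add_mem hx hy

/-- The terms of the bar resolution of `k_Y`. -/
noncomputable def barModule (i : ℕ) : Submodule (GrR k r) (BarAmbient k r) where
  __ := barSpan hP k (barIndex Y i)
  smul_mem' x _ hy := smul_mem_barSpan_index hP k Y x hy

theorem barD_mem_deg {i : ℕ} {j : ℤ} {x : BarAmbient k r}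
    (hx : x ∈ barSpan hP k (barIndexDeg Y (i + 1) j)) :
    barD hP k x ∈ barSpan hP k (barIndexDeg Y i j) := by
  classical
  refine barSpan_le hP k (N := (barSpan hP k (barIndexDeg Y i j)).comap
    ((barD hP k).restrictScalars k)) ?_ hx
  rintro ⟨l, α⟩ ⟨⟨h1, h2⟩, h3⟩
  cases l with
  | nil => simp at h2
  | cons β l =>
    simp only [weight_cons] at h1 h2 h3
    rw [Submodule.mem_comap, LinearMap.restrictScalars_apply, barD_cons]
    refine sub_mem ?_ (embed_mem_barSpan hP k ?_)
    · rw [zetaGr_mul_zetaGr hP k]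
      split_ifs with hg
      · refine single_mem_barSpan hP k ⟨⟨?_, by simpa using h2⟩, ?_⟩
        · rw [target_comp hg.1]; exact h1.2.2
        · rw [hg.2, ← h3, add_assoc]
      · rw [Finsupp.single_zero]; exact zero_mem _
    · refine Finsupp.supported_mono ?_ (h1.merge_mem k)
      rintro m ⟨m1, m2, m3, -⟩
      refine ⟨⟨m1, ?_⟩, ?_⟩
      · simp only [List.length_cons] at m2 h2 ⊢
        omega
      · rw [← h3, m3, weight_cons]

theorem barSpan_mono {s t : Set (List (IntClass r) × IntClass r)} (h : s ⊆ t) :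
    barSpan hP k s ≤ barSpan hP k t := Submodule.span_mono (Set.image_mono h)

theorem barD_mem {i : ℕ} {x : BarAmbient k r} (hx : x ∈ barModule hP k Y (i + 1)) :
    barD hP k x ∈ barModule hP k Y i := by
  refine barSpan_le hP k (N := (barSpan hP k (barIndex Y i)).comap
    ((barD hP k).restrictScalars k)) (fun t ht => ?_) hx
  exact barSpan_mono hP k (fun _ h => h.1)
    (barD_mem_deg hP k Y (single_mem_barSpan hP k (s := barIndexDeg Y (i + 1) _) ⟨ht, rfl⟩))

theorem barD_zero {x : BarAmbient k r} (hx : x ∈ barModule hP k Y 0) : barD hP k x = 0 := by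
  refine barSpan_le hP k (N := LinearMap.ker ((barD hP k).restrictScalars k)) ?_ hx
  rintro ⟨l, α⟩ ⟨h1, h2⟩
  obtain rfl := List.length_eq_zero_iff.1 h2
  exact barD_nil hP k _

theorem barS_mem {i : ℕ} {x : BarAmbient k r} (hx : x ∈ barModule hP k Y i) :
    barS hP k x ∈ barModule hP k Y (i + 1) := by
  refine barSpan_le hP k (N := (barSpan hP k (barIndex Y (i + 1))).comap (barS hP k)) ?_ hx
  rintro ⟨l, α⟩ ⟨h1, h2⟩
  rw [Submodule.mem_comap]
  by_cases h : IsProper α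
  · rw [barS_of_isProper hP k _ h]
    exact single_mem_barSpan hP k ⟨⟨h, by simp, h1⟩, by simpa using h2⟩
  · rw [barS_of_not_isProper hP k _ h]
    exact zero_mem _

theorem bar_contraction {i : ℕ} {x : BarAmbient k r} (hx : x ∈ barModule hP k Y i) :
    barD hP k (barS hP k x) + barS hP k (barD hP k x) + barUnit hP k Y (barAug k Y x) = x := by
  refine barSpan_le hP k (N := LinearMap.eqLocus
    ((barD hP k).restrictScalars k ∘ₗ barS hP k + barS hP k ∘ₗ (barD hP k).restrictScalars k +
      barUnit hP k Y ∘ₗ (barAug k Y).restrictScalars k) LinearMap.id) ?_ hx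
  rintro ⟨l, α⟩ ⟨h1, -⟩
  exact bar_contraction_single hP k Y h1

/-- Only the coefficient of the empty list matters. It can be reached from a one-entry list alone,
and there the entry is proper, so the character of k_Y kills it. -/
theorem barAug_barD {i : ℕ} {x : BarAmbient k r} (hx : x ∈ barModule hP k Y i) :
    barAug k Y (barD hP k x) = 0 := by
  refine barSpan_le hP k (N := LinearMap.ker
    ((barAug k Y ∘ₗ barD hP k).restrictScalars k)) ?_ hx
  rintro ⟨l, α⟩ ⟨h1, -⟩
  rw [LinearMap.mem_ker]
  change barAug k Y (barD hP k (Finsupp.single l (zetaGr hP k α))) = 0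
  cases l with
  | nil => rw [barD_nil, map_zero]
  | cons β l =>
    rw [barD_cons, map_sub]
    have h2 : barAug k Y (Finsupp.single l (zetaGr hP k α * zetaGr hP k β)) = 0 := by
      cases l with
      | nil => rw [barAug_single_nil, map_mul, grChar_of_isProper hP k Y h1.1, mul_zero, map_zero]
      | cons γ l => rw [barAug_single_cons]
    rw [h2, zero_sub, neg_eq_zero]
    cases l with
    | nil => rw [show merge k [β] = 0 from rfl, map_zero, map_zero]
    | cons γ l =>
      have h3 := embed_mem_barSpan hP k (s := barIndex Y (l.length + 1)) (α := α)
        (Finsupp.supported_mono (by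
          rintro m ⟨m1, m2, -⟩
          exact ⟨m1, by simpa using m2⟩) (h1.merge_mem k))
      refine barSpan_le hP k (N := LinearMap.ker ((barAug k Y).restrictScalars k)) ?_ h3
      rintro ⟨m, γ⟩ ⟨-, hm⟩
      cases m with
      | nil => simp at hm
      | cons ε m => exact barAug_single_cons k Y _ _ _

/-- Instead of a sign computation, the contraction is used: every basis element of positive length
is an R-multiple of s(y) with y one step shorter. From d s = 1 - s d - (unit)(augmentation) it
follows that d d s y = d y - d s d y, and the contraction at d y, together with d d y = 0 by
induction, gives d s d y = d y. -/
theorem barD_barD {i : ℕ} {x : BarAmbient k r} (hx : x ∈ barModule hP k Y i) :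
    barD hP k (barD hP k x) = 0 := by
  induction i generalizing x with
  | zero => rw [barD_zero hP k Y hx, map_zero]
  | succ i ih =>
    refine barSpan_le hP k (N := LinearMap.ker
      ((barD hP k ∘ₗ barD hP k).restrictScalars k)) ?_ hx
    rintro ⟨l, α⟩ ⟨h1, h2⟩
    rw [LinearMap.mem_ker]
    change barD hP k (barD hP k (Finsupp.single l (zetaGr hP k α))) = 0
    cases l with
    | nil => simp at h2
    | cons β l =>
      have hy : Finsupp.single l (zetaGr hP k β) ∈ barModule hP k Y i :=
        single_mem_barSpan hP k ⟨h1.2.2, by simpa using h2⟩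
      have hb : Finsupp.single (β :: l) (zetaGr hP k α) =
          zetaGr hP k α • barS hP k (Finsupp.single l (zetaGr hP k β)) := by
        rw [barS_of_isProper hP k l h1.1, Finsupp.smul_single, smul_eq_mul,
          zetaGr_mul_pointInt hP k h1.2.1.symm]
      rw [hb, map_smul, map_smul]
      generalize Finsupp.single l (zetaGr hP k β) = y at hy
      -- The contraction identity solved for d s y.
      have e1 := eq_sub_of_add_eq (eq_sub_of_add_eq (bar_contraction hP k Y hy))
      rw [e1, map_sub, map_sub, barD_barUnit, sub_zero]
      have e2 : barD hP k (barS hP k (barD hP k y)) = barD hP k y := by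
        cases i with
        | zero => rw [barD_zero hP k Y hy, map_zero, map_zero]
        | succ i =>
          have e3 := bar_contraction hP k Y (barD_mem hP k Y hy)
          rwa [ih hy, map_zero, add_zero, barAug_barD hP k Y hy, map_zero, add_zero] at e3
      rw [e2, sub_self, smul_zero]

/-- The source of a list of classes which ends at `Y`. -/
def pathSource : List (IntClass r) → PointClass r
  | [] => Y
  | α :: _ => source α

theorem IsPath.pathSource_eq {X : PointClass r} {l : List (IntClass r)} (h : IsPath Y X l) :
    pathSource Y l = X := by
  cases l with
  | nil => exact h.symm
  | cons α l => exact h.2.1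

open Classical in
/-- The projection onto a term of the bar resolution. -/
noncomputable def barProj (i : ℕ) : BarAmbient k r →ₗ[GrR k r] barModule hP k Y i :=
  Finsupp.linearCombination (GrR k r) fun l =>
    if h : IsPath Y (pathSource Y l) l ∧ l.length = i then
      ⟨Finsupp.single l (zetaGr hP k (pointInt (pathSource Y l))),
        single_mem_barSpan hP k ⟨by simpa using h.1, h.2⟩⟩
    else 0

theorem barProj_apply {i : ℕ} {x : BarAmbient k r} (hx : x ∈ barModule hP k Y i) :
    (barProj hP k Y i x : BarAmbient k r) = x := by
  refine barSpan_le hP k (N := LinearMap.eqLocus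
    (((barModule hP k Y i).subtype ∘ₗ barProj hP k Y i).restrictScalars k) LinearMap.id) ?_ hx
  rintro ⟨l, α⟩ ⟨h1, h2⟩
  change (barProj hP k Y i (Finsupp.single l (zetaGr hP k α)) : BarAmbient k r) =
    Finsupp.single l (zetaGr hP k α)
  dsimp only at h1 h2
  have e := h1.pathSource_eq
  unfold barProj
  rw [Finsupp.linearCombination_single, dif_pos ⟨by rwa [e], h2⟩, Submodule.coe_smul,
    Finsupp.smul_single, smul_eq_mul, zetaGr_mul_pointInt hP k e.symm]

/-- The terms of the bar resolution, as types. -/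
def BarTerm (i : ℕ) : Type (max u v) := barModule hP k Y i

noncomputable instance (i : ℕ) : AddCommGroup (BarTerm hP k Y i) :=
  inferInstanceAs (AddCommGroup (barModule hP k Y i))

noncomputable instance (i : ℕ) : Module (GrR k r) (BarTerm hP k Y i) :=
  inferInstanceAs (Module (GrR k r) (barModule hP k Y i))

noncomputable instance (i : ℕ) : Module k (BarTerm hP k Y i) :=
  inferInstanceAs (Module k (barModule hP k Y i))

instance (i : ℕ) : IsScalarTower k (GrR k r) (BarTerm hP k Y i) :=
  inferInstanceAs (IsScalarTower k (GrR k r) (barModule hP k Y i))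

/-- The inclusion of a term of the bar resolution into the ambient module. -/
noncomputable def barIncl (i : ℕ) : BarTerm hP k Y i →ₗ[GrR k r] BarAmbient k r :=
  (barModule hP k Y i).subtype

/-- The inclusion of a term of the bar resolution into the ambient module, as a `k`-linear map. -/
noncomputable def barInclK (i : ℕ) : BarTerm hP k Y i →ₗ[k] BarAmbient k r :=
  (barIncl hP k Y i).restrictScalars k

theorem barIncl_mem {i : ℕ} (x : BarTerm hP k Y i) : barIncl hP k Y i x ∈ barModule hP k Y i :=
  Subtype.property (p := fun x => x ∈ barModule hP k Y i) x

theorem barIncl_injective (i : ℕ) : Function.Injective (barIncl hP k Y i) :=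
  Subtype.val_injective

/-- The element of a term of the bar resolution given by an element of the ambient module. -/
def barMk {i : ℕ} (x : BarAmbient k r) (hx : x ∈ barModule hP k Y i) : BarTerm hP k Y i := ⟨x, hx⟩

theorem single_mem_barModule {i : ℕ} {l : List (IntClass r)} {α : IntClass r}
    (h : (l, α) ∈ barIndex Y i) : Finsupp.single l (zetaGr hP k α) ∈ barModule hP k Y i :=
  single_mem_barSpan hP k h

theorem barIncl_barMk {i : ℕ} (x : BarAmbient k r) (hx : x ∈ barModule hP k Y i) :
    barIncl hP k Y i (barMk hP k Y x hx) = x := rfl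

/-- The list l contributes the left ideal generated by the idempotent ζ of its source. Right
multiplication by this idempotent retracts the free ambient module onto the term. -/
theorem projective_barTerm (i : ℕ) : Module.Projective (GrR k r) (BarTerm hP k Y i) :=
  Module.Projective.of_split (M := BarAmbient k r) (barIncl hP k Y i) (barProj hP k Y i)
    (LinearMap.ext fun x => Subtype.ext (barProj_apply hP k Y (barIncl_mem hP k Y x)))

/-- A subspace which contains the basis elements is everything. -/
theorem barTerm_induction {i : ℕ} {N : Submodule k (BarTerm hP k Y i)}
    {s : Set (List (IntClass r) × IntClass r)}
    (h : ∀ l α, ∀ hl : (l, α) ∈ barIndex Y i, (l, α) ∈ s →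
      barMk hP k Y (Finsupp.single l (zetaGr hP k α)) (single_mem_barModule hP k Y hl) ∈ N)
    (hs : s ⊆ barIndex Y i)
    {x : BarTerm hP k Y i} (hx : barIncl hP k Y i x ∈ barSpan hP k s) : x ∈ N := by
  have h1 : barSpan hP k s ≤ N.map (barInclK hP k Y i) :=
    barSpan_le hP k fun t ht => ⟨_, h t.1 t.2 (hs ht) ht, rfl⟩
  obtain ⟨y, hy, e⟩ := h1 hx
  obtain rfl : y = x := barIncl_injective hP k Y i e
  exact hy

/-- The grading of a term of the bar resolution. -/
noncomputable def barDeg (i : ℕ) (j : ℤ) : Submodule k (BarTerm hP k Y i) :=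
  (barSpan hP k (barIndexDeg Y i j)).comap (barInclK hP k Y i)

theorem mem_barDeg {i : ℕ} {j : ℤ} {x : BarTerm hP k Y i} :
    x ∈ barDeg hP k Y i j ↔ barIncl hP k Y i x ∈ barSpan hP k (barIndexDeg Y i j) := Iff.rfl

open Classical in
/-- The projection to the basis elements of degree `j`. -/
noncomputable def barDegProj (j : ℤ) : BarAmbient k r →ₗ[k] BarAmbient k r :=
  Finsupp.lsum k fun l => (zetaBasis hP k).constr k fun α =>
    if ((rk α + weight l : ℕ) : ℤ) = j then Finsupp.single l (zetaGr hP k α) else 0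

open Classical in
theorem barDegProj_single (j : ℤ) (l : List (IntClass r)) (α : IntClass r) :
    barDegProj hP k j (Finsupp.single l (zetaGr hP k α)) =
      if ((rk α + weight l : ℕ) : ℤ) = j then Finsupp.single l (zetaGr hP k α) else 0 := by
  unfold barDegProj
  rw [Finsupp.lsum_single, ← zetaBasis_apply, Module.Basis.constr_basis]
  simp only [zetaBasis_apply]

theorem isInternal_barDeg (i : ℕ) : DirectSum.IsInternal (barDeg hP k Y i) := by
  refine isInternal_of_separated (fun j => barDegProj hP k j ∘ₗ barInclK hP k Y i) ?_ ?_ ?_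
  · intro j x hx h
    have : barDegProj hP k j (barIncl hP k Y i x) = barIncl hP k Y i x := by
      refine barSpan_le hP k (N := LinearMap.eqLocus (barDegProj hP k j) LinearMap.id) ?_ hx
      rintro t ⟨-, ht⟩
      exact (barDegProj_single hP k j t.1 t.2).trans (if_pos ht)
    apply barIncl_injective hP k Y i
    rw [← this, map_zero]
    exact h
  · intro j j' hj x hx
    refine barSpan_le hP k (N := LinearMap.ker (barDegProj hP k j)) ?_ hx
    rintro t ⟨-, ht⟩
    exact (barDegProj_single hP k j t.1 t.2).trans (if_neg (ht ▸ hj))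
  · rw [eq_top_iff]
    intro x _
    refine barTerm_induction hP k Y (N := ⨆ j, barDeg hP k Y i j) (s := barIndex Y i)
      (fun l α hl _ => ?_) subset_rfl (barIncl_mem hP k Y x)
    have h : (l, α) ∈ barIndexDeg Y i (rk α + weight l : ℕ) := ⟨hl, rfl⟩
    exact Submodule.mem_iSup_of_mem _ ((mem_barDeg hP k Y).2 (single_mem_barSpan hP k h))

theorem smul_mem_barSpan_deg {i a : ℕ} {b : ℤ} {x : GrR k r} {y : BarAmbient k r}
    (hx : x ∈ grGrading k r a) (hy : y ∈ barSpan hP k (barIndexDeg Y i b)) :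
    x • y ∈ barSpan hP k (barIndexDeg Y i (a + b)) := by
  refine smul_barSpan hP k (a := a) (s := barIndexDeg Y i b)
    (s' := barIndexDeg Y i (a + b)) ?_ hx hy
  rintro ⟨l, α⟩ ⟨⟨h1, h2⟩, h3⟩ β hβ hg
  refine ⟨⟨?_, h2⟩, ?_⟩
  · rw [target_comp hg.1]; exact h1
  · rw [← h3, hg.2, hβ]
    push_cast
    ring

theorem isGraded_barDeg (i : ℕ) : IsGradedModule k (grGrading k r) (barDeg hP k Y i) where
  isInternal := isInternal_barDeg hP k Y i
  smul_mem {_ _ x n} hx hn := by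
    rw [mem_barDeg] at hn ⊢
    rw [map_smul]
    exact smul_mem_barSpan_deg hP k Y hx hn

theorem pointDegree_zero : pointDegree k Y 0 = ⊤ := if_pos rfl

theorem pointDegree_of_ne {j : ℤ} (h : j ≠ 0) : pointDegree k Y j = ⊥ := if_neg h

theorem barAug_mem {j : ℤ} {x : BarAmbient k r} (hx : x ∈ barSpan hP k (barIndexDeg Y 0 j)) :
    barAug k Y x ∈ pointDegree k Y j := by
  classical
  by_cases hj : j = 0
  · rw [hj, pointDegree_zero]; trivial
  · refine barSpan_le hP k (N := (pointDegree k Y j).comap ((barAug k Y).restrictScalars k)) ?_ hx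
    rintro ⟨l, α⟩ ⟨⟨h1, h2⟩, h3⟩
    obtain rfl := List.length_eq_zero_iff.1 h2
    rw [Submodule.mem_comap, LinearMap.restrictScalars_apply, barAug_single_nil, grChar_zetaGr hP k,
      if_neg, map_zero]
    · exact zero_mem _
    · rintro rfl
      rw [rk_pointInt hP] at h3
      exact hj h3.symm

/-- The differential of the bar resolution of `k_Y`. -/
noncomputable def barDiff (i : ℕ) : BarTerm hP k Y (i + 1) →ₗ[GrR k r] BarTerm hP k Y i :=
  (barD hP k).restrict fun _ hx => barD_mem hP k Y hx

theorem barIncl_barDiff (i : ℕ) (x : BarTerm hP k Y (i + 1)) :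
    barIncl hP k Y i (barDiff hP k Y i x) = barD hP k (barIncl hP k Y (i + 1) x) := rfl

/-- The bar resolution of `k_Y`. -/
noncomputable def barResolution : GradedProjectiveResolution.{max u v, v, max u v} k
    (R := GrR k r) (grGrading k r) (PointModule k Y) (pointDegree k Y) where
  X i := BarTerm hP k Y i
  deg i := barDeg hP k Y i
  isGraded i := isGraded_barDeg hP k Y i
  projective i := projective_barTerm hP k Y i
  d i := barDiff hP k Y i
  d_mem _ _ _ hx := barD_mem_deg hP k Y hx
  aug := barAug k Y ∘ₗ barIncl hP k Y 0
  aug_mem _ _ hx := barAug_mem hP k Y hx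
  aug_surjective c := by
    classical
    have h : ([], pointInt Y) ∈ barIndex Y 0 := ⟨target_pointInt Y, rfl⟩
    have h' : barUnit hP k Y c ∈ barModule hP k Y 0 :=
      Submodule.smul_mem (barSpan hP k (barIndex Y 0)) _ (single_mem_barSpan hP k h)
    refine ⟨barMk hP k Y (barUnit hP k Y c) h', ?_⟩
    · rw [LinearMap.comp_apply, barIncl_barMk, barUnit_apply, LinearMap.map_smul_of_tower,
        barAug_single_nil, grChar_zetaGr hP k, if_pos rfl, ← map_smul, smul_eq_mul, mul_one,
        LinearEquiv.symm_apply_apply]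
  exact_zero := by
    intro x
    have hx := barIncl_mem hP k Y x
    constructor
    · intro h
      -- For an element x of length 0 in the kernel of the augmentation, the identity reduces to x =
      -- d s x.
      have e := bar_contraction hP k Y hx
      rw [LinearMap.comp_apply] at h
      rw [barD_zero hP k Y hx, map_zero, h, map_zero, add_zero, add_zero] at e
      exact ⟨barMk hP k Y _ (barS_mem hP k Y hx), barIncl_injective hP k Y 0 e⟩
    · rintro ⟨y, rfl⟩
      exact barAug_barD hP k Y (barIncl_mem hP k Y y)
  exact_succ i := by
    intro x
    have hx := barIncl_mem hP k Y x
    constructor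
    · intro h
      have e := bar_contraction hP k Y hx
      have h' : barD hP k (barIncl hP k Y (i + 1) x) = 0 := congrArg (barIncl hP k Y i) h
      have h'' : barAug k Y (barIncl hP k Y (i + 1) x) = 0 := by
        refine barSpan_le hP k (N := LinearMap.ker ((barAug k Y).restrictScalars k)) ?_ hx
        rintro ⟨m, γ⟩ ⟨-, hm⟩
        cases m with
        | nil => simp at hm
        | cons ε m => exact barAug_single_cons k Y _ _ _
      rw [h', map_zero, h'', map_zero, add_zero, add_zero] at e
      exact ⟨barMk hP k Y _ (barS_mem hP k Y hx), barIncl_injective hP k Y (i + 1) e⟩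
    · rintro ⟨y, rfl⟩
      exact barIncl_injective hP k Y i (barD_barD hP k Y (barIncl_mem hP k Y y))

end Bar

/-- The recursion carries pairs of consecutive terms, since extending the sequence needs the
relation between the last two. It produces both comparison maps and homotopies. -/
theorem exists_dependent_seq {α : ℕ → Type*} {q : α 0 → Prop} {p : ∀ i, α i → α (i + 1) → Prop}
    (h0 : ∃ a b, q a ∧ p 0 a b) (hs : ∀ i a b, p i a b → ∃ c, p (i + 1) b c) :
    ∃ f : ∀ i, α i, q (f 0) ∧ ∀ i, p i (f i) (f (i + 1)) := by
  obtain ⟨a, b, hq, hp⟩ := h0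
  choose next hnext using hs
  let seq : ∀ i, {s : α i × α (i + 1) // p i s.1 s.2} := fun i =>
    Nat.rec ⟨(a, b), hp⟩ (fun i s => ⟨(s.1.2, next i s.1.1 s.1.2 s.2), hnext i _ _ s.2⟩) i
  exact ⟨fun i => (seq i).1.1, hq, fun i => (seq i).2⟩

/-! ### Degree-preserving lifts from projective graded modules. -/

section GradedLift

variable {k : Type*} [Field k]

section Proj

variable {N : Type*} [AddCommGroup N] [Module k N] {deg : ℤ → Submodule k N}

/-- The linear map out of a graded vector space with given restrictions to the components. -/
noncomputable def gradedDesc (h : DirectSum.IsInternal deg) {N' : Type*} [AddCommGroup N']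
    [Module k N'] (f : ∀ j, deg j →ₗ[k] N') : N →ₗ[k] N' :=
  DirectSum.toModule k ℤ N' f ∘ₗ (LinearEquiv.ofBijective (DirectSum.coeLinearMap deg) h).symm

theorem gradedDesc_apply (h : DirectSum.IsInternal deg) {N' : Type*} [AddCommGroup N']
    [Module k N'] (f : ∀ j, deg j →ₗ[k] N') {j : ℤ} {x : N} (hx : x ∈ deg j) :
    gradedDesc h f x = f j ⟨x, hx⟩ := by
  have e : (LinearEquiv.ofBijective (DirectSum.coeLinearMap deg) h).symm x =
      DirectSum.lof k ℤ (fun j => deg j) j ⟨x, hx⟩ := by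
    rw [LinearEquiv.symm_apply_eq]
    exact (DirectSum.coeLinearMap_lof (R := k) deg j ⟨x, hx⟩).symm
  rw [gradedDesc, LinearMap.comp_apply, LinearEquiv.coe_coe, e, DirectSum.toModule_lof]

open Classical in
/-- The projection onto a component of a graded vector space. -/
noncomputable def gradedProj (h : DirectSum.IsInternal deg) (j : ℤ) : N →ₗ[k] N :=
  gradedDesc h fun i => if i = j then (deg i).subtype else 0

theorem gradedProj_of_mem (h : DirectSum.IsInternal deg) {j : ℤ} {x : N} (hx : x ∈ deg j) :
    gradedProj h j x = x := by
  rw [gradedProj, gradedDesc_apply h _ hx, if_pos rfl]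
  rfl

theorem gradedProj_of_mem_of_ne (h : DirectSum.IsInternal deg) {i j : ℤ} (hij : i ≠ j) {x : N}
    (hx : x ∈ deg i) : gradedProj h j x = 0 := by
  rw [gradedProj, gradedDesc_apply h _ hx, if_neg hij]
  rfl

theorem graded_induction (h : DirectSum.IsInternal deg) {p : N → Prop} (x : N) (h0 : p 0)
    (hadd : ∀ x y, p x → p y → p (x + y)) (hmem : ∀ j, ∀ x ∈ deg j, p x) : p x := by
  have hx : x ∈ ⨆ j, deg j := by rw [h.submodule_iSup_eq_top]; trivial
  induction hx using Submodule.iSup_induction' with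
  | mem j x hx => exact hmem j x hx
  | zero => exact h0
  | add x y _ _ hx hy => exact hadd _ _ hx hy

theorem gradedProj_mem (h : DirectSum.IsInternal deg) (j : ℤ) (x : N) :
    gradedProj h j x ∈ deg j := by
  refine graded_induction h (p := fun x => gradedProj h j x ∈ deg j) x ?_ ?_ ?_
  · rw [map_zero]; exact zero_mem _
  · intro x y hx hy
    rw [map_add]; exact add_mem hx hy
  · intro i x hx
    by_cases hij : i = j
    · subst hij
      rwa [gradedProj_of_mem h hx]
    · rw [gradedProj_of_mem_of_ne h hij hx]; exact zero_mem _

end Proj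

variable {R : Type*} [Ring R] [Algebra k R] {gr : ℕ → Submodule k R} (hgr : ⨆ d, gr d = ⊤)

section

variable {N N' : Type*} [AddCommGroup N] [Module k N] [Module R N] [IsScalarTower k R N]
  [AddCommGroup N'] [Module k N'] [Module R N'] [IsScalarTower k R N']
  {deg : ℤ → Submodule k N} {deg' : ℤ → Submodule k N'}

theorem gradedProj_smul (h : IsGradedModule k gr deg) {a : ℕ} {x : R} (hx : x ∈ gr a) (b : ℤ)
    (n : N) : gradedProj h.isInternal (a + b) (x • n) = x • gradedProj h.isInternal b n := by
  refine graded_induction h.isInternal (p := fun n => gradedProj h.isInternal (a + b) (x • n) =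
    x • gradedProj h.isInternal b n) n (by simp) ?_ ?_
  · intro m n hm hn
    rw [smul_add, map_add, map_add, smul_add, hm, hn]
  · intro c n hn
    by_cases hcb : c = b
    · subst hcb
      rw [gradedProj_of_mem _ hn, gradedProj_of_mem _ (h.smul_mem hx hn)]
    · rw [gradedProj_of_mem_of_ne _ hcb hn,
        gradedProj_of_mem_of_ne _ (fun e => hcb (add_left_cancel e)) (h.smul_mem hx hn), smul_zero]

include hgr in
/-- The part of degree `0` of an `R`-linear map between graded modules. -/
theorem exists_degree_zero_part (h : IsGradedModule k gr deg) (h' : IsGradedModule k gr deg')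
    (f : N →ₗ[R] N') : ∃ f₀ : N →ₗ[R] N', ∀ j, ∀ x ∈ deg j,
      f₀ x = gradedProj h'.isInternal j (f x) := by
  let g : N →ₗ[k] N' := gradedDesc h.isInternal fun j =>
    gradedProj h'.isInternal j ∘ₗ f.restrictScalars k ∘ₗ (deg j).subtype
  have hg : ∀ j, ∀ x ∈ deg j, g x = gradedProj h'.isInternal j (f x) := fun j x hx =>
    gradedDesc_apply h.isInternal _ hx
  refine ⟨{ g with map_smul' := fun a x => ?_ }, hg⟩
  change g (a • x) = a • g x
  have ha : a ∈ ⨆ d, gr d := by rw [hgr]; trivial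
  induction ha using Submodule.iSup_induction' with
  | mem d a ha =>
    refine graded_induction h.isInternal (p := fun x => g (a • x) = a • g x) x (by simp) ?_ ?_
    · intro x y hx hy
      rw [smul_add, map_add, map_add, smul_add, hx, hy]
    · intro j x hx
      rw [hg _ _ (h.smul_mem ha hx), hg _ _ hx, map_smul, gradedProj_smul h' ha]
  | zero => simp
  | add a b _ _ ha hb => rw [add_smul, map_add, ha, hb, add_smul]

end

/-- Corestricting g and φ to the range of g reduces to a surjection. In this form exactness feeds
directly into the lifting. -/
theorem exists_projective_lift {Q M M' : Type*} [AddCommGroup Q] [Module R Q]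
    [Module.Projective R Q] [AddCommGroup M] [Module R M] [AddCommGroup M'] [Module R M']
    (g : M' →ₗ[R] M) (φ : Q →ₗ[R] M) (h : ∀ x, ∃ y, g y = φ x) :
    ∃ ψ : Q →ₗ[R] M', g ∘ₗ ψ = φ := by
  obtain ⟨ψ, hψ⟩ := Module.projective_lifting_property g.rangeRestrict
    (φ.codRestrict (LinearMap.range g) h) g.surjective_rangeRestrict
  refine ⟨ψ, LinearMap.ext fun x => ?_⟩
  exact congrArg Subtype.val (LinearMap.congr_fun hψ x)

-- Ungraded projectivity suffices: the degree-0 part of an arbitrary lift is again a lift, because g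
-- and φ preserve degrees.
include hgr in
theorem exists_graded_projective_lift {Q M M' : Type*} [AddCommGroup Q] [Module k Q] [Module R Q]
    [IsScalarTower k R Q] [Module.Projective R Q] [AddCommGroup M] [Module k M] [Module R M]
    [IsScalarTower k R M] [AddCommGroup M'] [Module k M'] [Module R M'] [IsScalarTower k R M']
    {degQ : ℤ → Submodule k Q} {degM : ℤ → Submodule k M} {degM' : ℤ → Submodule k M'}
    (hQ : IsGradedModule k gr degQ) (hM : DirectSum.IsInternal degM)
    (hM' : IsGradedModule k gr degM')
    (g : M' →ₗ[R] M) (hg : ∀ j, ∀ x ∈ degM' j, g x ∈ degM j)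
    (φ : Q →ₗ[R] M) (hφ : ∀ j, ∀ x ∈ degQ j, φ x ∈ degM j) (h : ∀ x, ∃ y, g y = φ x) :
    ∃ ψ : Q →ₗ[R] M', (∀ j, ∀ x ∈ degQ j, ψ x ∈ degM' j) ∧ g ∘ₗ ψ = φ := by
  obtain ⟨ψ, hψ⟩ := exists_projective_lift g φ h
  obtain ⟨ψ₀, hψ₀⟩ := exists_degree_zero_part hgr hQ hM' ψ
  refine ⟨ψ₀, fun j x hx => ?_, LinearMap.ext fun x => ?_⟩
  · rw [hψ₀ j x hx]
    exact gradedProj_mem _ _ _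
  -- A degree-preserving map commutes with the projections to homogeneous components.
  · have hproj : ∀ j y, g (gradedProj hM'.isInternal j y) = gradedProj hM j (g y) := by
      intro j y
      refine graded_induction hM'.isInternal
        (p := fun y => g (gradedProj hM'.isInternal j y) = gradedProj hM j (g y)) y
        (by simp) ?_ ?_
      · intro x y hx hy
        simp only [map_add, hx, hy]
      · intro i x hx
        by_cases hij : i = j
        · subst hij
          rw [gradedProj_of_mem _ hx, gradedProj_of_mem _ (hg _ _ hx)]
        · rw [gradedProj_of_mem_of_ne _ hij hx, gradedProj_of_mem_of_ne _ hij (hg _ _ hx),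
            map_zero]
    refine graded_induction hQ.isInternal (p := fun x => (g ∘ₗ ψ₀) x = φ x) x (by simp) ?_ ?_
    · intro x y hx hy
      rw [map_add, map_add, hx, hy]
    · intro j x hx
      rw [LinearMap.comp_apply, hψ₀ j x hx, hproj]
      have := LinearMap.congr_fun hψ x
      rw [LinearMap.comp_apply] at this
      rw [this, gradedProj_of_mem _ (hφ j x hx)]

end GradedLift

/-! ### Comparison maps and homotopies between resolutions. -/

section Comparison

universe w'

variable {k : Type v} [Field k] {R : Type u} [Ring R] [Algebra k R] {gr : ℕ → Submodule k R}
  {N : Type*} [AddCommGroup N] [Module k N] [Module R N]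
  {degN : ℤ → Submodule k N} (Q : GradedProjectiveResolution.{u, v, w} k gr N degN)
  (B : GradedProjectiveResolution.{u, v, w'} k gr N degN)

theorem GradedProjectiveResolution.d_d (i : ℕ) (x : Q.X (i + 2)) :
    Q.d i (Q.d (i + 1) x) = 0 := (Q.exact_succ i _).2 ⟨x, rfl⟩

theorem GradedProjectiveResolution.aug_d (x : Q.X 1) : Q.aug (Q.d 0 x) = 0 :=
  (Q.exact_zero _).2 ⟨x, rfl⟩

/-- Each new map exists because the composite to be lifted consists of cycles of B, which are
boundaries by exactness. The graded lifting lemma keeps every stage degree-preserving. -/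
theorem exists_comparison [IsScalarTower k R N] (hgr : ⨆ d, gr d = ⊤)
    (hN : DirectSum.IsInternal degN) :
    ∃ f : ∀ i, Q.X i →ₗ[R] B.X i, (∀ i j, ∀ x ∈ Q.deg i j, f i x ∈ B.deg i j) ∧
      (∀ i x, B.d i (f (i + 1) x) = f i (Q.d i x)) ∧ ∀ x, B.aug (f 0 x) = Q.aug x := by
  have := Q.projective
  suffices h : ∃ f : ∀ i, {f : Q.X i →ₗ[R] B.X i // ∀ j, ∀ x ∈ Q.deg i j, f x ∈ B.deg i j},
      (∀ x, B.aug ((f 0).1 x) = Q.aug x) ∧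
        ∀ i, ∀ x, B.d i ((f (i + 1)).1 x) = (f i).1 (Q.d i x) by
    obtain ⟨f, h0, h⟩ := h
    exact ⟨fun i => (f i).1, fun i => (f i).2, h, h0⟩
  refine exists_dependent_seq
    (α := fun i => {f : Q.X i →ₗ[R] B.X i // ∀ j, ∀ x ∈ Q.deg i j, f x ∈ B.deg i j})
    (q := fun f => ∀ x, B.aug (f.1 x) = Q.aug x)
    (p := fun i f g => ∀ x, B.d i (g.1 x) = f.1 (Q.d i x)) ?_ ?_
  · obtain ⟨a, ha, hca⟩ := exists_graded_projective_lift hgr (Q.isGraded 0) hN (B.isGraded 0)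
      B.aug B.aug_mem Q.aug Q.aug_mem (fun x => B.aug_surjective _)
    have hca : ∀ x, B.aug (a x) = Q.aug x := LinearMap.congr_fun hca
    obtain ⟨b, hb, hcb⟩ := exists_graded_projective_lift hgr (Q.isGraded 1)
      (B.isGraded 0).isInternal (B.isGraded 1) (B.d 0) (B.d_mem 0) (a ∘ₗ Q.d 0)
      (fun j x hx => ha j _ (Q.d_mem 0 j x hx)) (fun x => (B.exact_zero _).1 (by
        rw [LinearMap.comp_apply, hca, Q.aug_d]))
    exact ⟨⟨a, ha⟩, ⟨b, hb⟩, hca, LinearMap.congr_fun hcb⟩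
  · rintro i ⟨a, ha⟩ ⟨b, hb⟩ hab
    obtain ⟨c, hc, hcc⟩ := exists_graded_projective_lift hgr (Q.isGraded (i + 2))
      (B.isGraded (i + 1)).isInternal (B.isGraded (i + 2)) (B.d (i + 1)) (B.d_mem (i + 1))
      (b ∘ₗ Q.d (i + 1))
      (fun j x hx => hb j _ (Q.d_mem (i + 1) j x hx)) (fun x => (B.exact_succ i _).1 (by
        rw [LinearMap.comp_apply, hab, Q.d_d, map_zero]))
    exact ⟨⟨c, hc⟩, LinearMap.congr_fun hcc⟩

/-- A chain map covering zero on N is null-homotopic. The homotopy need not respect degrees, as it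
only serves to show that two cycles are homologous. -/
theorem exists_homotopy (φ : ∀ i, Q.X i →ₗ[R] B.X i)
    (hφ : ∀ i x, B.d i (φ (i + 1) x) = φ i (Q.d i x)) (h0 : ∀ x, B.aug (φ 0 x) = 0) :
    ∃ h : ∀ i, Q.X i →ₗ[R] B.X (i + 1), (∀ x, B.d 0 (h 0 x) = φ 0 x) ∧
      ∀ i x, B.d (i + 1) (h (i + 1) x) + h i (Q.d i x) = φ (i + 1) x := by
  have := Q.projective
  refine exists_dependent_seq (α := fun i => Q.X i →ₗ[R] B.X (i + 1))
    (q := fun h => ∀ x, B.d 0 (h x) = φ 0 x)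
    (p := fun i a b => ∀ x, B.d (i + 1) (b x) + a (Q.d i x) = φ (i + 1) x) ?_ ?_
  · obtain ⟨a, ha⟩ := exists_projective_lift (B.d 0) (φ 0)
      (fun x => (B.exact_zero _).1 (h0 x))
    have ha : ∀ x, B.d 0 (a x) = φ 0 x := LinearMap.congr_fun ha
    obtain ⟨b, hb⟩ := exists_projective_lift (B.d 1) (φ 1 - a ∘ₗ Q.d 0)
      (fun x => (B.exact_succ 0 _).1 (by
        rw [LinearMap.sub_apply, LinearMap.comp_apply, map_sub, hφ, ha, sub_self]))
    refine ⟨a, b, ha, fun x => ?_⟩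
    have := LinearMap.congr_fun hb x
    rw [LinearMap.comp_apply, LinearMap.sub_apply, LinearMap.comp_apply] at this
    rw [this, sub_add_cancel]
  · intro i a b hab
    obtain ⟨c, hc⟩ := exists_projective_lift (B.d (i + 2)) (φ (i + 2) - b ∘ₗ Q.d (i + 1))
      (fun x => (B.exact_succ (i + 1) _).1 (by
        have h1 := hab (Q.d (i + 1) x)
        rw [Q.d_d, map_zero, add_zero] at h1
        rw [LinearMap.sub_apply, LinearMap.comp_apply, map_sub, hφ, h1, sub_self]))
    refine ⟨c, fun x => ?_⟩
    have := LinearMap.congr_fun hc x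
    rw [LinearMap.comp_apply, LinearMap.sub_apply, LinearMap.comp_apply] at this
    rw [this, sub_add_cancel]

end Comparison

/-! ### Homology of sequences of vector spaces. -/

section SeqHomology

variable {k : Type v} [Field k]

section

variable {C : ℕ → Type*} [∀ i, AddCommGroup (C i)] [∀ i, Module k (C i)]
  (d : ∀ i, C (i + 1) →ₗ[k] C i)

/-- The cycles of a sequence of vector spaces. -/
def seqCycles : (i : ℕ) → Submodule k (C i)
  | 0 => ⊤
  | i + 1 => LinearMap.ker (d i)

/-- The boundaries of a sequence of vector spaces. -/
def seqBoundaries (i : ℕ) : Submodule k (C i) := LinearMap.range (d i)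

/-- The homology of a sequence of vector spaces. -/
abbrev SeqHomology (i : ℕ) : Type _ :=
  ↥(seqCycles d i) ⧸ (seqBoundaries d i).submoduleOf (seqCycles d i)

/-- The homology classes of the cycles in a given subspace. -/
def homologyPart {i : ℕ} (D : Submodule k (C i)) : Submodule k (SeqHomology d i) :=
  (D.submoduleOf (seqCycles d i)).map ((seqBoundaries d i).submoduleOf (seqCycles d i)).mkQ

end

variable {C C' : ℕ → Type*} [∀ i, AddCommGroup (C i)] [∀ i, Module k (C i)]
  [∀ i, AddCommGroup (C' i)] [∀ i, Module k (C' i)]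
  {d : ∀ i, C (i + 1) →ₗ[k] C i} {d' : ∀ i, C' (i + 1) →ₗ[k] C' i}

theorem map_seqCycles {f : ∀ i, C i →ₗ[k] C' i} (hf : ∀ i x, d' i (f (i + 1) x) = f i (d i x))
    (i : ℕ) : ∀ x ∈ seqCycles d i, f i x ∈ seqCycles d' i := by
  cases i with
  | zero => exact fun _ _ => trivial
  | succ i =>
    intro x hx
    have hx : d i x = 0 := hx
    change d' i (f (i + 1) x) = 0
    rw [hf, hx, map_zero]

/-- The map on homology induced by a map of complexes. -/
noncomputable def seqHomologyMap (f : ∀ i, C i →ₗ[k] C' i)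
    (hf : ∀ i x, d' i (f (i + 1) x) = f i (d i x)) (i : ℕ) :
    SeqHomology d i →ₗ[k] SeqHomology d' i :=
  Submodule.mapQ _ _ ((f i).restrict (map_seqCycles hf i)) (by
    rintro ⟨x, hx⟩ ⟨y, hy⟩
    exact ⟨f (i + 1) y, by rw [hf, hy]; rfl⟩)

theorem seqHomologyMap_mk (f : ∀ i, C i →ₗ[k] C' i)
    (hf : ∀ i x, d' i (f (i + 1) x) = f i (d i x)) (i : ℕ) (x : seqCycles d i) :
    seqHomologyMap f hf i (Submodule.Quotient.mk x) =
      Submodule.Quotient.mk ⟨f i x, map_seqCycles hf i x x.2⟩ := rfl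

theorem map_homologyPart_le (f : ∀ i, C i →ₗ[k] C' i)
    (hf : ∀ i x, d' i (f (i + 1) x) = f i (d i x)) {i : ℕ} {D : Submodule k (C i)}
    {D' : Submodule k (C' i)} (hD : ∀ x ∈ D, f i x ∈ D') :
    (homologyPart d D).map (seqHomologyMap f hf i) ≤ homologyPart d' D' := by
  rintro _ ⟨_, ⟨x, hx, rfl⟩, rfl⟩
  exact ⟨⟨f i x, map_seqCycles hf i x x.2⟩, hD _ hx, rfl⟩

/-- Homotopy equivalent complexes have isomorphic homology. -/
theorem exists_homologyEquiv (f : ∀ i, C i →ₗ[k] C' i)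
    (hf : ∀ i x, d' i (f (i + 1) x) = f i (d i x)) (g : ∀ i, C' i →ₗ[k] C i)
    (hg : ∀ i x, d i (g (i + 1) x) = g i (d' i x))
    (hgf : ∀ i, ∀ x ∈ seqCycles d i, g i (f i x) - x ∈ seqBoundaries d i)
    (hfg : ∀ i, ∀ x ∈ seqCycles d' i, f i (g i x) - x ∈ seqBoundaries d' i)
    {L : Type*} {D : ∀ i, L → Submodule k (C i)} {D' : ∀ i, L → Submodule k (C' i)}
    (hfD : ∀ i j, ∀ x ∈ D i j, f i x ∈ D' i j) (hgD : ∀ i j, ∀ x ∈ D' i j, g i x ∈ D i j)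
    (i : ℕ) : ∃ e : SeqHomology d i ≃ₗ[k] SeqHomology d' i,
      ∀ j, (homologyPart d (D i j)).map e.toLinearMap = homologyPart d' (D' i j) := by
  have h1 : ∀ x, seqHomologyMap g hg i (seqHomologyMap f hf i x) = x := by
    intro x
    induction x using Submodule.Quotient.induction_on with
    | H x =>
      rw [seqHomologyMap_mk, seqHomologyMap_mk, Submodule.Quotient.eq]
      exact hgf i x x.2
  have h2 : ∀ x, seqHomologyMap f hf i (seqHomologyMap g hg i x) = x := by
    intro x
    induction x using Submodule.Quotient.induction_on with
    | H x =>
      rw [seqHomologyMap_mk, seqHomologyMap_mk, Submodule.Quotient.eq]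
      exact hfg i x x.2
  refine ⟨LinearEquiv.ofLinearMap (seqHomologyMap f hf i) (seqHomologyMap g hg i)
    (LinearMap.ext h2) (LinearMap.ext h1), fun j => le_antisymm
      (map_homologyPart_le f hf (hfD i j)) fun x hx => ?_⟩
  exact ⟨seqHomologyMap g hg i x, map_homologyPart_le g hg (hgD i j) ⟨x, hx, rfl⟩, h2 x⟩

theorem isInternal_of_equiv {V W L : Type*} [DecidableEq L] [AddCommGroup V] [Module k V]
    [AddCommGroup W] [Module k W] (e : V ≃ₗ[k] W) {D : L → Submodule k V} {D' : L → Submodule k W}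
    (h : ∀ j, (D j).map e.toLinearMap = D' j) (hD' : DirectSum.IsInternal D') :
    DirectSum.IsInternal D := by
  rw [DirectSum.isInternal_submodule_iff_iSupIndep_and_iSup_eq_top] at hD' ⊢
  have hD : D = fun j => (D' j).map e.symm.toLinearMap := by
    funext j
    rw [← h, ← Submodule.map_comp]
    simp
  rw [hD]
  refine ⟨hD'.1.map_orderIso (Submodule.orderIsoMapComap e.symm), ?_⟩
  rw [← Submodule.map_iSup, hD'.2, Submodule.map_top]
  exact LinearEquiv.range e.symm

end SeqHomology

/-! ### Functoriality of the tensor product over R. -/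

section TensorFunctor

variable (k : Type v) [Field k] {R : Type u} [Ring R] [Algebra k R]
  (M : Type*) [AddCommGroup M] [Module k M] [Module Rᵐᵒᵖ M]
  {N N' N'' : Type*} [AddCommGroup N] [Module k N] [Module R N] [IsScalarTower k R N]
  [AddCommGroup N'] [Module k N'] [Module R N'] [IsScalarTower k R N']
  [AddCommGroup N''] [Module k N''] [Module R N''] [IsScalarTower k R N'']

variable {M} in
/-- The element `m ⊗ n` of `M ⊗_R N`. -/
noncomputable def tensorMk (m : M) (n : N) : TensorOver k R M N :=
  (balanced k R M N).mkQ (m ⊗ₜ[k] n)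

variable {M} in
/-- The map `n ↦ m ⊗ n`. -/
noncomputable def tensorMkLin (m : M) : N →ₗ[k] TensorOver k R M N :=
  (balanced k R M N).mkQ ∘ₗ TensorProduct.mk k M N m

variable {M} in
theorem tensorMkLin_apply (m : M) (n : N) :
    tensorMkLin k m n = tensorMk (R := R) k m n := rfl

variable {M} in
theorem smul_tensorMk (c : k) (m : M) (n : N) :
    tensorMk (R := R) k (c • m) n = c • tensorMk k m n := by
  unfold tensorMk
  rw [← map_smul, TensorProduct.smul_tmul']

theorem zero_tensorMk (n : N) : tensorMk (R := R) k (0 : M) n = 0 := by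
  unfold tensorMk
  rw [TensorProduct.zero_tmul, map_zero]

variable {M} in
theorem tensorMap_mk (f : N →ₗ[R] N') (m : M) (n : N) :
    tensorMap k M f (tensorMk k m n) = tensorMk (R := R) k m (f n) := rfl

variable {M} in
theorem tensorMk_smul (m : M) (a : R) (n : N) :
    tensorMk (R := R) k m (a • n) = tensorMk k (MulOpposite.op a • m) n := by
  symm
  exact (Submodule.Quotient.eq _).2 (Submodule.subset_span ⟨m, a, n, rfl⟩)

theorem tensorOver_ext {V : Type*} [AddCommGroup V] [Module k V]
    {f g : TensorOver k R M N →ₗ[k] V}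
    (h : ∀ m n, f (tensorMk k m n) = g (tensorMk k m n)) : f = g :=
  Submodule.linearMap_qext _ (TensorProduct.ext' h)

variable {M} in
/-- The map out of `M ⊗_R N` given by a balanced bilinear map. -/
noncomputable def tensorDesc {V : Type*} [AddCommGroup V] [Module k V] (f : M →ₗ[k] N →ₗ[k] V)
    (hf : ∀ (m : M) (a : R) (n : N), f (MulOpposite.op a • m) n = f m (a • n)) :
    TensorOver k R M N →ₗ[k] V :=
  Submodule.liftQ _ (TensorProduct.lift f) (by
    refine Submodule.span_le.2 ?_
    rintro _ ⟨m, a, n, rfl⟩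
    rw [SetLike.mem_coe, LinearMap.mem_ker, map_sub, TensorProduct.lift.tmul,
      TensorProduct.lift.tmul, hf, sub_self])

theorem tensorMap_comp (f : N →ₗ[R] N') (g : N' →ₗ[R] N'') :
    tensorMap k M g ∘ₗ tensorMap k M f = tensorMap k M (g ∘ₗ f) :=
  tensorOver_ext k M fun _ _ => rfl

theorem tensorMap_id : tensorMap k M (LinearMap.id : N →ₗ[R] N) = LinearMap.id :=
  tensorOver_ext k M fun _ _ => rfl

theorem tensorMap_add (f g : N →ₗ[R] N') :
    tensorMap k M (f + g) = tensorMap k M f + tensorMap k M g :=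
  tensorOver_ext k M fun m n => by
    rw [LinearMap.add_apply, tensorMap_mk, tensorMap_mk, tensorMap_mk]
    unfold tensorMk
    rw [LinearMap.add_apply, TensorProduct.tmul_add, map_add]

theorem tensorMap_sub (f g : N →ₗ[R] N') :
    tensorMap k M (f - g) = tensorMap k M f - tensorMap k M g := by
  rw [eq_sub_iff_add_eq, ← tensorMap_add, sub_add_cancel]

variable {M} in
theorem tensorMap_mem_tensorDegree {degM : ℤ → Submodule k M} {deg : ℤ → Submodule k N}
    {deg' : ℤ → Submodule k N'} {f : N →ₗ[R] N'} (hf : ∀ j, ∀ x ∈ deg j, f x ∈ deg' j) (j : ℤ) :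
    ∀ x ∈ tensorDegree (R := R) k degM deg j,
      tensorMap k M f x ∈ tensorDegree (R := R) k degM deg' j := by
  intro x hx
  refine Submodule.span_le (p := (tensorDegree (R := R) k degM deg' j).comap
    (tensorMap k M f)).2 ?_ hx
  rintro _ ⟨a, b, hab, m, hm, n, hn, rfl⟩
  exact Submodule.subset_span ⟨a, b, hab, m, hm, f n, hf b n hn, rfl⟩

end TensorFunctor

/-! ### Independence of Tor from the resolution. -/

section TorComparison

universe w'

variable {k : Type v} [Field k] {R : Type u} [Ring R] [Algebra k R] {gr : ℕ → Submodule k R}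
  {N : Type*} [AddCommGroup N] [Module k N] [Module R N] [IsScalarTower k R N]
  {degN : ℤ → Submodule k N} (Q : GradedProjectiveResolution.{u, v, w} k gr N degN)
  (B : GradedProjectiveResolution.{u, v, w'} k gr N degN)
  {M : Type*} [AddCommGroup M] [Module k M] [Module Rᵐᵒᵖ M] (degM : ℤ → Submodule k M)

/-- The boundary property of the composition of two comparison maps. -/
theorem tensor_comparison_sub_mem {f : ∀ i, Q.X i →ₗ[R] B.X i} {g : ∀ i, B.X i →ₗ[R] Q.X i}
    (hf : ∀ i x, B.d i (f (i + 1) x) = f i (Q.d i x)) (hf0 : ∀ x, B.aug (f 0 x) = Q.aug x)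
    (hg : ∀ i x, Q.d i (g (i + 1) x) = g i (B.d i x)) (hg0 : ∀ x, Q.aug (g 0 x) = B.aug x)
    (i : ℕ) : ∀ x ∈ seqCycles (C := fun i => TensorOver k R M (Q.X i)) (fun i => tensorMap k M (Q.d i)) i,
      tensorMap k M (g i) (tensorMap k M (f i) x) - x ∈
        seqBoundaries (C := fun i => TensorOver k R M (Q.X i)) (fun i => tensorMap k M (Q.d i)) i := by
  -- The difference g f - 1 covers zero on N; the resulting homotopy is R-linear and can be tensored
  -- with M.
  obtain ⟨h, h0, hs⟩ := exists_homotopy Q Q (fun i => g i ∘ₗ f i - LinearMap.id)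
    (fun i x => by simp [hf, hg]) (fun x => by simp [hf0, hg0])
  have key : ∀ (i) (x : TensorOver k R M (Q.X i)),
      tensorMap k M (g i) (tensorMap k M (f i) x) - x =
        tensorMap k M (g i ∘ₗ f i - LinearMap.id) x := by
    intro i x
    rw [tensorMap_sub, tensorMap_id, ← tensorMap_comp]
    rfl
  intro x hx
  rw [key]
  cases i with
  | zero =>
    refine ⟨tensorMap k M (h 0) x, ?_⟩
    rw [← LinearMap.comp_apply, tensorMap_comp]
    congr 2
    exact LinearMap.ext h0
  | succ i =>
    have hx : tensorMap k M (Q.d i) x = 0 := hx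
    refine ⟨tensorMap k M (h (i + 1)) x, ?_⟩
    have e : g (i + 1) ∘ₗ f (i + 1) - LinearMap.id =
        Q.d (i + 1) ∘ₗ h (i + 1) + h i ∘ₗ Q.d i := LinearMap.ext fun x => (hs i x).symm
    rw [e, tensorMap_add, ← tensorMap_comp, ← tensorMap_comp, LinearMap.add_apply,
      LinearMap.comp_apply, LinearMap.comp_apply, hx, map_zero, add_zero]

/-- `Tor` does not depend on the graded projective resolution. -/
theorem exists_torEquiv (hgr : ⨆ d, gr d = ⊤) (hN : DirectSum.IsInternal degN) (i : ℕ) :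
    ∃ e : Q.Tor M i ≃ₗ[k] B.Tor M i,
      ∀ j, (Q.torDegree degM i j).map e.toLinearMap = B.torDegree degM i j := by
  obtain ⟨f, hfd, hf, hf0⟩ := exists_comparison Q B hgr hN
  obtain ⟨g, hgd, hg, hg0⟩ := exists_comparison B Q hgr hN
  have h := exists_homologyEquiv (C := fun i => TensorOver k R M (Q.X i))
    (C' := fun i => TensorOver k R M (B.X i)) (d := fun i => tensorMap k M (Q.d i))
    (d' := fun i => tensorMap k M (B.d i)) (fun i => tensorMap k M (f i)) (fun i x => by
      rw [← LinearMap.comp_apply, ← LinearMap.comp_apply, tensorMap_comp, tensorMap_comp]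
      congr 2
      exact LinearMap.ext (hf i)) (fun i => tensorMap k M (g i)) (fun i x => by
      rw [← LinearMap.comp_apply, ← LinearMap.comp_apply, tensorMap_comp, tensorMap_comp]
      congr 2
      exact LinearMap.ext (hg i))
    (tensor_comparison_sub_mem Q B hf hf0 hg hg0)
    (tensor_comparison_sub_mem B Q hg hg0 hf hf0)
    (D := fun i => tensorDegree k degM (Q.deg i)) (D' := fun i => tensorDegree k degM (B.deg i))
    (fun i => tensorMap_mem_tensorDegree k (hfd i))
    (fun i => tensorMap_mem_tensorDegree k (hgd i)) i
  -- The cycles are defined by cases on i, so the two descriptions of homology agree definitionally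
  -- only after a case split.
  cases i with
  | zero => exact h
  | succ i => exact h

end TorComparison

/-! ### Tor as the homology of the complex of paths. -/

section PathComplex

variable {P : Type u} [PartialOrder P] (hP : ∀ x y : P, (Set.Icc x y).Finite)
  (k : Type v) [Field k] {r : Setoid (NonemptyInterval P)} [IncidenceAxioms r]
  (X Y : PointClass r)

/-- The paths of length `i` from `X` to `Y`. -/
def pathIndex (i : ℕ) : Set (List (IntClass r)) := {l | IsPath Y X l ∧ l.length = i}

/-- The space with the paths of length `i` from `X` to `Y` as basis. -/
def PathSpace (i : ℕ) : Type (max u v) := ↥(Finsupp.supported k k (pathIndex X Y i))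

noncomputable instance (i : ℕ) : AddCommGroup (PathSpace k X Y i) :=
  inferInstanceAs (AddCommGroup ↥(Finsupp.supported k k (pathIndex X Y i)))

noncomputable instance (i : ℕ) : Module k (PathSpace k X Y i) :=
  inferInstanceAs (Module k ↥(Finsupp.supported k k (pathIndex X Y i)))

/-- The inclusion of the space of paths into the space of all lists. -/
noncomputable def pathIncl (i : ℕ) : PathSpace k X Y i →ₗ[k] (List (IntClass r) →₀ k) :=
  (Finsupp.supported k k (pathIndex X Y i)).subtype

theorem pathIncl_mem {i : ℕ} (c : PathSpace k X Y i) :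
    pathIncl k X Y i c ∈ Finsupp.supported k k (pathIndex X Y i) :=
  Subtype.property (p := fun x => x ∈ Finsupp.supported k k (pathIndex X Y i)) c

theorem pathIncl_injective (i : ℕ) : Function.Injective (pathIncl k X Y i) :=
  Subtype.val_injective

/-- The element of the space of paths given by a combination of paths. -/
def pathMk {i : ℕ} (c : List (IntClass r) →₀ k)
    (hc : c ∈ Finsupp.supported k k (pathIndex X Y i)) : PathSpace k X Y i := ⟨c, hc⟩

theorem pathIncl_pathMk {i : ℕ} (c : List (IntClass r) →₀ k)
    (hc : c ∈ Finsupp.supported k k (pathIndex X Y i)) :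
    pathIncl k X Y i (pathMk k X Y c hc) = c := rfl

theorem single_mem_path {i : ℕ} {l : List (IntClass r)} (hl : l ∈ pathIndex X Y i) :
    Finsupp.single l 1 ∈ Finsupp.supported k k (pathIndex X Y i) :=
  Finsupp.single_mem_supported k _ hl

variable (r) in
/-- The linear extension of `merge`. -/
noncomputable def mergeLin : (List (IntClass r) →₀ k) →ₗ[k] (List (IntClass r) →₀ k) :=
  Finsupp.linearCombination k (merge k)

theorem mergeLin_single (l : List (IntClass r)) (c : k) :
    mergeLin k r (Finsupp.single l c) = c • merge k l := by
  simp [mergeLin]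

theorem supported_le {s : Set (List (IntClass r))} {N : Submodule k (List (IntClass r) →₀ k)}
    (h : ∀ l ∈ s, Finsupp.single l 1 ∈ N) : Finsupp.supported k k s ≤ N := by
  rw [Finsupp.supported_eq_span_single, Submodule.span_le]
  rintro _ ⟨l, hl, rfl⟩
  exact h l hl

theorem mergeLin_mem {i : ℕ} {c : List (IntClass r) →₀ k}
    (hc : c ∈ Finsupp.supported k k (pathIndex X Y (i + 1))) :
    mergeLin k r c ∈ Finsupp.supported k k (pathIndex X Y i) := by
  refine supported_le k (N := (Finsupp.supported k k (pathIndex X Y i)).comap (mergeLin k r))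
    ?_ hc
  rintro l ⟨h1, h2⟩
  rw [Submodule.mem_comap, mergeLin_single, one_smul]
  refine Finsupp.supported_mono ?_ (h1.merge_mem k)
  rintro m ⟨m1, m2, -⟩
  exact ⟨m1, by omega⟩

/-- The differential of the complex of paths. -/
noncomputable def pathD (i : ℕ) : PathSpace k X Y (i + 1) →ₗ[k] PathSpace k X Y i :=
  (-mergeLin k r).restrict fun _ hc => neg_mem (mergeLin_mem k X Y hc)

theorem pathIncl_pathD (i : ℕ) (c : PathSpace k X Y (i + 1)) :
    pathIncl k X Y i (pathD k X Y i c) = -mergeLin k r (pathIncl k X Y (i + 1) c) := rfl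

/-- The paths of weight `j`. -/
noncomputable def pathDeg (i : ℕ) (j : ℤ) : Submodule k (PathSpace k X Y i) :=
  (Finsupp.supported k k {l | (weight l : ℤ) = j}).comap (pathIncl k X Y i)

/-- The map `R[List] → k[List]` induced by the character of `R` on `k_X`. -/
noncomputable def charMap : BarAmbient k r →ₗ[k] (List (IntClass r) →₀ k) :=
  Finsupp.mapRange.linearMap (grChar k X).toLinearMap

theorem charMap_single (l : List (IntClass r)) (a : GrR k r) :
    charMap k X (Finsupp.single l a) = Finsupp.single l (grChar k X a) := by
  simp [charMap]

theorem charMap_smul (a : GrR k r) (x : BarAmbient k r) :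
    charMap k X (a • x) = grChar k X a • charMap k X x := by
  induction x using Finsupp.induction_linear with
  | zero => simp
  | add x y hx hy => rw [smul_add, map_add, map_add, smul_add, hx, hy]
  | single l b =>
    rw [Finsupp.smul_single, charMap_single, charMap_single, Finsupp.smul_single, smul_eq_mul,
      smul_eq_mul, map_mul]

theorem charMap_embed (a : GrR k r) (c : List (IntClass r) →₀ k) :
    charMap k X (embed a c) = grChar k X a • c := by
  induction c using Finsupp.induction_linear with
  | zero => simp
  | add x y hx hy => rw [map_add, map_add, smul_add, hx, hy]
  | single l b =>
    rw [embed_single, map_smul, charMap_single, Finsupp.smul_single, Finsupp.smul_single,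
      smul_eq_mul, smul_eq_mul, mul_comm]

theorem charMap_mem {s : Set (List (IntClass r) × IntClass r)} {x : BarAmbient k r}
    (hx : x ∈ barSpan hP k s) :
    charMap k X x ∈ Finsupp.supported k k {l | (l, pointInt X) ∈ s} := by
  classical
  refine barSpan_le hP k (N := (Finsupp.supported k k _).comap (charMap k X)) ?_ hx
  rintro ⟨l, α⟩ h1
  rw [Submodule.mem_comap, charMap_single, grChar_zetaGr]
  split_ifs with hα
  · subst hα
    exact Finsupp.single_mem_supported k _ h1
  · rw [Finsupp.single_zero]; exact zero_mem _

/-- The term where the first entry β multiplies the coefficient disappears, because β is proper and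
the character of k_X kills ζ_β. The merging terms remain, with their minus sign. -/
theorem charMap_barD {i : ℕ} {x : BarAmbient k r} (hx : x ∈ barModule hP k Y i) :
    charMap k X (barD hP k x) = -mergeLin k r (charMap k X x) := by
  refine barSpan_le hP k (N := LinearMap.eqLocus
    (charMap k X ∘ₗ (barD hP k).restrictScalars k) (-(mergeLin k r ∘ₗ charMap k X))) ?_ hx
  rintro ⟨l, α⟩ ⟨h1, -⟩
  change charMap k X (barD hP k (Finsupp.single l (zetaGr hP k α))) =
    -mergeLin k r (charMap k X (Finsupp.single l (zetaGr hP k α)))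
  rw [charMap_single, mergeLin_single]
  cases l with
  | nil => rw [barD_nil, map_zero, show merge k [] = 0 from rfl, smul_zero, neg_zero]
  | cons β l =>
    rw [barD_cons, map_sub, charMap_single, charMap_embed, map_mul,
      grChar_of_isProper hP k X h1.1, mul_zero, Finsupp.single_zero, zero_sub]

/-- The restriction of `charMap` to the bar resolution. -/
noncomputable def barChar (i : ℕ) : BarTerm hP k Y i →ₗ[k] PathSpace k X Y i :=
  (charMap k X ∘ₗ barInclK hP k Y i).codRestrict _ fun x => by
    refine Finsupp.supported_mono ?_ (charMap_mem hP k X (barIncl_mem hP k Y x))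
    rintro l ⟨h1, h2⟩
    exact ⟨by simpa using h1, h2⟩

/-- The pairing of `k_X` with the bar resolution. -/
noncomputable def barPairing (i : ℕ) :
    PointModule k X →ₗ[k] BarTerm hP k Y i →ₗ[k] PathSpace k X Y i :=
  LinearMap.toSpanSingleton k (BarTerm hP k Y i →ₗ[k] PathSpace k X Y i)
    (barChar hP k X Y i) ∘ₗ (pointVal k r X).toLinearMap

theorem coe_barPairing (i : ℕ) (m : PointModule k X) (n : BarTerm hP k Y i) :
    pathIncl k X Y i (barPairing hP k X Y i m n) =
      pointVal k r X m • charMap k X (barIncl hP k Y i n) := rfl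

theorem barPairing_balanced (i : ℕ) (m : PointModule k X) (a : GrR k r) (n : BarTerm hP k Y i) :
    barPairing hP k X Y i (MulOpposite.op a • m) n = barPairing hP k X Y i m (a • n) := by
  apply pathIncl_injective k X Y i
  rw [coe_barPairing, coe_barPairing, map_smul (barIncl hP k Y i), gr_op_smul, charMap_smul,
    map_smul, smul_eq_mul, mul_smul, smul_comm]

/-- The map from `k_X ⊗_R B` to the complex of paths. -/
noncomputable def tensorToPath (i : ℕ) :
    TensorOver k (GrR k r) (PointModule k X) (BarTerm hP k Y i) →ₗ[k] PathSpace k X Y i :=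
  tensorDesc (V := PathSpace k X Y i) k (barPairing hP k X Y i) (barPairing_balanced hP k X Y i)

theorem coe_tensorToPath (i : ℕ) (m : PointModule k X) (n : BarTerm hP k Y i) :
    pathIncl k X Y i (tensorToPath hP k X Y i (tensorMk k m n)) =
      pointVal k r X m • charMap k X (barIncl hP k Y i n) := rfl

theorem pointInt_mem_barIndex {i : ℕ} {l : List (IntClass r)} (h : l ∈ pathIndex X Y i) :
    (l, pointInt X) ∈ barIndex Y i := by
  refine ⟨?_, h.2⟩
  rw [target_pointInt]
  exact h.1

/-- The generator of the bar resolution given by a path. -/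
noncomputable def barBasis {i : ℕ} (l : List (IntClass r)) (h : l ∈ pathIndex X Y i) :
    BarTerm hP k Y i :=
  barMk hP k Y (Finsupp.single l (zetaGr hP k (pointInt X)))
    (single_mem_barModule hP k Y (pointInt_mem_barIndex X Y h))

open Classical in
/-- The map from the complex of paths to `k_X ⊗_R B`. -/
noncomputable def pathToTensor (i : ℕ) :
    PathSpace k X Y i →ₗ[k] TensorOver k (GrR k r) (PointModule k X) (BarTerm hP k Y i) :=
  Finsupp.linearCombination k (fun l => if h : l ∈ pathIndex X Y i then
    tensorMk k ((pointVal k r X).symm 1) (barBasis hP k X Y l h) else 0) ∘ₗ pathIncl k X Y i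

theorem pathToTensor_single {i : ℕ} {l : List (IntClass r)} (h : l ∈ pathIndex X Y i) :
    pathToTensor hP k X Y i (pathMk k X Y (Finsupp.single l 1) (single_mem_path k X Y h)) =
      tensorMk k ((pointVal k r X).symm 1) (barBasis hP k X Y l h) := by
  unfold pathToTensor
  rw [LinearMap.comp_apply, pathIncl_pathMk, Finsupp.linearCombination_single, one_smul,
    dif_pos h]

theorem pathSpace_induction {i : ℕ} {N : Submodule k (PathSpace k X Y i)}
    {s : Set (List (IntClass r))}
    (h : ∀ l, ∀ hl : l ∈ pathIndex X Y i, l ∈ s →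
      pathMk k X Y (Finsupp.single l 1) (single_mem_path k X Y hl) ∈ N)
    {c : PathSpace k X Y i} (hc : pathIncl k X Y i c ∈ Finsupp.supported k k s) :
    c ∈ N := by
  have h1 : Finsupp.supported k k (pathIndex X Y i ∩ s) ≤ N.map (pathIncl k X Y i) :=
    supported_le k fun l hl => ⟨_, h l hl.1 hl.2, rfl⟩
  rw [Finsupp.supported_inter] at h1
  obtain ⟨c', hc', e⟩ := h1 ⟨pathIncl_mem k X Y c, hc⟩
  obtain rfl : c' = c := pathIncl_injective k X Y i e
  exact hc'

theorem tensorToPath_pathToTensor (i : ℕ) (c : PathSpace k X Y i) :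
    tensorToPath hP k X Y i (pathToTensor hP k X Y i c) = c := by
  classical
  refine pathSpace_induction k X Y (s := Set.univ) (N := LinearMap.eqLocus
    (tensorToPath hP k X Y i ∘ₗ pathToTensor hP k X Y i) LinearMap.id) (fun l hl _ => ?_)
    (by simp)
  rw [LinearMap.mem_eqLocus, LinearMap.comp_apply, pathToTensor_single hP k X Y hl, LinearMap.id_apply]
  apply pathIncl_injective k X Y i
  rw [coe_tensorToPath, LinearEquiv.apply_symm_apply, one_smul, barBasis, barIncl_barMk, charMap_single,
    grChar_zetaGr, if_pos rfl, pathIncl_pathMk]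

/-- A basis element with coefficient ζ_α, where α is not the point class of X, is ζ_α times another
basis element. Carried across the tensor sign, ζ_α acts on k_X by zero, so only the generators given
by paths from X survive. -/
theorem pathToTensor_tensorToPath (i : ℕ)
    (t : TensorOver k (GrR k r) (PointModule k X) (BarTerm hP k Y i)) :
    pathToTensor hP k X Y i (tensorToPath hP k X Y i t) = t := by
  classical
  have h : pathToTensor hP k X Y i ∘ₗ tensorToPath hP k X Y i = LinearMap.id := by
    refine tensorOver_ext (R := GrR k r) k (PointModule k X) fun m n => ?_
    refine barTerm_induction hP k Y (s := barIndex Y i) (N := LinearMap.eqLocus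
      ((pathToTensor hP k X Y i ∘ₗ tensorToPath hP k X Y i) ∘ₗ tensorMkLin k m)
      (tensorMkLin k m)) (fun l α hl _ => ?_) subset_rfl (barIncl_mem hP k Y n)
    rw [LinearMap.mem_eqLocus, LinearMap.comp_apply, LinearMap.comp_apply, tensorMkLin_apply]
    by_cases hα : α = pointInt X
    · subst hα
      have hl' : l ∈ pathIndex X Y i := ⟨(target_pointInt X) ▸ hl.1, hl.2⟩
      have e : tensorToPath hP k X Y i (tensorMk k m
          (barMk hP k Y _ (single_mem_barModule hP k Y hl))) =
          pointVal k r X m • pathMk k X Y (Finsupp.single l 1) (single_mem_path k X Y hl') := by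
        apply pathIncl_injective k X Y i
        rw [coe_tensorToPath, barIncl_barMk, charMap_single, grChar_zetaGr, if_pos rfl]
        rfl
      rw [e, map_smul, pathToTensor_single hP k X Y hl', ← smul_tensorMk, ← map_smul,
        smul_eq_mul, mul_one, LinearEquiv.symm_apply_apply]
      rfl
    · have e : tensorToPath hP k X Y i (tensorMk k m
          (barMk hP k Y _ (single_mem_barModule hP k Y hl))) = 0 := by
        apply pathIncl_injective k X Y i
        rw [coe_tensorToPath, barIncl_barMk, charMap_single, grChar_zetaGr, if_neg hα,
          Finsupp.single_zero, smul_zero]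
        rfl
      have hm : (l, pointInt (target α)) ∈ barIndex Y i := by
        refine ⟨?_, hl.2⟩
        rw [target_pointInt]
        exact hl.1
      have e' : barMk hP k Y _ (single_mem_barModule hP k Y hl) =
          zetaGr hP k α • barMk hP k Y _ (single_mem_barModule hP k Y hm) := by
        apply barIncl_injective hP k Y i
        rw [map_smul, barIncl_barMk, barIncl_barMk, Finsupp.smul_single, smul_eq_mul,
          zetaGr_mul_pointInt hP k rfl]
      rw [e, map_zero, e', tensorMk_smul, gr_op_smul, grChar_zetaGr, if_neg hα, zero_smul,
        zero_tensorMk]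
  exact LinearMap.congr_fun h t

theorem tensorToPath_tensorMap (i : ℕ)
    (t : TensorOver k (GrR k r) (PointModule k X) (BarTerm hP k Y (i + 1))) :
    pathD k X Y i (tensorToPath hP k X Y (i + 1) t) = tensorToPath hP k X Y i
      (tensorMap k (PointModule k X) (barDiff hP k Y i) t) := by
  have h : pathD k X Y i ∘ₗ tensorToPath hP k X Y (i + 1) = tensorToPath hP k X Y i ∘ₗ
      tensorMap k (PointModule k X) (barDiff hP k Y i) := by
    refine tensorOver_ext (R := GrR k r) (V := PathSpace k X Y i) k (PointModule k X)
      fun m n => pathIncl_injective k X Y i ?_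
    rw [LinearMap.comp_apply, LinearMap.comp_apply, tensorMap_mk, pathIncl_pathD, coe_tensorToPath,
      coe_tensorToPath, barIncl_barDiff, charMap_barD hP k X Y (barIncl_mem hP k Y n), map_smul,
      smul_neg]
  exact LinearMap.congr_fun h t

theorem tensorToPath_mem_deg (i : ℕ) (j : ℤ) :
    ∀ t ∈ tensorDegree (R := GrR k r) k (pointDegree k X) (barDeg hP k Y i) j,
      tensorToPath hP k X Y i t ∈ pathDeg k X Y i j := by
  intro t ht
  refine Submodule.span_le (p := (pathDeg k X Y i j).comap (tensorToPath hP k X Y i)).2 ?_ ht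
  rintro _ ⟨a, b, hab, m, hm, n, hn, rfl⟩
  change pointVal k r X m • charMap k X (barIncl hP k Y i n) ∈
    Finsupp.supported k k {l | (weight l : ℤ) = j}
  by_cases ha : a = 0
  · refine Submodule.smul_mem _ _ (Finsupp.supported_mono ?_ (charMap_mem hP k X hn))
    rintro l ⟨-, h⟩
    rw [rk_pointInt hP, zero_add] at h
    change (weight l : ℤ) = j
    rw [h, ← hab, ha, zero_add]
  · rw [pointDegree_of_ne k X ha, Submodule.mem_bot] at hm
    rw [hm, map_zero, zero_smul]
    exact zero_mem _

theorem pathToTensor_mem_deg (i : ℕ) (j : ℤ) : ∀ c ∈ pathDeg k X Y i j,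
    pathToTensor hP k X Y i c ∈
      tensorDegree (R := GrR k r) k (pointDegree k X) (barDeg hP k Y i) j := by
  intro c hc
  refine pathSpace_induction k X Y (N := (tensorDegree (R := GrR k r) k (pointDegree k X)
    (barDeg hP k Y i) j).comap (pathToTensor hP k X Y i)) (fun l hl hj => ?_) hc
  rw [Submodule.mem_comap, pathToTensor_single hP k X Y hl]
  refine Submodule.subset_span ⟨0, j, zero_add j, _, ?_, _, ?_, rfl⟩
  · rw [pointDegree_zero]; trivial
  · rw [mem_barDeg, barBasis, barIncl_barMk]
    refine single_mem_barSpan hP k ⟨pointInt_mem_barIndex X Y hl, ?_⟩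
    rw [rk_pointInt hP, zero_add]
    exact hj

theorem isInternal_pointDegree : DirectSum.IsInternal (pointDegree k Y) := by
  refine isInternal_of_separated (fun j => if j = 0 then LinearMap.id else 0) ?_ ?_ ?_
  · intro j x hx h
    by_cases hj : j = 0
    · rwa [if_pos hj] at h
    · rwa [pointDegree_of_ne k Y hj] at hx
  · intro j j' hj x hx
    by_cases h0 : j = 0
    · rw [pointDegree_of_ne k Y (h0 ▸ hj), Submodule.mem_bot] at hx
      rw [hx, map_zero]
    · rw [if_neg h0, LinearMap.zero_apply]
  · rw [eq_top_iff]
    exact (pointDegree_zero k Y).ge.trans (le_iSup _ 0)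

/-- The homology of the complex of paths. -/
abbrev PathHomology (i : ℕ) : Type (max u v) :=
  SeqHomology (C := PathSpace k X Y) (pathD k X Y) i

/-- The homology classes of the cycles in a subspace of the complex of paths. -/
noncomputable def pathHomologyPart {i : ℕ} (D : Submodule k (PathSpace k X Y i)) :
    Submodule k (PathHomology k X Y i) :=
  homologyPart (C := PathSpace k X Y) (pathD k X Y) D

include hP in
/-- `Tor` is the homology of the complex of paths. -/
theorem exists_torEquiv_path (Q : GradedProjectiveResolution.{max u v, v, w} k (R := GrR k r)
    (grGrading k r) (PointModule k Y) (pointDegree k Y)) (i : ℕ) :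
    ∃ e : Q.Tor (PointModule k X) i ≃ₗ[k] PathHomology k X Y i,
      ∀ j, (Q.torDegree (pointDegree k X) i j).map e.toLinearMap =
        pathHomologyPart k X Y (pathDeg k X Y i j) := by
  obtain ⟨e, he⟩ := exists_torEquiv Q (barResolution hP k Y) (pointDegree k X)
    (iSup_grGrading k r) (isInternal_pointDegree k Y) i
  obtain ⟨e', he'⟩ := exists_homologyEquiv
    (C := fun i => TensorOver k (GrR k r) (PointModule k X) (BarTerm hP k Y i))
    (C' := PathSpace k X Y)
    (d := fun i => tensorMap k (PointModule k X) (barDiff hP k Y i))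
    (d' := pathD k X Y)
    (D := fun i => tensorDegree (R := GrR k r) k (pointDegree k X) (barDeg hP k Y i))
    (D' := pathDeg k X Y)
    (fun i => tensorToPath hP k X Y i) (tensorToPath_tensorMap hP k X Y)
    (fun i => pathToTensor hP k X Y i) (fun i x => by
      have h := congrArg (pathToTensor hP k X Y i)
        (tensorToPath_tensorMap hP k X Y i (pathToTensor hP k X Y (i + 1) x))
      rw [tensorToPath_pathToTensor, pathToTensor_tensorToPath] at h
      exact h.symm)
    (fun i x _ => by
      rw [pathToTensor_tensorToPath, sub_self]
      exact zero_mem _)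
    (fun i x _ => by
      rw [tensorToPath_pathToTensor, sub_self]
      exact zero_mem _)
    (tensorToPath_mem_deg hP k X Y) (pathToTensor_mem_deg hP k X Y) i
  have key : ∃ e' : (barResolution hP k Y).Tor (PointModule k X) i ≃ₗ[k]
      PathHomology k X Y i,
      ∀ j, ((barResolution hP k Y).torDegree (pointDegree k X) i j).map e'.toLinearMap =
        pathHomologyPart k X Y (pathDeg k X Y i j) := by
    cases i with
    | zero => exact ⟨e', he'⟩
    | succ i => exact ⟨e', he'⟩
  obtain ⟨e', he'⟩ := key
  refine ⟨e.trans e', fun j => ?_⟩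
  rw [← he', ← he, ← Submodule.map_comp]
  rfl

end PathComplex

/-! ### Homology of a direct sum of complexes. -/

section Decomposition

variable {k : Type v} [Field k] {C : ℕ → Type*} [∀ i, AddCommGroup (C i)] [∀ i, Module k (C i)]
  {d : ∀ i, C (i + 1) →ₗ[k] C i} {L : Type*} {D : ∀ i, L → Submodule k (C i)}
  {pr : ∀ i, L → C i →ₗ[k] C i}

theorem homologyPart_mono {i : ℕ} {E E' : Submodule k (C i)} (h : E ≤ E') :
    homologyPart d E ≤ homologyPart d E' :=
  Submodule.map_mono fun _ hx => h hx

/-- The projections commute with the differential, so the components of a cycle are cycles; on E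
only the components with labels in the range of f are nonzero. -/
theorem homologyPart_le_iSup (hcomm : ∀ l i x, d i (pr (i + 1) l x) = pr i l (d i x))
    (hmem : ∀ i l x, pr i l x ∈ D i l) (hsum : ∀ i x, ∃ s : Finset L, x = ∑ l ∈ s, pr i l x)
    {i : ℕ} {E : Submodule k (C i)} {ι : Type*} (f : ι → L)
    (hE : ∀ x ∈ E, ∀ l ∉ Set.range f, pr i l x = 0) :
    homologyPart d E ≤ ⨆ b, homologyPart d (D i (f b)) := by
  rintro _ ⟨⟨x, hx⟩, hxE, rfl⟩
  obtain ⟨s, hs⟩ := hsum i x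
  have hc : ∀ l, pr i l x ∈ seqCycles d i := fun l =>
    map_seqCycles (d := d) (d' := d) (f := fun i => pr i l) (hcomm l) i x hx
  have e : (⟨x, hx⟩ : seqCycles d i) = ∑ l ∈ s, ⟨pr i l x, hc l⟩ := by
    apply Subtype.ext
    rw [AddSubmonoidClass.coe_finsetSum]
    exact hs
  rw [e, map_sum]
  refine Submodule.sum_mem _ fun l _ => ?_
  by_cases hl : l ∈ Set.range f
  · obtain ⟨b, rfl⟩ := hl
    exact Submodule.mem_iSup_of_mem b ⟨⟨_, hc _⟩, hmem _ _ _, rfl⟩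
  · have h0 : (⟨pr i l x, hc l⟩ : seqCycles d i) = 0 := Subtype.ext (hE x hxE l hl)
    rw [h0, map_zero]
    exact zero_mem _

/-- The decomposition of the homology of a complex which is a direct sum of complexes. -/
theorem isInternal_homologyPart [DecidableEq L]
    (hcomm : ∀ l i x, d i (pr (i + 1) l x) = pr i l (d i x))
    (hmem : ∀ i l x, pr i l x ∈ D i l) (hid : ∀ i l, ∀ x ∈ D i l, pr i l x = x)
    (hne : ∀ i l l', l' ≠ l → ∀ x ∈ D i l', pr i l x = 0)
    (hsum : ∀ i x, ∃ s : Finset L, x = ∑ l ∈ s, pr i l x) (i : ℕ) :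
    DirectSum.IsInternal fun l => homologyPart d (D i l) := by
  have hc : ∀ l, ∀ x ∈ seqCycles d i, pr i l x ∈ seqCycles d i := fun l =>
    map_seqCycles (d := d) (d' := d) (f := fun i => pr i l) (hcomm l) i
  refine isInternal_of_separated
    (fun l => seqHomologyMap (d := d) (d' := d) (fun i => pr i l) (hcomm l) i) ?_ ?_ ?_
  · rintro l _ ⟨x, hx, rfl⟩ h
    have e : x = (⟨pr i l x, hc l x x.2⟩ : seqCycles d i) :=
      Subtype.ext (hid i l x hx).symm
    exact (congrArg ((seqBoundaries d i).submoduleOf (seqCycles d i)).mkQ e).trans h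
  · rintro l l' hl _ ⟨x, hx, rfl⟩
    have h0 : (⟨pr i l x, hc l x x.2⟩ : seqCycles d i) = 0 :=
      Subtype.ext (hne i l l' hl x hx)
    refine (seqHomologyMap_mk (fun i => pr i l) (hcomm l) i x).trans ?_
    rw [h0]
    rfl
  · rw [eq_top_iff]
    refine le_trans ?_ (homologyPart_le_iSup (E := ⊤) hcomm hmem hsum id
      fun x _ l hl => (hl ⟨l, rfl⟩).elim)
    intro x _
    induction x using Submodule.Quotient.induction_on with
    | H x => exact ⟨x, trivial, rfl⟩

/-- A quotient of a space of cycles, in terms of another complex. -/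
theorem nonempty_quotient_equiv {V W : Type*} [AddCommGroup V] [Module k V] [AddCommGroup W]
    [Module k W] {Z B : Submodule k V} {Z' B' D' : Submodule k W} (f : Z →ₗ[k] W)
    (hZ : ∀ z, f z ∈ Z') (hD : ∀ z, f z ∈ D') (hB : ∀ z, f z ∈ B' ↔ (z : V) ∈ B)
    (hs : ∀ w ∈ Z', w ∈ D' → ∃ z, f z = w) :
    Nonempty ((Z ⧸ B.submoduleOf Z) ≃ₗ[k]
      ((D'.submoduleOf Z').map (B'.submoduleOf Z').mkQ : Submodule k (Z' ⧸ B'.submoduleOf Z'))) := by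
  let φ : Z →ₗ[k] Z' ⧸ B'.submoduleOf Z' := (B'.submoduleOf Z').mkQ ∘ₗ f.codRestrict Z' hZ
  have hker : LinearMap.ker φ = B.submoduleOf Z := by
    ext z
    rw [LinearMap.mem_ker]
    exact (Submodule.Quotient.mk_eq_zero _).trans (hB z)
  have hrange : LinearMap.range φ = (D'.submoduleOf Z').map (B'.submoduleOf Z').mkQ := by
    apply le_antisymm
    · rintro _ ⟨z, rfl⟩
      exact ⟨⟨f z, hZ z⟩, hD z, rfl⟩
    · rintro _ ⟨⟨w, hw⟩, hw', rfl⟩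
      obtain ⟨z, rfl⟩ := hs w hw hw'
      exact ⟨z, rfl⟩
  exact ⟨(Submodule.quotEquivOfEq _ _ hker.symm).trans
    (φ.quotKerEquivRange.trans (LinearEquiv.ofEq _ _ hrange))⟩

end Decomposition

/-! ### Projections of finitely supported functions. -/

section Filter

variable (k : Type v) [Field k] {ι : Type*}

open Classical in
/-- The projection of finitely supported functions onto those supported in `s`. -/
noncomputable def filterLin (s : Set ι) : (ι →₀ k) →ₗ[k] (ι →₀ k) :=
  (Finsupp.supported k k s).subtype ∘ₗ Finsupp.restrictDom k k s

theorem filterLin_mem (s : Set ι) (c : ι →₀ k) : filterLin k s c ∈ Finsupp.supported k k s :=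
  Subtype.property _

open Classical in
theorem filterLin_apply (s : Set ι) (c : ι →₀ k) : filterLin k s c = c.filter (· ∈ s) := by
  simp [filterLin]

theorem filterLin_of_mem {s : Set ι} {c : ι →₀ k} (hc : c ∈ Finsupp.supported k k s) :
    filterLin k s c = c := by
  classical
  rw [filterLin_apply, Finsupp.filter_eq_self_iff]
  intro x hx
  exact hc (by simpa using hx)

theorem filterLin_of_disjoint {s t : Set ι} (h : Disjoint s t) {c : ι →₀ k}
    (hc : c ∈ Finsupp.supported k k t) : filterLin k s c = 0 := by
  classical
  rw [filterLin_apply, Finsupp.filter_eq_zero_iff]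
  intro x hx
  by_contra h0
  exact Set.disjoint_left.1 h hx (hc (by simpa using h0))

theorem filterLin_mem_of_mem {s t : Set ι} {c : ι →₀ k} (hc : c ∈ Finsupp.supported k k t) :
    filterLin k s c ∈ Finsupp.supported k k t := by
  classical
  rw [filterLin_apply, Finsupp.mem_supported]
  refine subset_trans ?_ hc
  rw [Finsupp.support_filter]
  exact Finset.coe_subset.2 (Finset.filter_subset _ _)

theorem exists_sum_filterLin {L : Type*} (f : ι → L) (c : ι →₀ k) :
    ∃ s : Finset L, c = ∑ l ∈ s, filterLin k (f ⁻¹' {l}) c := by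
  classical
  refine ⟨c.support.image f, Finsupp.ext fun x => ?_⟩
  rw [Finsupp.finsetSum_apply]
  simp only [filterLin_apply, Finsupp.filter_apply, Set.mem_preimage, Set.mem_singleton_iff]
  rw [Finset.sum_ite_eq]
  split_ifs with h
  · rfl
  · by_contra h0
    exact h (Finset.mem_image_of_mem f (by simpa using h0))

end Filter

/-! ### Splitting the complex of paths by labels. -/

section PathLabels

variable {P : Type u} [PartialOrder P] (k : Type v) [Field k] {r : Setoid (NonemptyInterval P)}
  [IncidenceAxioms r] (X Y : PointClass r)

/-- The combinations of the paths with a given label. -/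
noncomputable def pathPart {L : Type*} (f : List (IntClass r) → L) (i : ℕ) (l : L) :
    Submodule k (PathSpace k X Y i) :=
  (Finsupp.supported k k (f ⁻¹' {l})).comap (pathIncl k X Y i)

/-- The projection to the combinations of the paths with a given label. -/
noncomputable def pathProj {L : Type*} (f : List (IntClass r) → L) (i : ℕ) (l : L) :
    PathSpace k X Y i →ₗ[k] PathSpace k X Y i :=
  (filterLin k (f ⁻¹' {l})).restrict fun _ hc => filterLin_mem_of_mem k hc

theorem pathIncl_pathProj {L : Type*} (f : List (IntClass r) → L) (i : ℕ) (l : L)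
    (c : PathSpace k X Y i) : pathIncl k X Y i (pathProj k X Y f i l c) =
      filterLin k (f ⁻¹' {l}) (pathIncl k X Y i c) := rfl

section

variable {L : Type*} {f : List (IntClass r) → L}
  (hf : ∀ l, IsPath Y X l → merge k l ∈ Finsupp.supported k k (f ⁻¹' {f l}))

-- Merging does not change labels, so the differential cannot mix the parts. It suffices to test
-- this on single paths.
include hf in
theorem pathD_pathProj (l : L) (i : ℕ) (c : PathSpace k X Y (i + 1)) :
    pathD k X Y i (pathProj k X Y f (i + 1) l c) = pathProj k X Y f i l (pathD k X Y i c) := by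
  refine pathSpace_induction k X Y (s := Set.univ) (N := LinearMap.eqLocus
    (pathD k X Y i ∘ₗ pathProj k X Y f (i + 1) l) (pathProj k X Y f i l ∘ₗ pathD k X Y i))
    (fun m hm _ => ?_) (by simp)
  rw [LinearMap.mem_eqLocus, LinearMap.comp_apply, LinearMap.comp_apply]
  apply pathIncl_injective k X Y i
  rw [pathIncl_pathProj, pathIncl_pathD, pathIncl_pathD, pathIncl_pathProj, pathIncl_pathMk,
    map_neg]
  have h1 : Finsupp.single m (1 : k) ∈ Finsupp.supported k k (f ⁻¹' {f m}) :=
    Finsupp.single_mem_supported k _ rfl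
  have h2 : mergeLin k r (Finsupp.single m 1) ∈ Finsupp.supported k k (f ⁻¹' {f m}) := by
    rw [mergeLin_single, one_smul]
    exact hf m hm.1
  by_cases hl : f m = l
  · subst hl
    rw [filterLin_of_mem k h1, filterLin_of_mem k h2]
  · have hd : Disjoint (f ⁻¹' {l}) (f ⁻¹' {f m}) :=
      Disjoint.preimage f (Set.disjoint_singleton.2 (Ne.symm hl))
    rw [filterLin_of_disjoint k hd h1, filterLin_of_disjoint k hd h2, map_zero]

theorem pathProj_mem (i : ℕ) (l : L) (c : PathSpace k X Y i) :
    pathProj k X Y f i l c ∈ pathPart k X Y f i l :=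
  filterLin_mem k (f ⁻¹' {l}) (pathIncl k X Y i c)

theorem pathProj_of_mem (i : ℕ) (l : L) : ∀ c ∈ pathPart k X Y f i l,
    pathProj k X Y f i l c = c := fun _ hc =>
  pathIncl_injective k X Y i (filterLin_of_mem k hc)

theorem pathProj_of_mem_of_ne (i : ℕ) (l l' : L) (hl : l' ≠ l) : ∀ c ∈ pathPart k X Y f i l',
    pathProj k X Y f i l c = 0 := fun _ hc =>
  pathIncl_injective k X Y i (filterLin_of_disjoint k
    (Disjoint.preimage f (Set.disjoint_singleton.2 hl.symm)) hc)

theorem exists_sum_pathProj (i : ℕ) (c : PathSpace k X Y i) :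
    ∃ s : Finset L, c = ∑ l ∈ s, pathProj k X Y f i l c := by
  obtain ⟨s, hs⟩ := exists_sum_filterLin k f (pathIncl k X Y i c)
  refine ⟨s, pathIncl_injective k X Y i ?_⟩
  rw [map_sum]
  exact hs

include hf in
theorem isInternal_pathHomologyPart [DecidableEq L] (i : ℕ) :
    DirectSum.IsInternal fun l => pathHomologyPart k X Y (pathPart k X Y f i l) :=
  isInternal_homologyPart (C := PathSpace k X Y) (d := pathD k X Y) (D := pathPart k X Y f)
    (pr := pathProj k X Y f) (pathD_pathProj k X Y hf) (pathProj_mem k X Y)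
    (pathProj_of_mem k X Y) (pathProj_of_mem_of_ne k X Y) (exists_sum_pathProj k X Y) i

include hf in
theorem pathHomologyPart_le_iSup {i : ℕ} {s : Set (List (IntClass r))} {ι : Type*} (g : ι → L)
    (hg : ∀ m ∈ pathIndex X Y i, m ∈ s → f m ∈ Set.range g) :
    pathHomologyPart k X Y ((Finsupp.supported k k s).comap (pathIncl k X Y i)) ≤
      ⨆ b, pathHomologyPart k X Y (pathPart k X Y f i (g b)) := by
  refine homologyPart_le_iSup (C := PathSpace k X Y) (d := pathD k X Y) (D := pathPart k X Y f)
    (pr := pathProj k X Y f) (pathD_pathProj k X Y hf) (pathProj_mem k X Y)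
    (exists_sum_pathProj k X Y) g fun c hc l hl => pathIncl_injective k X Y i ?_
  have h1 : pathIncl k X Y i c ∈ Finsupp.supported k k (pathIndex X Y i ∩ s) := by
    rw [Finsupp.supported_inter]
    exact ⟨pathIncl_mem k X Y c, hc⟩
  refine filterLin_of_disjoint k (Set.disjoint_left.2 ?_) h1
  rintro m rfl ⟨h2, h3⟩
  exact hl (hg m h2 h3)

end

end PathLabels

/-! ### Finite chains as sorted lists. -/

section Chains

variable {V : Type u} [PartialOrder V]

-- A minimal element of a chain is its least element; it becomes the head and the rest is sorted by
-- induction.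
open Classical in
theorem exists_pairwise_toFinset {F : Finset V} (h : IsChain (· ≤ ·) (F : Set V)) :
    ∃ p : List V, p.Pairwise (· < ·) ∧ p.toFinset = F := by
  induction F using Finset.strongInduction with
  | H F ih =>
    rcases F.eq_empty_or_nonempty with rfl | hF
    · exact ⟨[], List.Pairwise.nil, rfl⟩
    · obtain ⟨m, hm⟩ := F.exists_minimal hF
      obtain ⟨p, hp, hpF⟩ := ih (F.erase m) (Finset.erase_ssubset hm.1)
        (h.mono (Finset.coe_subset.2 (Finset.erase_subset _ _)))
      refine ⟨m :: p, List.pairwise_cons.2 ⟨fun z hz => ?_, hp⟩, ?_⟩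
      · rw [← List.mem_toFinset, hpF, Finset.mem_erase] at hz
        rcases h hm.1 hz.2 hz.1.symm with h1 | h1
        · exact lt_of_le_of_ne h1 hz.1.symm
        · exact lt_of_le_of_ne (hm.2 hz.2 h1) hz.1.symm
      · rw [List.toFinset_cons, hpF, Finset.insert_erase hm.1]

open Classical in
theorem eq_of_pairwise_of_toFinset_eq {p q : List V} (hp : p.Pairwise (· < ·))
    (hq : q.Pairwise (· < ·)) (h : p.toFinset = q.toFinset) : p = q := by
  refine List.Perm.eq_of_pairwise (fun a b _ _ h1 h2 => (lt_asymm h1 h2).elim) hp hq ?_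
  exact List.perm_of_nodup_nodup_toFinset_eq (hp.imp fun h => h.ne) (hq.imp fun h => h.ne) h

open Classical in
theorem IsIncr.card_toFinset {x y : V} {p : List V} (hp : IsIncr y x p) :
    p.toFinset.card = p.length :=
  List.toFinset_card_of_nodup (hp.pairwise.imp fun h => h.ne)

open Classical in
theorem IsIncr.exists_of_subset {x y : V} {p : List V} (hp : IsIncr y x p) {F : Finset V}
    (hF : F ⊆ p.toFinset) : ∃ q, IsIncr y x q ∧ q.toFinset = F := by
  refine ⟨p.filter (· ∈ F), isIncr_of_pairwise hp.lt (hp.pairwise.filter _)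
    fun z hz => hp.mem_Ioo (List.mem_of_mem_filter hz), ?_⟩
  ext z
  simp only [List.mem_toFinset, List.mem_filter, decide_eq_true_eq]
  exact ⟨fun h => h.2, fun h => ⟨List.mem_toFinset.1 (hF h), h⟩⟩

open Classical in
theorem mem_orderComplex_Ioo {x y : V} (hxy : x < y) {F : Finset V} :
    F ∈ (orderComplex (Set.Ioo x y)).faces ↔ ∃ p, IsIncr y x p ∧ p.toFinset = F := by
  constructor
  · rintro ⟨h1, h2⟩
    obtain ⟨p, hp, rfl⟩ := exists_pairwise_toFinset h2
    exact ⟨p, isIncr_of_pairwise hxy hp fun z hz => h1 (by simpa using hz), rfl⟩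
  · rintro ⟨p, hp, rfl⟩
    refine ⟨fun z hz => hp.mem_Ioo (by simpa using hz), fun a ha b hb hab => ?_⟩
    have ha : a ∈ p := by simpa using ha
    have hb : b ∈ p := by simpa using hb
    have h := (hp.pairwise.imp (S := fun a b => a ≤ b ∨ b ≤ a) fun h => Or.inl h.le)
    have : Std.Symm (fun a b : V => a ≤ b ∨ b ≤ a) := ⟨fun _ _ h => h.symm⟩
    exact h.forall ha hb hab

end Chains

/-! ### The simplicial boundary and adjoining a least vertex. -/

section Boundary

variable (k : Type v) [Field k] {V : Type u}

theorem chains_le {Δ : FaceComplex V} {n : ℤ} {N : Submodule k (ChainSpace k V)}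
    (h : ∀ F ∈ Δ.faces, (F.card : ℤ) - 1 = n → face k F ∈ N) : Δ.chains k n ≤ N := by
  refine Submodule.span_le.2 ?_
  rintro _ ⟨F, ⟨h1, h2⟩, rfl⟩
  exact h F h1 h2

theorem face_mem_chains {Δ : FaceComplex V} {n : ℤ} {F : Finset V} (h : F ∈ Δ.faces)
    (hn : (F.card : ℤ) - 1 = n) : face k F ∈ Δ.chains k n :=
  Submodule.subset_span ⟨F, ⟨h, hn⟩, rfl⟩

variable [PartialOrder V]

theorem boundary_mem_chains (Δ : FaceComplex V) (n : ℤ) :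
    ∀ c ∈ Δ.chains k n, boundary k c ∈ Δ.chains k (n - 1) := by
  classical
  refine chains_le k (N := (Δ.chains k (n - 1)).comap (boundary k)) fun F hF hn => ?_
  rw [Submodule.mem_comap, boundary_face]
  refine Submodule.sum_mem _ fun v hv => Submodule.smul_mem _ _ (face_mem_chains k
    (Δ.down_closed hF (Finset.erase_subset _ _)) ?_)
  have h1 := Finset.card_erase_add_one hv
  have h2 : (F.card : ℤ) = (F.erase v).card + 1 := by exact_mod_cast h1.symm
  linarith

open Classical in
/-- The linear extension of `F ↦ F ∪ {v}`. -/
noncomputable def coneLin (v : V) : ChainSpace k V →ₗ[k] ChainSpace k V :=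
  Finsupp.linearCombination k fun F => face k (insert v F)

open Classical in
theorem coneLin_face (v : V) (F : Finset V) : coneLin k v (face k F) = face k (insert v F) := by
  unfold coneLin face
  erw [Finsupp.linearCombination_single, one_smul]

-- Deleting the new least vertex has sign +1, and the positions of all other vertices shift by one,
-- which flips their signs. This is the same recursion as the one defining `merge`, so the two
-- operators can be compared by induction.
open Classical in
theorem boundary_face_insert {v : V} {F : Finset V} (h : ∀ u ∈ F, v < u) :
    boundary k (face k (insert v F)) = face k F - coneLin k v (boundary k (face k F)) := by
  have hv : v ∉ F := fun hv => lt_irrefl v (h v hv)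
  rw [boundary_face, Finset.sum_insert hv, boundary_face, map_sum, sub_eq_add_neg,
    ← Finset.sum_neg_distrib]
  congr 1
  · have e : (insert v F).filter (· < v) = ∅ := by
      rw [Finset.filter_eq_empty_iff]
      intro u hu
      rcases Finset.mem_insert.1 hu with rfl | hu
      · exact lt_irrefl u
      · exact (h u hu).asymm
    rw [e, Finset.card_empty, pow_zero, one_smul, Finset.erase_insert hv]
  · refine Finset.sum_congr rfl fun u hu => ?_
    have hvu := h u hu
    rw [map_smul, coneLin_face, Finset.filter_insert, if_pos hvu, Finset.card_insert_of_notMem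
      (fun h' => hv (Finset.mem_filter.1 h').1), pow_succ, mul_neg_one, neg_smul,
      Finset.erase_insert_of_ne hvu.ne]

end Boundary

/-! ### From faces of the order complex to paths. -/

section Comparison

variable {P : Type u} [PartialOrder P] (hP : ∀ x y : P, (Set.Icc x y).Finite)
  (k : Type v) [Field k] (r : Setoid (NonemptyInterval P)) [IncidenceAxioms r]

-- Membership in the layer asks for a refinement with at least t + 1 vertices, that is with at least
-- t + 2 steps, and the weight is the largest number of steps of a refinement.
open Classical in
include hP in
theorem mem_layer_iff {x y : P} (hxy : x < y) {F : Finset P} {t : ℤ} :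
    F ∈ ((orderComplex (Set.Ioo x y)).layer t).faces ↔ ∃ p, IsIncr y x p ∧ p.toFinset = F ∧
      t + 2 ≤ weight (steps r y x p) := by
  constructor
  · rintro ⟨G, hG, hFG, ht⟩
    obtain ⟨q, hq, rfl⟩ := (mem_orderComplex_Ioo hxy).1 hG
    obtain ⟨p, hp, rfl⟩ := hq.exists_of_subset hFG
    refine ⟨p, hp, rfl, ?_⟩
    have h := (le_weight_steps_iff (r := r) hP hp (q.length + 1)).2 ⟨q, hq, fun z hz => by
      simpa using hFG (List.mem_toFinset.2 hz), le_rfl⟩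
    rw [hq.card_toFinset] at ht
    omega
  · rintro ⟨p, hp, rfl, ht⟩
    obtain ⟨q, hq, hpq, h⟩ := (le_weight_steps_iff (r := r) hP hp _).1 le_rfl
    refine ⟨q.toFinset, (mem_orderComplex_Ioo hxy).2 ⟨q, hq, rfl⟩, fun z hz => ?_, ?_⟩
    · exact List.mem_toFinset.2 (hpq (List.mem_toFinset.1 hz))
    · rw [hq.card_toFinset]
      omega

open Classical in
/-- The map which sends the face `{p₁ < ⋯ < pₘ}` of the order complex of `(x, y)` to the list of
the classes of the successive intervals of `x < p₁ < ⋯ < pₘ < y` if this has weight `j`, and to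
`0` otherwise. -/
noncomputable def chainToPath (y x : P) (j : ℤ) : ChainSpace k P →ₗ[k] (List (IntClass r) →₀ k) :=
  Finsupp.linearCombination k fun F =>
    if h : ∃ p, IsIncr y x p ∧ p.toFinset = F ∧ (weight (steps r y x p) : ℤ) = j then
      Finsupp.single (steps r y x h.choose) 1 else 0

variable {r}

open Classical in
theorem chainToPath_face {x y : P} {p : List P} (hp : IsIncr y x p) (j : ℤ) :
    chainToPath k r y x j (face k p.toFinset) =
      if (weight (steps r y x p) : ℤ) = j then Finsupp.single (steps r y x p) 1 else 0 := by
  have e : chainToPath k r y x j (face k p.toFinset) =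
      if h : ∃ q, IsIncr y x q ∧ q.toFinset = p.toFinset ∧ (weight (steps r y x q) : ℤ) = j then
        Finsupp.single (steps r y x h.choose) 1 else 0 := by
    unfold chainToPath face
    erw [Finsupp.linearCombination_single, one_smul]
  rw [e]
  -- An increasing list is determined by its set of entries, so the chosen list is p itself.
  have hu : ∀ q, IsIncr y x q → q.toFinset = p.toFinset → q = p := fun q hq h =>
    eq_of_pairwise_of_toFinset_eq hq.pairwise hp.pairwise h
  by_cases h : ∃ q, IsIncr y x q ∧ q.toFinset = p.toFinset ∧ (weight (steps r y x q) : ℤ) = j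
  · have h1 := h.choose_spec
    have h2 := hu _ h1.1 h1.2.1
    rw [dif_pos h, if_pos (h2 ▸ h1.2.2), h2]
  · rw [dif_neg h, if_neg fun h' => h ⟨p, hp, rfl, h'⟩]

open Classical in
theorem chainToPath_coneLin {x y v : P} (hxv : x < v) (j : ℤ) {q : List P} (hq : IsIncr y v q) :
    chainToPath k r y x j (coneLin k v (face k q.toFinset)) =
      Finsupp.lmapDomain k k (List.cons (cl r x v))
        (chainToPath k r y v (j - rk (cl r x v)) (face k q.toFinset)) := by
  have hq' : IsIncr y x (v :: q) := ⟨hxv, hq⟩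
  rw [coneLin_face, ← List.toFinset_cons, chainToPath_face k hq', chainToPath_face k hq]
  have e : (weight (steps r y x (v :: q)) : ℤ) = j ↔
      (weight (steps r y v q) : ℤ) = j - rk (cl r x v) := by
    simp only [steps, weight_cons]
    push_cast
    constructor <;> intro h <;> linarith
  by_cases h : (weight (steps r y x (v :: q)) : ℤ) = j
  · rw [if_pos h, if_pos (e.1 h), Finsupp.lmapDomain_apply, Finsupp.mapDomain_single]
    rfl
  · rw [if_neg h, if_neg (h ∘ e.2), map_zero]

include hP in
open Classical in
/-- The simplicial boundary corresponds to `merge`. -/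
theorem chainToPath_boundary_face {x y : P} {p : List P} (hp : IsIncr y x p) {j : ℤ}
    (hj : j ≤ weight (steps r y x p)) :
    chainToPath k r y x j (boundary k (face k p.toFinset)) =
      if (weight (steps r y x p) : ℤ) = j then merge k (steps r y x p) else 0 := by
  induction p generalizing x j with
  | nil =>
    have h1 : boundary k (face k (∅ : Finset P)) = 0 := by
      rw [boundary_face, Finset.sum_empty]
    rw [List.toFinset_nil, h1, map_zero, show merge k (steps r y x []) = 0 from rfl, ite_self]
  | cons v p ih =>
    have hv : ∀ u ∈ p.toFinset, v < u := fun u hu =>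
      (hp.2.mem_Ioo (List.mem_toFinset.1 hu)).1
    -- Coning with v prepends the step from x to v, whose rank is taken off the weight required in
    -- (v, y).
    have hcone : chainToPath k r y x j (coneLin k v (boundary k (face k p.toFinset))) =
        Finsupp.lmapDomain k k (List.cons (cl r x v))
          (chainToPath k r y v (j - rk (cl r x v)) (boundary k (face k p.toFinset))) := by
      rw [boundary_face]
      simp only [map_sum, map_smul]
      refine Finset.sum_congr rfl fun u _ => ?_
      obtain ⟨q, hq, hqF⟩ := hp.2.exists_of_subset (Finset.erase_subset u p.toFinset)
      rw [← hqF, chainToPath_coneLin k hp.1 j hq]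
    have hw : (weight (steps r y x (v :: p)) : ℤ) = rk (cl r x v) + weight (steps r y v p) := by
      simp only [steps, weight_cons]
      push_cast
      rfl
    have hj' : j - rk (cl r x v) ≤ weight (steps r y v p) := by linarith
    have hdrop : IsIncr y x p := isIncr_of_pairwise hp.lt hp.2.pairwise fun z hz =>
      hp.mem_Ioo (List.mem_cons_of_mem _ hz)
    rw [List.toFinset_cons, boundary_face_insert k hv, map_sub, hcone, ih hp.2 hj',
      chainToPath_face k hdrop]
    -- Here u is the point after v, or y if v is the last vertex. Dropping v replaces the steps to v
    -- and on to u by the single step from x to u and leaves the tail l unchanged.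
    have hm : ∃ u l, steps r y v p = cl r v u :: l ∧ steps r y x p = cl r x u :: l ∧ v < u := by
      cases p with
      | nil => exact ⟨y, [], rfl, rfl, hp.2⟩
      | cons u p => exact ⟨u, steps r y u p, rfl, rfl, hp.2.1⟩
    obtain ⟨u, l, e1, e2, hvu⟩ := hm
    rw [hw] at hj
    rw [hw, e1, e2, steps, e1]
    rw [e1] at hj
    have hc := comp_cl (r := r) hp.1.le hvu.le
    have ht : target (cl r x v) = source (cl r v u) := by
      rw [target_cl hp.1.le, source_cl hvu.le]
    have hle := rk_add_le hP ht
    rw [hc] at hle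
    simp only [weight_cons, Nat.cast_add] at hj ⊢
    have hle' : (rk (cl r x v) : ℤ) + rk (cl r v u) ≤ rk (cl r x u) := by exact_mod_cast hle
    -- At weight exactly j, dropping v keeps the weight if and only if the ranks of the two steps
    -- add up, which is the condition under which `merge` composes them.
    by_cases h : (rk (cl r x v) : ℤ) + (rk (cl r v u) + weight l) = j
    · rw [if_pos h, if_pos (show (rk (cl r v u) : ℤ) + weight l = j - rk (cl r x v) by linarith),
        merge, hc]
      congr 1
      by_cases hg : Good (cl r x v) (cl r v u)
      · have h2 := hg.2
        rw [hc] at h2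
        have h3 : (rk (cl r x u) : ℤ) = rk (cl r x v) + rk (cl r v u) := by exact_mod_cast h2
        rw [if_pos hg, if_pos (by linarith)]
      · rw [if_neg hg, if_neg]
        intro h2
        refine hg ⟨ht, ?_⟩
        rw [hc]
        have : (rk (cl r x u) : ℤ) = rk (cl r x v) + rk (cl r v u) := by linarith
        exact_mod_cast this
    -- Above weight j everything vanishes, since superadditivity prevents a deletion from lowering
    -- the weight back to j.
    · have h3 : j < (rk (cl r x v) : ℤ) + (rk (cl r v u) + weight l) :=
        lt_of_le_of_ne hj (Ne.symm h)
      rw [if_neg h, if_neg (show ¬ (rk (cl r x u) : ℤ) + weight l = j by intro h'; linarith),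
        if_neg (show ¬ (rk (cl r v u) : ℤ) + weight l = j - rk (cl r x v) by intro h'; linarith),
        map_zero, sub_zero]

end Comparison

/-! ### Relative homology of consecutive layers. -/

section RelativeHomology

variable {P : Type u} [PartialOrder P] (hP : ∀ x y : P, (Set.Icc x y).Finite)
  (k : Type v) [Field k] {r : Setoid (NonemptyInterval P)} [IncidenceAxioms r]

variable (r) in
open Classical in
/-- The linear map which sends the path given by a chain `x < p₁ < ⋯ < pₘ < y` to the face
`{p₁, …, pₘ}`. -/
noncomputable def pathToChain (y x : P) : (List (IntClass r) →₀ k) →ₗ[k] ChainSpace k P :=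
  Finsupp.linearCombination k fun l =>
    if h : ∃ p, IsIncr y x p ∧ steps r y x p = l then face k h.choose.toFinset else 0

open Classical in
theorem pathToChain_single {x y : P} {p : List P} (hp : IsIncr y x p) :
    pathToChain k r y x (Finsupp.single (steps r y x p) 1) = face k p.toFinset := by
  have h : ∃ q, IsIncr y x q ∧ steps r y x q = steps r y x p := ⟨p, hp, rfl⟩
  unfold pathToChain
  rw [Finsupp.linearCombination_single, one_smul, dif_pos h,
    h.choose_spec.1.steps_injective hp h.choose_spec.2]

/-- The sequential layer `Δ^⟨j⟩` of the order complex `Δ` of `(x, y)`. -/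
abbrev openLayer (x y : P) (j : ℤ) : FaceComplex P := (orderComplex (Set.Ioo x y)).layer j

variable {x y : P} (hxy : x < y)

open Classical in
include hP hxy in
theorem openLayer_chains_le {t n : ℤ} {N : Submodule k (ChainSpace k P)}
    (h : ∀ p, IsIncr y x p → t + 2 ≤ weight (steps r y x p) → (p.length : ℤ) - 1 = n →
      face k p.toFinset ∈ N) : (openLayer x y t).chains k n ≤ N := by
  refine chains_le k fun F hF hn => ?_
  obtain ⟨p, hp, rfl, ht⟩ := (mem_layer_iff hP r hxy).1 hF
  rw [hp.card_toFinset] at hn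
  exact h p hp ht hn

open Classical in
include hP in
theorem face_mem_openLayer_chains {t n : ℤ} {p : List P} (hp : IsIncr y x p)
    (ht : t + 2 ≤ weight (steps r y x p)) (hn : (p.length : ℤ) - 1 = n) :
    face k p.toFinset ∈ (openLayer x y t).chains k n := by
  refine face_mem_chains k ((mem_layer_iff hP r hp.lt).2 ⟨p, hp, rfl, ht⟩) ?_
  rw [hp.card_toFinset]
  exact hn

/-- The weight of a path together with its product. -/
noncomputable def pathLabel (X : PointClass r) (l : List (IntClass r)) : ℤ × IntClass r :=
  (weight l, prodFrom X l)

-- A face of dimension n has n + 1 vertices and cuts [x, y] into n + 2 steps, hence the shift n = i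
-- - 2.
include hP hxy in
theorem chainToPath_mem {j n : ℤ} {i : ℕ} (hi : n = (i : ℤ) - 2) :
    ∀ c ∈ (openLayer x y (j - 2)).chains k n, chainToPath k r y x j c ∈ Finsupp.supported k k
      (pathIndex (Quotient.mk _ x) (Quotient.mk _ y) i ∩
        pathLabel (Quotient.mk _ x) ⁻¹' {(j, cl r x y)}) := by
  classical
  refine openLayer_chains_le (r := r) hP k hxy (N := (Finsupp.supported k k _).comap _)
    fun p hp _ hn => ?_
  rw [Submodule.mem_comap, chainToPath_face k hp]
  split_ifs with h
  · refine Finsupp.single_mem_supported k _ ⟨⟨hp.isPath, ?_⟩, ?_⟩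
    · rw [length_steps]
      omega
    · exact Prod.ext h hp.prodFrom_steps
  · exact zero_mem _

-- In the layer j - 2 all faces have weight at least j, which is the hypothesis of
-- `chainToPath_boundary_face`.
include hP hxy in
theorem chainToPath_boundary {j n : ℤ} :
    ∀ c ∈ (openLayer x y (j - 2)).chains k n,
      chainToPath k r y x j (boundary k c) = mergeLin k r (chainToPath k r y x j c) := by
  classical
  refine openLayer_chains_le (r := r) hP k hxy (N := LinearMap.eqLocus
    (chainToPath k r y x j ∘ₗ boundary k) (mergeLin k r ∘ₗ chainToPath k r y x j))
    fun p hp hw _ => ?_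
  rw [LinearMap.mem_eqLocus, LinearMap.comp_apply, LinearMap.comp_apply,
    chainToPath_boundary_face hP k hp (by linarith), chainToPath_face k hp]
  split_ifs
  · rw [mergeLin_single, one_smul]
  · rw [map_zero]

include hP hxy in
theorem chainToPath_of_mem {j n : ℤ} :
    ∀ c ∈ (openLayer x y (j - 1)).chains k n, chainToPath k r y x j c = 0 := by
  classical
  refine openLayer_chains_le (r := r) hP k hxy (N := LinearMap.ker (chainToPath k r y x j))
    fun p hp hw _ => ?_
  rw [LinearMap.mem_ker, chainToPath_face k hp, if_neg]
  intro h
  linarith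

-- Faces of weight j are recovered exactly, and the others have weight at least j + 1, so they lie
-- in the smaller layer.
include hP hxy in
theorem sub_pathToChain_mem {j n : ℤ} :
    ∀ c ∈ (openLayer x y (j - 2)).chains k n,
      c - pathToChain k r y x (chainToPath k r y x j c) ∈ (openLayer x y (j - 1)).chains k n := by
  classical
  refine openLayer_chains_le (r := r) hP k hxy (N := ((openLayer x y (j - 1)).chains k n).comap
    (LinearMap.id - pathToChain k r y x ∘ₗ chainToPath k r y x j)) fun p hp hw hn => ?_
  rw [Submodule.mem_comap, LinearMap.sub_apply, LinearMap.comp_apply, LinearMap.id_apply,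
    chainToPath_face k hp]
  split_ifs with h
  · rw [pathToChain_single k hp, sub_self]
    exact zero_mem _
  · rw [map_zero, sub_zero]
    refine face_mem_openLayer_chains (r := r) hP k hp ?_ hn
    have : j < weight (steps r y x p) := lt_of_le_of_ne (by linarith) (Ne.symm h)
    linarith

-- Passing to paths of weight j thus amounts to dividing the chains of the layer j - 2 by those of
-- the layer j - 1. Together with `exists_chainToPath_eq`, this identifies relative chains with the
-- part of the complex of paths labelled by j and the class of [x, y].
include hP hxy in
theorem chainToPath_eq_zero_iff {j n : ℤ} {c : ChainSpace k P}
    (hc : c ∈ (openLayer x y (j - 2)).chains k n) :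
    chainToPath k r y x j c = 0 ↔ c ∈ (openLayer x y (j - 1)).chains k n := by
  refine ⟨fun h => ?_, chainToPath_of_mem hP k hxy c⟩
  have h1 := sub_pathToChain_mem (r := r) hP k hxy c hc
  rwa [h, map_zero, sub_zero] at h1

-- Any nonempty path with this product is the list of steps of a chain from x to y. The condition i
-- ≠ 0 excludes the empty list, which `steps` never produces.
include hP hxy in
theorem exists_chainToPath_eq {j n : ℤ} {i : ℕ} (h0 : i ≠ 0) (hi : n = (i : ℤ) - 2) :
    ∀ w ∈ Finsupp.supported k k (pathIndex (Quotient.mk _ x) (Quotient.mk _ y) i ∩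
        pathLabel (Quotient.mk _ x) ⁻¹' {(j, cl r x y)}),
      ∃ c ∈ (openLayer x y (j - 2)).chains k n, chainToPath k r y x j c = w := by
  classical
  refine supported_le k
    (N := ((openLayer x y (j - 2)).chains k n).map (chainToPath k r y x j)) ?_
  rintro l ⟨⟨hl, hli⟩, hlab⟩
  have h1 : (weight l : ℤ) = j := congrArg Prod.fst hlab
  have h2 : prodFrom _ l = cl r x y := congrArg Prod.snd hlab
  cases l with
  | nil => exact (h0 hli.symm).elim
  | cons α l =>
    obtain ⟨p, hp, e⟩ := exists_steps hl hxy.le h2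
    rw [← e] at h1 hli ⊢
    rw [length_steps] at hli
    exact ⟨face k p.toFinset, face_mem_openLayer_chains (r := r) hP k hp (by linarith) (by omega),
      by rw [chainToPath_face k hp, if_pos h1]⟩

theorem merge_mem_label {X Y : PointClass r} (l : List (IntClass r)) (h : IsPath Y X l) :
    merge k l ∈ Finsupp.supported k k (pathLabel X ⁻¹' {pathLabel X l}) :=
  Finsupp.supported_mono (fun _ hm => Prod.ext (congrArg Nat.cast hm.2.2.1) hm.2.2.2)
    (h.merge_mem k)

include hP in
/-- The part of the homology of the complex of paths with a given weight and a given product, in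
terms of relative simplicial homology. -/
theorem nonempty_relHomology_equiv {X Y : PointClass r} {α : IntClass r} (hX : source α = X)
    (hY : target α = Y) (hxy : x < y) (hα : cl r x y = α) (i : ℕ) (j : ℤ) :
    Nonempty (RelHomology k (openLayer x y (j - 2)) (openLayer x y (j - 1))
        (((i + 1 : ℕ) : ℤ) - 2) ≃ₗ[k]
      pathHomologyPart k X Y (pathPart k X Y (pathLabel X) (i + 1) (j, α))) := by
  subst hα
  rw [source_cl hxy.le] at hX
  rw [target_cl hxy.le] at hY
  subst hX hY
  set n : ℤ := ((i + 1 : ℕ) : ℤ) - 2 with hn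
  have hn1 : n + 1 = ((i + 2 : ℕ) : ℤ) - 2 := by rw [hn]; push_cast; ring
  let X : PointClass r := Quotient.mk _ x
  let Y : PointClass r := Quotient.mk _ y
  have hmem : ∀ z : relCycles k (openLayer x y (j - 2)) (openLayer x y (j - 1)) n,
      chainToPath k r y x j z ∈ Finsupp.supported k k (pathIndex X Y (i + 1) ∩
        pathLabel X ⁻¹' {(j, cl r x y)}) := fun z => chainToPath_mem hP k hxy hn z z.2.1
  let f : relCycles k (openLayer x y (j - 2)) (openLayer x y (j - 1)) n →ₗ[k]
      PathSpace k X Y (i + 1) :=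
    (chainToPath k r y x j ∘ₗ Submodule.subtype _).codRestrict
      (Finsupp.supported k k (pathIndex X Y (i + 1)))
      fun z => Finsupp.supported_mono Set.inter_subset_left (hmem z)
  have hf : ∀ z, pathIncl k X Y (i + 1) (f z) = chainToPath k r y x j z := fun z => rfl
  refine nonempty_quotient_equiv (V := ChainSpace k P) (W := PathSpace k X Y (i + 1))
    (Z' := seqCycles (C := PathSpace k X Y) (pathD k X Y) (i + 1))
    (B' := seqBoundaries (C := PathSpace k X Y) (pathD k X Y) (i + 1))
    (D' := pathPart k X Y (pathLabel X) (i + 1) (j, cl r x y)) f (fun z => ?_) (fun z => ?_)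
    (fun z => ?_) (fun w hw hw' => ?_)
  · change pathD k X Y i (f z) = 0
    apply pathIncl_injective k X Y i
    rw [pathIncl_pathD, hf, ← chainToPath_boundary hP k hxy z z.2.1,
      chainToPath_of_mem hP k hxy _ z.2.2, neg_zero, map_zero]
  · exact Finsupp.supported_mono Set.inter_subset_right (hmem z)
  · constructor
    · rintro ⟨w, hw⟩
      have hz : f z ∈ pathPart k X Y (pathLabel X) (i + 1) (j, cl r x y) :=
        Finsupp.supported_mono Set.inter_subset_right (hmem z)
      -- The bounding element w may have components with other labels; its component with the right
      -- label has the same boundary, and it comes from a chain c.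
      have h1 : pathD k X Y (i + 1) (pathProj k X Y (pathLabel X) (i + 2) (j, cl r x y) w) =
          f z := by
        rw [pathD_pathProj k X Y (merge_mem_label k), hw, pathProj_of_mem k X Y _ _ _ hz]
      obtain ⟨c, hc, e⟩ := exists_chainToPath_eq hP k hxy (Nat.succ_ne_zero _) hn1
        (pathIncl k X Y (i + 2) (pathProj k X Y (pathLabel X) (i + 2) (j, cl r x y) w)) (by
          rw [Finsupp.supported_inter]
          exact ⟨pathIncl_mem k X Y _, pathProj_mem k X Y _ _ _⟩)
      have h2 := congrArg (pathIncl k X Y (i + 1)) h1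
      rw [pathIncl_pathD, ← e, ← chainToPath_boundary hP k hxy c hc, hf] at h2
      have hb := boundary_mem_chains k _ _ c hc
      rw [add_sub_cancel_right] at hb
      -- The differential on paths is minus the merging operator, so it is z + ∂c, not z - ∂c, that
      -- maps to zero and hence lies in the smaller layer.
      have h3 : (z : ChainSpace k P) + boundary k c ∈ (openLayer x y (j - 1)).chains k n := by
        rw [← chainToPath_eq_zero_iff (r := r) hP k hxy (add_mem z.2.1 hb), map_add, ← h2,
          neg_add_cancel]
      have e3 : (z : ChainSpace k P) = boundary k (-c) + (z + boundary k c) := by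
        rw [map_neg]; abel
      rw [e3]
      exact add_mem (Submodule.mem_sup_left ⟨-c, neg_mem hc, rfl⟩) (Submodule.mem_sup_right h3)
    · intro hz
      obtain ⟨_, ⟨c, hc, rfl⟩, g, hg, e⟩ := Submodule.mem_sup.1 hz
      have hc' := Finsupp.supported_mono Set.inter_subset_left
        (chainToPath_mem (r := r) hP k hxy hn1 c hc)
      -- The minus sign compensates the one in the differential on paths.
      refine ⟨-pathMk k X Y _ hc', pathIncl_injective k X Y _ ?_⟩
      rw [pathIncl_pathD, map_neg, map_neg, neg_neg, pathIncl_pathMk, hf, ← e, map_add,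
        chainToPath_of_mem hP k hxy g hg, add_zero, chainToPath_boundary hP k hxy c hc]
  · obtain ⟨c, hc, e⟩ := exists_chainToPath_eq hP k hxy (Nat.succ_ne_zero _) hn
      (pathIncl k X Y (i + 1) w) (by
        rw [Finsupp.supported_inter]
        exact ⟨pathIncl_mem k X Y _, hw'⟩)
    -- That w is a cycle says that ∂c maps to zero, i.e. that c is a relative cycle.
    have hw0 : pathD k X Y i w = 0 := hw
    have h1 := congrArg (pathIncl k X Y i) hw0
    rw [pathIncl_pathD, ← e, ← chainToPath_boundary hP k hxy c hc, map_zero, neg_eq_zero,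
      chainToPath_eq_zero_iff (r := r) hP k hxy (boundary_mem_chains k _ _ c hc)] at h1
    exact ⟨⟨c, hc, h1⟩, pathIncl_injective k X Y _ e⟩

end RelativeHomology

/-! ### Assembly of the Tor formula. -/

section Main

variable {P : Type u} [PartialOrder P] (hP : ∀ x y : P, (Set.Icc x y).Finite)
  (k : Type v) [Field k] {r : Setoid (NonemptyInterval P)} [IncidenceAxioms r]
  (X Y : PointClass r)

theorem isInternal_pathHomologyPart_pathDeg (i : ℕ) :
    DirectSum.IsInternal fun j => pathHomologyPart k X Y (pathDeg k X Y i j) :=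
  isInternal_pathHomologyPart k X Y (f := fun l => (weight l : ℤ))
    (fun _ h => Finsupp.supported_mono (fun _ hm => congrArg Nat.cast hm.2.2.1) (h.merge_mem k)) i

theorem pathDeg_zero_zero : pathDeg k X Y 0 0 = ⊤ := by
  rw [eq_top_iff]
  intro c _
  refine Finsupp.supported_mono ?_ (pathIncl_mem k X Y c)
  rintro l ⟨-, h⟩
  rw [List.length_eq_zero_iff] at h
  subst h
  rfl

theorem pathHomologyPart_top (i : ℕ) :
    pathHomologyPart k X Y (⊤ : Submodule k (PathSpace k X Y i)) = ⊤ := by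
  rw [eq_top_iff]
  intro c _
  induction c using Submodule.Quotient.induction_on with
  | H c => exact ⟨c, trivial, rfl⟩

/-- A path of length 1 has no neighbours to merge. Hence the homology in length 0 is the whole space
of paths of length 0. -/
theorem pathD_zero : pathD k X Y 0 = 0 := by
  refine LinearMap.ext fun c => pathSpace_induction k X Y (s := Set.univ)
    (N := LinearMap.eqLocus (pathD k X Y 0) 0) (fun l hl _ => ?_) (by simp)
  rw [LinearMap.mem_eqLocus, LinearMap.zero_apply]
  apply pathIncl_injective k X Y 0
  obtain ⟨α, rfl⟩ := List.length_eq_one_iff.1 hl.2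
  rw [pathIncl_pathD, pathIncl_pathMk, mergeLin_single, show merge k [α] = 0 from rfl, smul_zero,
    neg_zero, map_zero]

theorem subsingleton_pathHomology_zero (h : X ≠ Y) : Subsingleton (PathHomology k X Y 0) := by
  have h0 : ∀ c : PathSpace k X Y 0, c = 0 := fun c => pathSpace_induction k X Y (s := Set.univ)
    (N := ⊥) (fun l hl _ => by
      obtain ⟨hl, hl'⟩ := hl
      rw [List.length_eq_zero_iff] at hl'
      subst hl'
      exact (h hl).elim) (by simp)
  refine ⟨fun a b => ?_⟩
  induction a using Submodule.Quotient.induction_on with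
  | H a =>
    induction b using Submodule.Quotient.induction_on with
    | H b => exact congrArg Submodule.Quotient.mk (Subtype.ext ((h0 _).trans (h0 _).symm))

theorem nonempty_pathHomology_zero_equiv : Nonempty (PathHomology k X X 0 ≃ₗ[k] k) := by
  have hnil : ([] : List (IntClass r)) ∈ pathIndex X X 0 := ⟨rfl, rfl⟩
  let g : PathSpace k X X 0 →ₗ[k] k := Finsupp.lapply [] ∘ₗ pathIncl k X X 0
  have hg : Function.Bijective g := by
    constructor
    · rw [injective_iff_map_eq_zero]
      intro c hc
      apply pathIncl_injective k X X 0
      rw [map_zero]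
      refine Finsupp.ext fun l => ?_
      by_cases hl : l = []
      · rw [hl]; exact hc
      · refine Finsupp.notMem_support_iff.1 fun h => hl ?_
        exact List.length_eq_zero_iff.1 (pathIncl_mem k X X c h).2
    · intro a
      refine ⟨a • pathMk k X X (Finsupp.single [] 1) (single_mem_path k X X hnil), ?_⟩
      change (Finsupp.lapply [] : (List (IntClass r) →₀ k) →ₗ[k] k) (pathIncl k X X 0 (a • _)) = a
      rw [map_smul, pathIncl_pathMk]
      simp
  have hb : (seqBoundaries (C := PathSpace k X X) (pathD k X X) 0).submoduleOf
      (seqCycles (C := PathSpace k X X) (pathD k X X) 0) = ⊥ := by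
    rw [eq_bot_iff]
    rintro c ⟨w, hw⟩
    rw [pathD_zero] at hw
    exact Subtype.ext hw.symm
  exact ⟨(Submodule.quotEquivOfEqBot _ hb).trans
    (Submodule.topEquiv.trans (LinearEquiv.ofBijective g hg))⟩

-- The degree-j part is the sum of the parts labelled (j, α). In positive length the product of a
-- path from X to Y is a proper class with source X and target Y, so exactly the classes of the
-- index set can contribute, each through its chosen representative.
include hP in
theorem nonempty_pathHomologyPart_equiv (rep : IntClass r → NonemptyInterval P)
    (hrep : ∀ α, Quotient.mk r (rep α) = α) (i : ℕ) (j : ℤ) :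
    Nonempty (pathHomologyPart k X Y (pathDeg k X Y (i + 1) j) ≃ₗ[k]
      ⨁ α : {α : IntClass r // IsProper α ∧ source α = X ∧ target α = Y},
        RelHomology k
          ((orderComplex (Set.Ioo (rep α.1).fst (rep α.1).snd)).layer (j - 2))
          ((orderComplex (Set.Ioo (rep α.1).fst (rep α.1).snd)).layer (j - 1))
          (((i + 1 : ℕ) : ℤ) - 2)) := by
  classical
  have hcl : ∀ α, cl r (rep α).fst (rep α).snd = α := fun α =>
    (cl_of_le (rep α).fst_le_snd).trans (hrep α)
  have e1 : ∀ α : {α : IntClass r // IsProper α ∧ source α = X ∧ target α = Y},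
      Nonempty (RelHomology k
          ((orderComplex (Set.Ioo (rep α.1).fst (rep α.1).snd)).layer (j - 2))
          ((orderComplex (Set.Ioo (rep α.1).fst (rep α.1).snd)).layer (j - 1))
          (((i + 1 : ℕ) : ℤ) - 2) ≃ₗ[k]
        pathHomologyPart k X Y (pathPart k X Y (pathLabel X) (i + 1) (j, α.1))) := fun α =>
    nonempty_relHomology_equiv hP k α.2.2.1 α.2.2.2
      (lt_of_isProper_cl (r := r) (rep α.1).fst_le_snd ((hcl α.1).symm ▸ α.2.1)) (hcl α.1) i j
  let g : {α : IntClass r // IsProper α ∧ source α = X ∧ target α = Y} → ℤ × IntClass r :=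
    fun α => (j, α.1)
  have hint := isInternal_pathHomologyPart k X Y (merge_mem_label k) (i + 1)
  -- A subfamily, with j fixed and α varying, of the independent family of all labelled parts.
  have hind : iSupIndep fun α => pathHomologyPart k X Y
      (pathPart k X Y (pathLabel X) (i + 1) (g α)) :=
    hint.submodule_iSupIndep.comp fun α β h => Subtype.ext (congrArg Prod.snd h)
  have hsup : ⨆ α, pathHomologyPart k X Y (pathPart k X Y (pathLabel X) (i + 1) (g α)) =
      pathHomologyPart k X Y (pathDeg k X Y (i + 1) j) := by
    apply le_antisymm
    · refine iSup_le fun α => homologyPart_mono (C := PathSpace k X Y) fun c hc => ?_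
      exact Finsupp.supported_mono (M := k) (R := k)
        (show pathLabel X ⁻¹' {g α} ⊆ {l : List (IntClass r) | (weight l : ℤ) = j} from
          fun l hl => congrArg Prod.fst hl) hc
    · refine pathHomologyPart_le_iSup k X Y (merge_mem_label k) g fun l hl hj => ?_
      obtain ⟨hl, hli⟩ := hl
      cases l with
      | nil => cases hli
      | cons α l =>
        exact ⟨⟨_, hl.isProper_prodFrom, hl.source_prodFrom, hl.target_prodFrom⟩,
          Prod.ext (Eq.symm hj) rfl⟩
  -- The supremum is the range of the summation map, which independence makes injective; so the
  -- degree-j part is an external direct sum.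
  rw [Submodule.iSup_eq_range_dfinsupp_lsum] at hsup
  exact ⟨((DFinsupp.mapRange.linearEquiv fun α => (e1 α).some).trans
    ((LinearEquiv.ofInjective _ hind.dfinsupp_lsum_injective).trans
      (LinearEquiv.ofEq _ _ hsup))).symm⟩

variable {k X Y} in
/-- The description of `Tor(k_X, k_Y)` computed from a graded projective resolution of `k_Y`. -/
def HasSimplicialTor {R : Type (max u v)} [Ring R] [Algebra k R] [Module R (PointModule k Y)]
    [Module Rᵐᵒᵖ (PointModule k X)] {gr : ℕ → Submodule k R}
    (rep : IntClass r → NonemptyInterval P)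
    (Q : GradedProjectiveResolution.{max u v, v, w} k gr (PointModule k Y) (pointDegree k Y)) :
    Prop :=
  (∀ i, DirectSum.IsInternal (Q.torDegree (pointDegree k X) i)) ∧
    (X = Y → Nonempty (Q.Tor (PointModule k X) 0 ≃ₗ[k] k) ∧
      Q.torDegree (pointDegree k X) 0 0 = ⊤) ∧
    (X ≠ Y → Subsingleton (Q.Tor (PointModule k X) 0)) ∧
    ∀ (i : ℕ) (j : ℤ), 1 ≤ i →
      Nonempty (Q.torDegree (pointDegree k X) i j ≃ₗ[k]
        ⨁ α : {α : IntClass r // IsProper α ∧ source α = X ∧ target α = Y},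
          RelHomology k
            ((orderComplex (Set.Ioo (rep α.1).fst (rep α.1).snd)).layer (j - 2))
            ((orderComplex (Set.Ioo (rep α.1).fst (rep α.1).snd)).layer (j - 1))
            ((i : ℤ) - 2))

include hP in
theorem hasSimplicialTor (rep : IntClass r → NonemptyInterval P)
    (hrep : ∀ α, Quotient.mk r (rep α) = α)
    (Q : GradedProjectiveResolution.{max u v, v, w} k (R := GrR k r)
      (grGrading k r) (PointModule k Y) (pointDegree k Y)) :
    HasSimplicialTor (X := X) rep Q := by
  refine ⟨fun i => ?_, ?_, ?_, ?_⟩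
  · obtain ⟨e, he⟩ := exists_torEquiv_path hP k X Y Q i
    exact isInternal_of_equiv e he (isInternal_pathHomologyPart_pathDeg k X Y i)
  · rintro rfl
    obtain ⟨e, he⟩ := exists_torEquiv_path hP k X X Q 0
    obtain ⟨e'⟩ := nonempty_pathHomology_zero_equiv k X
    have h := he 0
    rw [pathDeg_zero_zero, pathHomologyPart_top, ← LinearEquiv.range e,
      LinearMap.range_eq_map] at h
    exact ⟨⟨e.trans e'⟩, Submodule.map_injective_of_injective e.injective h⟩
  · intro h
    obtain ⟨e, -⟩ := exists_torEquiv_path hP k X Y Q 0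
    have := subsingleton_pathHomology_zero k X Y h
    exact e.toEquiv.subsingleton
  · intro i j hi
    obtain ⟨i, rfl⟩ := Nat.exists_eq_succ_of_ne_zero (Nat.one_le_iff_ne_zero.1 hi)
    obtain ⟨e, he⟩ := exists_torEquiv_path hP k X Y Q (i + 1)
    obtain ⟨e'⟩ := nonempty_pathHomologyPart_equiv hP k X Y rep hrep i j
    exact ⟨(e.submoduleMap _).trans ((LinearEquiv.ofEq _ _ (he j)).trans e')⟩

end Main

end RedInc

theorem corollary4p7 {P : Type u} [PartialOrder P] (hP : ∀ x y : P, (Set.Icc x y).Finite)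
    (k : Type v) [Field k] (r : Setoid (NonemptyInterval P)) [IncidenceAxioms r]
    (rep : IntClass r → NonemptyInterval P) (hrep : ∀ α, Quotient.mk r (rep α) = α)
    (X Y : PointClass r) :
    Nonempty (GradedProjectiveResolution.{max u v, v, max u v} k (R := RedGr k r) (redGrading k r)
      (PointModule k Y) (pointDegree k Y)) ∧
    ∀ Q : GradedProjectiveResolution.{max u v, v, w} k (R := RedGr k r) (redGrading k r)
        (PointModule k Y) (pointDegree k Y),
      (∀ i, DirectSum.IsInternal (Q.torDegree (pointDegree k X) i)) ∧
      (X = Y → Nonempty (Q.Tor (PointModule k X) 0 ≃ₗ[k] k) ∧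
        Q.torDegree (pointDegree k X) 0 0 = ⊤) ∧
      (X ≠ Y → Subsingleton (Q.Tor (PointModule k X) 0)) ∧
      ∀ (i : ℕ) (j : ℤ), 1 ≤ i →
        Nonempty (Q.torDegree (pointDegree k X) i j ≃ₗ[k]
          ⨁ α : {α : IntClass r // IsProper α ∧ source α = X ∧ target α = Y},
            RelHomology k
              ((orderComplex (Set.Ioo (rep α.1).fst (rep α.1).snd)).layer (j - 2))
              ((orderComplex (Set.Ioo (rep α.1).fst (rep α.1).snd)).layer (j - 1))
              ((i : ℤ) - 2)) := by
  refine ⟨⟨barResolution hP k Y⟩, fun Q => ?_⟩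
  -- `GrR k r` unfolds to `RedGr k r` with the same structures, so a resolution over one is a
  -- resolution over the other.
  have h : HasSimplicialTor (R := RedGr k r) (X := X) rep Q := hasSimplicialTor hP k X Y rep hrep Q
  exact h
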